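/- Let $\mathbb{R}^4$ have coordinates $(t,z)=(t^1,t^2,z^1,z^2)$, and consider smooth metrics of arbitrary signature $$\mathbf{g}=b_{ij}(t)\,dt^i dt^j+2f_{ik}(t)\,dt^i dz^k+h_{kl}(t)\,dz^k dz^l,\qquad b_{ij}=b_{ji},\ h_{kl}=h_{lk},\ \det(h_{kl})\neq 0,$$ defined over open sets of values of $t=(t^1,t^2)$. Let $J^m\tau$ be the space of $m$-jets of such metrics, with coordinates $t^i$, $z^k$ and the partial derivatives of $b_{ij},f_{ik},h_{kl}$ with respect to $t^1,t^2$ of orders $0,\dots,m$. Let $\mathfrak{G}$ be the pseudogroup of local diffeomorphisms $P$ of $\mathbb{R}^4$ for which there is a constant matrix $(\alpha^i_j)\in\mathrm{GL}(2,\mathbb{R})$ with $P_*\,\partial/\partial z^j=\alpha^i_j\,\partial/\partial z^i$ (so that locally $\bar t^{\,i}=\phi^i(t)$, $\bar z^{\,i}=\alpha^i_j z^j+\psi^i(t)$ with $\det(\partial\phi^i/\partial t^j)\ne 0$). It acts on these metrics, and hence on $J^m\tau$ through its prolongation $\mathfrak{G}^{(m)}_\tau$. Let $\Xi^\perp$ be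 the distribution orthogonal, with respect to $\mathbf{g}$, to $\partial/\partial z^1$ and $\partial/\partial z^2$. Given a subspace $S\subseteq J^m\tau$, the generic dimension of the orbit space $S/\mathfrak{G}^{(m)}_\tau$ is said to be $N$ if $S$ has an invariant, open and dense subset on which all orbits of $\mathfrak{G}^{(m)}_\tau$ have one and the same dimension $d$, and $N=\dim S-d$. (a) (Orthogonally intransitive case.) Let $S$ be the set of $m$-jets, at points $x$, of metrics for which $\Xi^\perp$ is not integrable (over any neighbourhood of $x$). Then the generic dimension $N_m$ of the orbit space $S/\mathfrak{G}^{(m)}_\tau$ is $N_0=0$, $N_1=6$, $N_2=20$. (b) (Orthogonally transitive case.) Let $S$ be the set of $m$-jets of metrics for which $\Xi^\perp$ is integrable. Then the generic dimension $N_m$ of the orbit space $S/\mathfrak{G}^{(m)}_\tau$ is $N_0=0$, $N_1=4$, $N_2=14$. -/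

import Mathlib

open scoped ContDiff

noncomputable section

namespace GTwo

/-- The plane `ℝ²`. -/
abbrev Plane : Type := Fin 2 → ℝ

/-- The space `ℝ⁴` of adapted coordinates `(t, z) = ((t¹, t²), (z¹, z²))`. It is also the tangent
space at each of its points; the abelian algebra is spanned by `∂/∂z¹, ∂/∂z²`, and its leaves
are the surfaces `t = const`. -/
abbrev Space : Type := Plane × Plane

/-- The values at one point of the metric coefficients `(b_{ij}, f_{ik}, h_{kl})`, with
`b_{ij} = b_{ji}` and `h_{kl} = h_{lk}` (so that there are `3 + 4 + 3` of them). -/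
abbrev Coeff : Type := (Sym2 (Fin 2) → ℝ) × (Fin 2 → Fin 2 → ℝ) × (Sym2 (Fin 2) → ℝ)

def bMat (c : Coeff) : Matrix (Fin 2) (Fin 2) ℝ := Matrix.of fun i j => c.1 s(i, j)

def fMat (c : Coeff) : Matrix (Fin 2) (Fin 2) ℝ := Matrix.of fun i k => c.2.1 i k

def hMat (c : Coeff) : Matrix (Fin 2) (Fin 2) ℝ := Matrix.of fun k l => c.2.2 s(k, l)

/-- The Gram matrix of `b_{ij} dtⁱ dtʲ + 2 f_{ik} dtⁱ dzᵏ + h_{kl} dzᵏ dzˡ`. -/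
def gMat (c : Coeff) : Matrix (Fin 2 ⊕ Fin 2) (Fin 2 ⊕ Fin 2) ℝ :=
  Matrix.fromBlocks (bMat c) (fMat c) (fMat c).transpose (hMat c)

/-- The symmetric bilinear form `b_{ij} dtⁱ dtʲ + 2 f_{ik} dtⁱ dzᵏ + h_{kl} dzᵏ dzˡ`. -/
def gForm (c : Coeff) (u v : Space) : ℝ :=
  Sum.elim u.1 u.2 ⬝ᵥ (gMat c).mulVec (Sum.elim v.1 v.2)

/-- The coefficient functions `σ = (b, f, h)` of `t` define, over the set `Ω` of values of `t`,
a smooth (semi-Riemannian) metric of arbitrary signature, whose restriction to the leaves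
`t = const` is nondegenerate. -/
def IsMetricOn (σ : Plane → Coeff) (Ω : Set Plane) : Prop :=
  ContDiffOn ℝ ∞ σ Ω ∧ ∀ t ∈ Ω, (gMat (σ t)).det ≠ 0 ∧ (hMat (σ t)).det ≠ 0

/-- The fibre of the distribution `Ξ^⊥`: the vectors orthogonal to `∂/∂z¹, ∂/∂z²`. -/
def orthLeaf (c : Coeff) : Set Space := {v | ∀ w : Plane, gForm c v (0, w) = 0}

/-- `Ξ^⊥` is integrable over `Ω`: through every point `y` of `Ω × ℝ²` there passes an integral
manifold, i.e. a smoothly immersed surface `e : W → Ω × ℝ²` whose tangent spaces are the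
fibres of `Ξ^⊥`. -/
def OrthIntegrableOn (σ : Plane → Coeff) (Ω : Set Plane) : Prop :=
  ∀ y : Space, y.1 ∈ Ω → ∃ (W : Set Plane) (e : Plane → Space),
    IsOpen W ∧ ContDiffOn ℝ ∞ e W ∧ (∃ w ∈ W, e w = y) ∧
    ∀ w ∈ W, (e w).1 ∈ Ω ∧ Function.Injective (fderiv ℝ e w) ∧
      Set.range (fderiv ℝ e w) = orthLeaf (σ (e w).1)

/-- `∂σ/∂tⁱ`. -/
def partialDeriv (i : Fin 2) (σ : Plane → Coeff) : Plane → Coeff :=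
  fun t => fderiv ℝ σ t (Pi.single i 1)

/-- Multi-indices `(p, q)` with `p + q ≤ m`. -/
abbrev MultiIndex (m : ℕ) : Type := {p : Fin (m + 1) × Fin (m + 1) // (p.1 : ℕ) + p.2 ≤ m}

/-- The coordinates `(t, z)`, `b_{ij,I}`, `f_{ik,I}`, `h_{kl,I}`, `|I| ≤ m`, of jets of order `m`.
Jets of metrics form an open subset of this space. -/
abbrev JetSpace (m : ℕ) : Type := Space × (MultiIndex m → Coeff)

/-- The `m`-jet at the point `x` of the metric with coefficients `σ`. -/
def jet (m : ℕ) (σ : Plane → Coeff) (x : Space) : JetSpace m :=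
  (x, fun p => (partialDeriv 0)^[(p.1.1 : ℕ)] ((partialDeriv 1)^[(p.1.2 : ℕ)] σ) x.1)

/-- The `m`-jets of orthogonally intransitive metrics: the `m`-jets at `x` of metrics near `x`
for which `Ξ^⊥` is not integrable (over any neighbourhood of `x`). -/
def intransitiveJets (m : ℕ) : Set (JetSpace m) :=
  {θ | ∃ (x : Space) (Ω : Set Plane) (σ : Plane → Coeff), IsOpen Ω ∧ x.1 ∈ Ω ∧ IsMetricOn σ Ω ∧
    (∀ Ω' ⊆ Ω, IsOpen Ω' → x.1 ∈ Ω' → ¬ OrthIntegrableOn σ Ω') ∧ θ = jet m σ x}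

/-- The `m`-jets of orthogonally transitive metrics: the `m`-jets at `x` of metrics near `x`
for which `Ξ^⊥` is integrable. -/
def transitiveJets (m : ℕ) : Set (JetSpace m) :=
  {θ | ∃ (x : Space) (Ω : Set Plane) (σ : Plane → Coeff), IsOpen Ω ∧ x.1 ∈ Ω ∧ IsMetricOn σ Ω ∧
    OrthIntegrableOn σ Ω ∧ θ = jet m σ x}

/-- The pseudogroup `𝔊` of transformations of adapted coordinates: the local diffeomorphisms `P`
of `ℝ⁴` such that `P_* ∂/∂zʲ = αⁱⱼ ∂/∂zⁱ` with constants `α ∈ GL(2, ℝ)`. -/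
def IsAdapted (P : OpenPartialHomeomorph Space Space) : Prop :=
  ContDiffOn ℝ ∞ P P.source ∧ ContDiffOn ℝ ∞ P.symm P.target ∧
    ∃ α : GL (Fin 2) ℝ, ∀ x ∈ P.source, ∀ v : Plane,
      fderiv ℝ P x (0, v) = (0, α.val.mulVec v)

/-- The orbit of an `m`-jet `θ` under the prolonged pseudogroup `𝔊_τ^{(m)}`: `P ∈ 𝔊` carries the
`m`-jet at `x` of a metric `g` to the `m`-jet at `P x` of the metric `g'` with `P^* g' = g`. -/
def jetOrbit (m : ℕ) (θ : JetSpace m) : Set (JetSpace m) :=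
  {θ' | ∃ (P : OpenPartialHomeomorph Space Space) (x : Space) (σ σ' : Plane → Coeff),
    IsAdapted P ∧ x ∈ P.source ∧
    IsMetricOn σ (Prod.fst '' P.source) ∧ IsMetricOn σ' (Prod.fst '' P.target) ∧
    (∀ y ∈ P.source, ∀ u v : Space,
      gForm (σ' (P y).1) (fderiv ℝ P y u) (fderiv ℝ P y v) = gForm (σ y.1) u v) ∧
    θ = jet m σ x ∧ θ' = jet m σ' (P x)}

/-- `S` is the image of a smooth immersion of a second countable `d`-dimensional manifold, given
by the countably many charts `Ω n` of the latter. For nonempty `S` the number `d` is unique. -/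
def HasDimension {E : Type*} [NormedAddCommGroup E] [NormedSpace ℝ E] (S : Set E) (d : ℕ) : Prop :=
  ∃ (Ω : ℕ → Set (EuclideanSpace ℝ (Fin d))) (F : ℕ → EuclideanSpace ℝ (Fin d) → E),
    (∀ n, IsOpen (Ω n) ∧ ContDiffOn ℝ ∞ (F n) (Ω n) ∧
      ∀ p ∈ Ω n, Function.Injective (fderiv ℝ (F n) p)) ∧
    S = ⋃ n, F n '' Ω n

/-- The generic dimension of the orbit space `S / 𝔊_τ^{(m)}` is `N`: there is an invariant, open
and dense subset `U` of the nonempty space `S` of `m`-jets, such that the orbits of the points of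
`U` have one and the same dimension, which is smaller by `N` than the dimension of `S`. -/
def HasGenericOrbitSpaceDim (m : ℕ) (S : Set (JetSpace m)) (N : ℕ) : Prop :=
  S.Nonempty ∧ ∃ (D d : ℕ) (U : Set (JetSpace m)),
    HasDimension S D ∧
    (∃ O : Set (JetSpace m), IsOpen O ∧ U = S ∩ O) ∧ S ⊆ closure U ∧
    (∀ θ ∈ U, jetOrbit m θ ⊆ U) ∧
    (∀ θ ∈ U, HasDimension (jetOrbit m θ) d) ∧
    D = d + N

end GTwo

end

/-!
Besides the leaf metric `h`, the coefficients `(b, f, h)` of a metric determine the quotient metric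
`q = b - f h⁻¹ fᵀ` and the connection `A = f h⁻¹`. Under a transformation
`(t, z) ↦ (φ(t), α z + ψ(t))` with Jacobians `J` of `φ` and `K` of `ψ`, the triple `(q, A, h)`
becomes `(Jᵀ q J, (Jᵀ A + Kᵀ) α⁻ᵀ, αᵀ h α)`, and `Ξ^⊥` is integrable if and only if `A` is closed.

The orbit of a jet is therefore the image of the finite-dimensional manifold of points `x`, matrices
`α` and `(m + 1)`-jets of `φ` and `ψ` at `x`. For `m ≥ 1` this parametrization is an immersion
wherever, among the first derivatives of `h`, some are not trace-free and some not proportional to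
`h`: an element of its kernel consists of a Killing field of `q` and an element of `𝔰𝔬(h)` which
together annihilate the derivatives of `h`, and both vanish. Jets of this kind are dense, so that
dimensions are obtained by counting Taylor coefficients. For integrable `Ξ^⊥` the Taylor
coefficients of `A` are replaced by those of a potential. In order zero, the orbits are open by
Sylvester's law of inertia.

Nonintegrability of `Ξ^⊥` is no restriction on the `m`-jets, as terms of order `m + 1` can be added
to a metric to prevent `A` from being closed near the given point.
-/

open Filter Topology Matrix

noncomputable section

namespace GTwo

attribute [local instance] Matrix.linftyOpNormedRing Matrix.linftyOpNormedAlgebra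

section SameJet

variable {V W E F : Type*} [NormedAddCommGroup V] [NormedSpace ℝ V] [NormedAddCommGroup W]
  [NormedSpace ℝ W] [NormedAddCommGroup E] [NormedSpace ℝ E] [NormedAddCommGroup F]
  [NormedSpace ℝ F] {m n : ℕ} {f g h : V → E} {x : V}

/-- The functions `f` and `g` have the same derivatives of all orders `≤ m` at `x`. -/
def SameJet (m : ℕ) (f g : V → E) (x : V) : Prop :=
  ∀ k ≤ m, iteratedFDeriv ℝ k f x = iteratedFDeriv ℝ k g x

/-- All derivatives of `f` of orders `≤ m` vanish at `x`. -/
def Flat (m : ℕ) (f : V → E) (x : V) : Prop := SameJet m f (fun _ => 0) x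

lemma SameJet.refl (m : ℕ) (f : V → E) (x : V) : SameJet m f f x := fun _ _ => rfl

lemma SameJet.symm (hfg : SameJet m f g x) : SameJet m g f x := fun k hk => (hfg k hk).symm

lemma SameJet.trans (hfg : SameJet m f g x) (hgh : SameJet m g h x) : SameJet m f h x :=
  fun k hk => (hfg k hk).trans (hgh k hk)

lemma SameJet.mono (hfg : SameJet m f g x) (hn : n ≤ m) : SameJet n f g x :=
  fun k hk => hfg k (hk.trans hn)

lemma sameJet_of_eventuallyEq (hfg : f =ᶠ[𝓝 x] g) : SameJet m f g x :=
  fun k _ => (hfg.iteratedFDeriv (𝕜 := ℝ) k).eq_of_nhds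

lemma sameJet_zero_iff : SameJet 0 f g x ↔ f x = g x := by
  refine ⟨fun hfg => ?_, fun hfg k hk => ?_⟩
  · simpa using congrArg (fun L => L 0) (hfg 0 le_rfl)
  · obtain rfl := Nat.le_zero.1 hk
    ext
    simpa using hfg

lemma SameJet.eq (hfg : SameJet m f g x) : f x = g x := sameJet_zero_iff.1 (hfg.mono m.zero_le)

lemma sameJet_succ_iff :
    SameJet (m + 1) f g x ↔ f x = g x ∧ SameJet m (fderiv ℝ f) (fderiv ℝ g) x := by
  have succ_iff : ∀ k, iteratedFDeriv ℝ (k + 1) f x = iteratedFDeriv ℝ (k + 1) g x ↔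
      iteratedFDeriv ℝ k (fderiv ℝ f) x = iteratedFDeriv ℝ k (fderiv ℝ g) x := fun k => by
    rw [iteratedFDeriv_succ_eq_comp_right, iteratedFDeriv_succ_eq_comp_right]
    exact LinearIsometryEquiv.injective _ |>.eq_iff
  refine ⟨fun hfg => ⟨hfg.eq, fun k hk => (succ_iff k).1 (hfg _ (by omega))⟩, fun hfg k hk => ?_⟩
  cases k with
  | zero => exact sameJet_zero_iff.2 hfg.1 0 le_rfl
  | succ k => exact (succ_iff k).2 (hfg.2 k (by omega))

/-- By the formula of Faà di Bruno. -/
lemma SameJet.comp {φ ψ : W → V} {y : W} (hfg : SameJet m f g (φ y)) (hφψ : SameJet m φ ψ y)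
    (hf : ContDiffAt ℝ ∞ f (φ y)) (hg : ContDiffAt ℝ ∞ g (φ y)) (hφ : ContDiffAt ℝ ∞ φ y)
    (hψ : ContDiffAt ℝ ∞ ψ y) : SameJet m (f ∘ φ) (g ∘ ψ) y := by
  intro k hk
  rw [iteratedFDeriv_comp hf hφ (mod_cast le_top),
    iteratedFDeriv_comp (hφψ.eq ▸ hg) hψ (mod_cast le_top), ← hφψ.eq]
  refine Finset.sum_congr rfl fun c _ => ?_
  have outer : ftaylorSeries ℝ f (φ y) c.length = ftaylorSeries ℝ g (φ y) c.length :=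
    hfg _ (c.length_le.trans hk)
  have inner : ∀ i, ftaylorSeries ℝ φ y (c.partSize i) = ftaylorSeries ℝ ψ y (c.partSize i) :=
    fun i => hφψ _ ((c.partSize_le i).trans hk)
  simp only [FormalMultilinearSeries.compAlongOrderedFinpartition, outer, inner]

lemma SameJet.comp_left {φ ψ : W → V} {y : W} (hφψ : SameJet m φ ψ y)
    (hf : ContDiffAt ℝ ∞ f (φ y)) (hφ : ContDiffAt ℝ ∞ φ y) (hψ : ContDiffAt ℝ ∞ ψ y) :
    SameJet m (fun z => f (φ z)) (fun z => f (ψ z)) y :=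
  (SameJet.refl m f _).comp hφψ hf hf hφ hψ

lemma SameJet.prodMk {f' g' : V → F} (hfg : SameJet m f g x) (hfg' : SameJet m f' g' x)
    (hf : ContDiffAt ℝ ∞ f x) (hg : ContDiffAt ℝ ∞ g x) (hf' : ContDiffAt ℝ ∞ f' x)
    (hg' : ContDiffAt ℝ ∞ g' x) : SameJet m (fun y => (f y, f' y)) (fun y => (g y, g' y)) x := by
  intro k hk
  rw [iteratedFDeriv_prodMk hf hf' (mod_cast le_top), iteratedFDeriv_prodMk hg hg'
    (mod_cast le_top), hfg k hk, hfg' k hk]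

lemma SameJet.sum {ι : Type*} {s : Finset ι} {F G : ι → V → E}
    (hFG : ∀ i, SameJet m (F i) (G i) x) (hF : ∀ i, ContDiffAt ℝ ∞ (F i) x)
    (hG : ∀ i, ContDiffAt ℝ ∞ (G i) x) :
    SameJet m (fun y => ∑ i ∈ s, F i y) (fun y => ∑ i ∈ s, G i y) x := by
  intro k hk
  rw [iteratedFDeriv_fun_sum_apply fun i _ => (hF i).of_le (mod_cast le_top),
    iteratedFDeriv_fun_sum_apply fun i _ => (hG i).of_le (mod_cast le_top)]
  exact Finset.sum_congr rfl fun i _ => hFG i k hk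

lemma Flat.mono (hf : Flat m f x) (hn : n ≤ m) : Flat n f x := SameJet.mono hf hn

lemma Flat.congr (hf : Flat m f x) (hfg : f =ᶠ[𝓝 x] g) : Flat m g x :=
  (sameJet_of_eventuallyEq hfg).symm.trans hf

lemma Flat.eq_zero (hf : Flat m f x) : f x = 0 := SameJet.eq hf

lemma flat_zero_iff : Flat 0 f x ↔ f x = 0 := sameJet_zero_iff

lemma flat_succ_iff : Flat (m + 1) f x ↔ f x = 0 ∧ Flat m (fderiv ℝ f) x := by
  rw [Flat, sameJet_succ_iff, fderiv_fun_const]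
  rfl

lemma Flat.fderiv (hf : Flat (m + 1) f x) : Flat m (fderiv ℝ f) x := (flat_succ_iff.1 hf).2

lemma Flat.map {Φ : E × F → W} {σ : V → E} {w : V → F} (hw : Flat m w x)
    (hΦ : ContDiffAt ℝ ∞ Φ (σ x, 0)) (hΦ_zero : ∀ e, Φ (e, 0) = 0) (hσ : ContDiffAt ℝ ∞ σ x)
    (hw' : ContDiffAt ℝ ∞ w x) : Flat m (fun y => Φ (σ y, w y)) x := by
  have key := ((SameJet.refl m σ x).prodMk hw hσ hσ hw' contDiffAt_const).comp_left (f := Φ)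
    (by rwa [hw.eq_zero]) (hσ.prodMk hw') (hσ.prodMk contDiffAt_const)
  simp only [hΦ_zero] at key
  exact key

lemma Flat.comp {w : W → V} {y : W} (hw : Flat m w y) (hf : ContDiffAt ℝ ∞ f 0) (hf0 : f 0 = 0)
    (hw' : ContDiffAt ℝ ∞ w y) : Flat m (fun z => f (w z)) y :=
  hw.map (Φ := fun p : ℝ × V => f p.2) (σ := fun _ => 0)
    (hf.comp ((0 : ℝ), (0 : V)) contDiffAt_snd) (fun _ => hf0)
    contDiffAt_const hw'

lemma Flat.prodMk {f' : V → F} (hf : Flat m f x) (hf' : Flat m f' x) (sf : ContDiffAt ℝ ∞ f x)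
    (sf' : ContDiffAt ℝ ∞ f' x) : Flat m (fun y => (f y, f' y)) x :=
  SameJet.prodMk hf hf' sf contDiffAt_const sf' contDiffAt_const

lemma Flat.add (hf : Flat m f x) (hg : Flat m g x) (sf : ContDiffAt ℝ ∞ f x)
    (sg : ContDiffAt ℝ ∞ g x) : Flat m (fun y => f y + g y) x :=
  (hf.prodMk hg sf sg).comp (f := fun p : E × E => p.1 + p.2) (by fun_prop) (add_zero 0)
    (sf.prodMk sg)

lemma Flat.sub (hf : Flat m f x) (hg : Flat m g x) (sf : ContDiffAt ℝ ∞ f x)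
    (sg : ContDiffAt ℝ ∞ g x) : Flat m (fun y => f y - g y) x :=
  (hf.prodMk hg sf sg).comp (f := fun p : E × E => p.1 - p.2) (by fun_prop) (sub_zero 0)
    (sf.prodMk sg)

end SameJet

section DirDeriv

variable {V E : Type*} [NormedAddCommGroup V] [NormedSpace ℝ V] [NormedAddCommGroup E]
  [NormedSpace ℝ E] {m : ℕ} {f g : V → E} {x : V}

lemma contDiffAt_fderiv (hf : ContDiffAt ℝ ∞ f x) : ContDiffAt ℝ ∞ (fderiv ℝ f) x :=
  hf.fderiv_right (by simp)

lemma eventually_differentiableAt (hf : ContDiffAt ℝ ∞ f x) :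
    ∀ᶠ y in 𝓝 x, DifferentiableAt ℝ f y :=
  ((hf.of_le (m := 1) (mod_cast le_top)).eventually (by simp)).mono
    fun _ hy => hy.differentiableAt (by simp)

/-- The derivative of `f` in the constant direction `w`; the partial derivatives of functions on
`ℝ²` are those in the directions `Pi.single i 1`. -/
def dirDeriv (w : V) (f : V → E) : V → E := fun x => fderiv ℝ f x w

lemma contDiffAt_dirDeriv (w : V) (hf : ContDiffAt ℝ ∞ f x) : ContDiffAt ℝ ∞ (dirDeriv w f) x :=
  (contDiffAt_fderiv hf).clm_apply contDiffAt_const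

lemma contDiffAt_dirDeriv_iterate (w : V) (hf : ContDiffAt ℝ ∞ f x) (n : ℕ) :
    ContDiffAt ℝ ∞ ((dirDeriv w)^[n] f) x := by
  induction n generalizing f with
  | zero => exact hf
  | succ _ ih => exact ih (contDiffAt_dirDeriv w hf)

lemma fderiv_dirDeriv (hf : DifferentiableAt ℝ (fderiv ℝ f) x) (v w : V) :
    fderiv ℝ (dirDeriv w f) x v = fderiv ℝ (fderiv ℝ f) x v w := by
  unfold dirDeriv
  rw [fderiv_clm_apply hf (differentiableAt_const _)]
  simp

lemma dirDeriv_congr (hfg : f =ᶠ[𝓝 x] g) (w : V) : dirDeriv w f =ᶠ[𝓝 x] dirDeriv w g :=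
  (hfg.fderiv (𝕜 := ℝ)).mono fun y hy => by rw [dirDeriv, dirDeriv, hy]

lemma dirDeriv_iterate_congr (hfg : f =ᶠ[𝓝 x] g) (w : V) (n : ℕ) :
    (dirDeriv w)^[n] f =ᶠ[𝓝 x] (dirDeriv w)^[n] g := by
  induction n generalizing f g with
  | zero => exact hfg
  | succ _ ih => exact ih (dirDeriv_congr hfg w)

lemma dirDeriv_comm (hf : ContDiffAt ℝ ∞ f x) (v w : V) :
    dirDeriv v (dirDeriv w f) =ᶠ[𝓝 x] dirDeriv w (dirDeriv v f) := by
  have hf2 : ContDiffAt ℝ 2 f x := hf.of_le (by norm_cast)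
  have hd := eventually_differentiableAt (contDiffAt_fderiv hf)
  filter_upwards [hf2.eventually (by simp), hd] with y hy hdy
  have hsymm : IsSymmSndFDerivAt ℝ f y := hy.isSymmSndFDerivAt (by simp)
  change fderiv ℝ (dirDeriv w f) y v = fderiv ℝ (dirDeriv v f) y w
  rw [fderiv_dirDeriv hdy, fderiv_dirDeriv hdy, hsymm.eq]

lemma dirDeriv_iterate_comm (hf : ContDiffAt ℝ ∞ f x) (v w : V) (n : ℕ) :
    (dirDeriv v)^[n] (dirDeriv w f) =ᶠ[𝓝 x] dirDeriv w ((dirDeriv v)^[n] f) := by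
  induction n generalizing f with
  | zero => rfl
  | succ n ih =>
    exact (dirDeriv_iterate_congr (dirDeriv_comm hf v w) v n).trans
      (ih (contDiffAt_dirDeriv v hf))

lemma SameJet.dirDeriv (hfg : SameJet (m + 1) f g x) (hf : ContDiffAt ℝ ∞ f x)
    (hg : ContDiffAt ℝ ∞ g x) (w : V) : SameJet m (dirDeriv w f) (dirDeriv w g) x :=
  (sameJet_succ_iff.1 hfg).2.comp_left (f := fun L : V →L[ℝ] E => L w) (by fun_prop)
    (contDiffAt_fderiv hf) (contDiffAt_fderiv hg)

lemma dirDeriv_zero (w : V) : dirDeriv w (fun _ : V => (0 : E)) = fun _ => 0 := by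
  funext y
  simp [dirDeriv]

lemma Flat.dirDeriv (hf : Flat (m + 1) f x) (sf : ContDiffAt ℝ ∞ f x) (w : V) :
    Flat m (dirDeriv w f) x := by
  have key := SameJet.dirDeriv hf sf contDiffAt_const w
  rwa [dirDeriv_zero] at key

end DirDeriv

section Coordinates

variable {ι E : Type*} [Fintype ι] [DecidableEq ι] [NormedAddCommGroup E] [NormedSpace ℝ E]
  {m : ℕ} {f g : (ι → ℝ) → E} {x : ι → ℝ}

/-- `∂f/∂xⁱ`. -/
abbrev pderiv (i : ι) (f : (ι → ℝ) → E) : (ι → ℝ) → E := dirDeriv (Pi.single i 1) f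

lemma fderiv_eq_sum_pderiv (f : (ι → ℝ) → E) (x v : ι → ℝ) :
    fderiv ℝ f x v = ∑ i, v i • pderiv i f x := by
  conv_lhs => rw [pi_eq_sum_univ' v, map_sum]
  exact Finset.sum_congr rfl fun i _ => map_smul _ _ _

lemma sameJet_succ_iff_pderiv (hf : ContDiffAt ℝ ∞ f x) (hg : ContDiffAt ℝ ∞ g x) :
    SameJet (m + 1) f g x ↔ f x = g x ∧ ∀ i, SameJet m (pderiv i f) (pderiv i g) x := by
  refine ⟨fun hfg => ⟨hfg.eq, fun i => hfg.dirDeriv hf hg _⟩, fun ⟨h0, hfg⟩ => ?_⟩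
  have fderiv_eq : ∀ f : (ι → ℝ) → E, fderiv ℝ f = fun y =>
      ∑ i, (ContinuousLinearMap.proj (R := ℝ) (φ := fun _ : ι => ℝ) i).smulRight (pderiv i f y) :=
    fun f => funext fun y => ContinuousLinearMap.ext fun v => by
      simp [fderiv_eq_sum_pderiv f y v]
  refine sameJet_succ_iff.2 ⟨h0, ?_⟩
  rw [fderiv_eq f, fderiv_eq g]
  have smooth_coord : ∀ {h : (ι → ℝ) → E}, ContDiffAt ℝ ∞ h x → ∀ i, ContDiffAt ℝ ∞ (fun y =>
      (ContinuousLinearMap.proj (R := ℝ) (φ := fun _ : ι => ℝ) i).smulRight (pderiv i h y)) x :=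
    fun hh i => contDiffAt_const.smulRight (contDiffAt_dirDeriv _ hh)
  exact SameJet.sum (fun i => (hfg i).comp_left
    (f := fun e => (ContinuousLinearMap.proj (R := ℝ) (φ := fun _ : ι => ℝ) i).smulRight e)
    (contDiffAt_const.smulRight contDiffAt_id) (contDiffAt_dirDeriv _ hf)
    (contDiffAt_dirDeriv _ hg)) (smooth_coord hf) (smooth_coord hg)

end Coordinates

section JetSpace

variable {E : Type*} [NormedAddCommGroup E] [NormedSpace ℝ E] {m : ℕ}

lemma sameJet_iff_pderiv_iterate {f g : Plane → E} {t : Plane} (hf : ContDiffAt ℝ ∞ f t)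
    (hg : ContDiffAt ℝ ∞ g t) : SameJet m f g t ↔ ∀ a b, a + b ≤ m →
      (pderiv 0)^[a] ((pderiv 1)^[b] f) t = (pderiv 0)^[a] ((pderiv 1)^[b] g) t := by
  induction m generalizing f g with
  | zero =>
    refine sameJet_zero_iff.trans ⟨fun h a b hab => ?_, fun h => h 0 0 le_rfl⟩
    obtain ⟨rfl, rfl⟩ : a = 0 ∧ b = 0 := by omega
    exact h
  | succ m ih =>
    have pderiv_zero : ∀ {h : Plane → E}, ContDiffAt ℝ ∞ h t → ∀ a b,
        (pderiv 0)^[a] ((pderiv 1)^[b] (pderiv 0 h)) t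
          = (pderiv 0)^[a + 1] ((pderiv 1)^[b] h) t := fun hh a b =>
      (dirDeriv_iterate_congr (dirDeriv_iterate_comm hh _ _ b) _ a).eq_of_nhds
    rw [sameJet_succ_iff_pderiv hf hg, Fin.forall_fin_two,
      ih (contDiffAt_dirDeriv _ hf) (contDiffAt_dirDeriv _ hg),
      ih (contDiffAt_dirDeriv _ hf) (contDiffAt_dirDeriv _ hg)]
    refine ⟨fun ⟨h, h0, h1⟩ a b hab => ?_, fun h => ⟨h 0 0 (by omega), fun a b hab => ?_,
      fun a b hab => h a (b + 1) (by omega)⟩⟩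
    · rcases b with _ | b
      · rcases a with _ | a
        · exact h
        · exact h0 a 0 (by omega)
      · exact h1 a b (by omega)
    · rw [pderiv_zero hf, pderiv_zero hg]
      exact h (a + 1) b (by omega)

lemma flat_iff_pderiv_iterate {f : Plane → E} {t : Plane} (hf : ContDiffAt ℝ ∞ f t) :
    Flat m f t ↔ ∀ a b, a + b ≤ m → (pderiv 0)^[a] ((pderiv 1)^[b] f) t = 0 := by
  rw [Flat, sameJet_iff_pderiv_iterate hf contDiffAt_const]
  simp only [Function.iterate_fixed (dirDeriv_zero _)]

lemma jet_eq_jet_iff {σ τ : Plane → Coeff} {x : Space} (hσ : ContDiffAt ℝ ∞ σ x.1)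
    (hτ : ContDiffAt ℝ ∞ τ x.1) : jet m σ x = jet m τ x ↔ SameJet m σ τ x.1 := by
  rw [sameJet_iff_pderiv_iterate hσ hτ]
  refine ⟨fun h a b hab => ?_, fun h => Prod.ext rfl (funext fun I => h _ _ I.2)⟩
  exact congrFun (congrArg Prod.snd h) ⟨(⟨a, by omega⟩, ⟨b, by omega⟩), hab⟩

end JetSpace

section Dimension

variable {V E : Type*} [NormedAddCommGroup V] [NormedSpace ℝ V] [FiniteDimensional ℝ V]
  [NormedAddCommGroup E] [NormedSpace ℝ E]

lemma hasDimension_image {Ω : Set V} (hΩ : IsOpen Ω) {f : V → E} (hf : ContDiff ℝ ∞ f)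
    (himm : ∀ p ∈ Ω, ∀ v, fderiv ℝ f p v = 0 → v = 0) :
    HasDimension (f '' Ω) (Module.finrank ℝ V) := by
  obtain ⟨L⟩ : Nonempty (EuclideanSpace ℝ (Fin (Module.finrank ℝ V)) ≃L[ℝ] V) :=
    FiniteDimensional.nonempty_continuousLinearEquiv_of_finrank_eq (by simp)
  refine ⟨fun _ => L ⁻¹' Ω, fun _ => f ∘ L, fun _ => ⟨hΩ.preimage L.continuous,
    (hf.comp L.contDiff).contDiffOn, fun p hp => ?_⟩, ?_⟩
  · rw [fderiv_comp p (hf.differentiable (by simp) _) L.differentiableAt, L.fderiv]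
    refine (injective_iff_map_eq_zero _).2 fun v hv => ?_
    exact L.map_eq_zero_iff.1 (himm (L p) hp (L v) hv)
  · rw [Set.iUnion_const, Set.image_comp, Set.image_preimage_eq _ L.surjective]

lemma hasDimension_of_isOpen {S : Set V} (hS : IsOpen S) :
    HasDimension S (Module.finrank ℝ V) := by
  simpa only [Set.image_id] using
    hasDimension_image hS (f := id) contDiff_id fun p _ v hv => by simpa using hv

end Dimension

section JetMap

variable {V E : Type*} [NormedAddCommGroup V] [NormedSpace ℝ V] [NormedAddCommGroup E]
  [NormedSpace ℝ E]

lemma contDiff_dirDeriv_iterate {f : V → E} (hf : ContDiff ℝ ∞ f) (w : V) (n : ℕ) :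
    ContDiff ℝ ∞ ((dirDeriv w)^[n] f) :=
  contDiff_iff_contDiffAt.2 fun _ => contDiffAt_dirDeriv_iterate w hf.contDiffAt n

lemma dirDeriv_iterate_slice {W : Type*} [NormedAddCommGroup W] [NormedSpace ℝ W]
    {G : V × W → E} (hG : ContDiff ℝ ∞ G) (p : V) (w : W) (n : ℕ) :
    (dirDeriv w)^[n] (fun t => G (p, t)) = fun t => (dirDeriv (0, w))^[n] G (p, t) := by
  induction n generalizing G with
  | zero => rfl
  | succ n ih =>
    refine (congrArg (dirDeriv w)^[n] (funext fun t => ?_)).trans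
      (ih (contDiff_dirDeriv_iterate hG (0, w) 1))
    have slice : HasFDerivAt (fun t : W => (p, t)) (ContinuousLinearMap.inr ℝ V W) t :=
      hasFDerivAt_prodMk_right p t
    have chain := ((hG.differentiable (by simp) (p, t)).hasFDerivAt.comp t slice).fderiv
    exact congrArg (fun L => L w) chain

/-- The `m`-jets of the metrics `G (p, ·)` of a family, at points depending on `p`. -/
def jetMap (m : ℕ) (G : V × Plane → Coeff) (π : V →L[ℝ] Space) (p : V) : JetSpace m :=
  jet m (fun t => G (p, t)) (π p)

/-- The derivative `∂^I G` of a family in the directions of the parameters `t`. -/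
def planeDeriv {m : ℕ} (I : MultiIndex m) (G : V × Plane → E) : V × Plane → E :=
  (dirDeriv (0, Pi.single 0 1))^[(I.1.1 : ℕ)] ((dirDeriv (0, Pi.single 1 1))^[(I.1.2 : ℕ)] G)

variable {m : ℕ}

lemma contDiff_planeDeriv {G : V × Plane → E} (hG : ContDiff ℝ ∞ G) (I : MultiIndex m) :
    ContDiff ℝ ∞ (planeDeriv I G) :=
  contDiff_dirDeriv_iterate (contDiff_dirDeriv_iterate hG _ _) _ _

lemma planeDeriv_apply {G : V × Plane → E} (hG : ContDiff ℝ ∞ G) (I : MultiIndex m) (p : V)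
    (t : Plane) : planeDeriv I G (p, t)
      = (pderiv 0)^[(I.1.1 : ℕ)] ((pderiv 1)^[(I.1.2 : ℕ)] fun t => G (p, t)) t := by
  rw [dirDeriv_iterate_slice hG, dirDeriv_iterate_slice (contDiff_dirDeriv_iterate hG _ _)]
  rfl

lemma planeDeriv_dirDeriv {G : V × Plane → E} (hG : ContDiff ℝ ∞ G) (I : MultiIndex m)
    (w x : V × Plane) : planeDeriv I (dirDeriv w G) x = dirDeriv w (planeDeriv I G) x :=
  ((dirDeriv_iterate_congr (dirDeriv_iterate_comm hG.contDiffAt _ w _) _ _).trans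
    (dirDeriv_iterate_comm (contDiff_dirDeriv_iterate hG _ _).contDiffAt _ w _)).eq_of_nhds

variable {G : V × Plane → Coeff} (hG : ContDiff ℝ ∞ G) (π : V →L[ℝ] Space)

include hG

lemma jetMap_eq : jetMap m G π = fun p => (π p, fun I => planeDeriv I G (p, (π p).1)) :=
  funext fun p => Prod.ext rfl (funext fun I => (planeDeriv_apply hG I p _).symm)

lemma contDiff_jetMap : ContDiff ℝ ∞ (jetMap m G π) := by
  rw [jetMap_eq hG]
  exact π.contDiff.prodMk (contDiff_pi.2 fun I => (contDiff_planeDeriv hG I).comp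
    (contDiff_id.prodMk (contDiff_fst.comp π.contDiff)))

lemma flat_of_fderiv_jetMap_eq_zero {p v : V} (hv : fderiv ℝ (jetMap m G π) p v = 0) :
    π v = 0 ∧ Flat m (fun t => fderiv ℝ G (p, t) (v, 0)) (π p).1 := by
  have diff_G : ∀ I : MultiIndex m, HasFDerivAt (fun q => planeDeriv I G (q, (π q).1))
      ((fderiv ℝ (planeDeriv I G) (p, (π p).1)).comp ((ContinuousLinearMap.id ℝ V).prod
        ((ContinuousLinearMap.fst ℝ Plane Plane).comp π))) p := fun I =>
    ((contDiff_planeDeriv hG I).differentiable (by simp) _).hasFDerivAt.comp p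
      ((hasFDerivAt_id p).prodMk ((ContinuousLinearMap.fst ℝ Plane Plane).comp π).hasFDerivAt)
  rw [jetMap_eq hG, (π.hasFDerivAt.prodMk (hasFDerivAt_pi.2 diff_G)).fderiv] at hv
  have hπ : π v = 0 := congrArg Prod.fst hv
  refine ⟨hπ, ?_⟩
  have hv_G : ContDiff ℝ ∞ (dirDeriv (v, 0) G) := contDiff_dirDeriv_iterate hG (v, 0) 1
  refine (flat_iff_pderiv_iterate
    (hv_G.comp (contDiff_prodMk_right p)).contDiffAt).2 fun a b hab => ?_
  let I : MultiIndex m := ⟨(⟨a, by omega⟩, ⟨b, by omega⟩), hab⟩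
  calc (pderiv 0)^[a] ((pderiv 1)^[b] fun t => dirDeriv (v, 0) G (p, t)) (π p).1
      = planeDeriv I (dirDeriv (v, 0) G) (p, (π p).1) := (planeDeriv_apply hv_G I p _).symm
    _ = dirDeriv (v, 0) (planeDeriv I G) (p, (π p).1) := planeDeriv_dirDeriv hG I _ _
    _ = 0 := by simpa [hπ, dirDeriv] using congrFun (congrArg Prod.snd hv) I

end JetMap

section SeparatedVariables

variable {E : Type*} [NormedAddCommGroup E] [NormedSpace ℝ E] {g h : ℝ → ℝ}

lemma hasFDerivAt_mul_smul (hg : ContDiff ℝ ∞ g) (hh : ContDiff ℝ ∞ h) (c t : Plane) (e : E) :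
    HasFDerivAt (fun t : Plane => (g (t 0 - c 0) * h (t 1 - c 1)) • e)
      ((g (t 0 - c 0) • deriv h (t 1 - c 1) • (ContinuousLinearMap.proj 1 : Plane →L[ℝ] ℝ)
        + h (t 1 - c 1) • deriv g (t 0 - c 0) • (ContinuousLinearMap.proj 0 : Plane →L[ℝ] ℝ)
        ).smulRight e) t := by
  have hasFDerivAt_factor : ∀ {k : ℝ → ℝ}, ContDiff ℝ ∞ k → ∀ i : Fin 2,
      HasFDerivAt (fun t : Plane => k (t i - c i))
        (deriv k (t i - c i) • (ContinuousLinearMap.proj i : Plane →L[ℝ] ℝ)) t := fun hk i =>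
    (hk.differentiable (by simp) _).hasDerivAt.comp_hasFDerivAt t
      ((hasFDerivAt_apply i t).sub_const (c i))
  exact ((hasFDerivAt_factor hg 0).mul (hasFDerivAt_factor hh 1)).smul_const e

lemma pderiv_iterate_mul_smul (hg : ContDiff ℝ ∞ g) (hh : ContDiff ℝ ∞ h) (c : Plane) (e : E)
    (a b : ℕ) :
    (pderiv 0)^[a] ((pderiv 1)^[b] fun t : Plane => (g (t 0 - c 0) * h (t 1 - c 1)) • e) =
      fun t => (iteratedDeriv a g (t 0 - c 0) * iteratedDeriv b h (t 1 - c 1)) • e := by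
  induction b generalizing h with
  | succ b ih =>
    rw [Function.iterate_succ_apply, iteratedDeriv_succ', ← ih (contDiff_infty_iff_deriv.1 hh).2]
    refine congrArg (fun f => (pderiv 0)^[a] ((pderiv 1)^[b] f)) (funext fun t => ?_)
    simp [dirDeriv, (hasFDerivAt_mul_smul hg hh c t e).fderiv]
  | zero =>
    induction a generalizing g with
    | zero => simp
    | succ a ih =>
      rw [Function.iterate_succ_apply, iteratedDeriv_succ', ← ih (contDiff_infty_iff_deriv.1 hg).2]
      refine congrArg (pderiv 0)^[a] (funext fun t => ?_)
      simp [dirDeriv, (hasFDerivAt_mul_smul hg hh c t e).fderiv, mul_comm]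

end SeparatedVariables

section Taylor

variable {E : Type*} [NormedAddCommGroup E] [NormedSpace ℝ E]

lemma pderiv_iterate_sum {ι : Type*} {s : Finset ι} {f : ι → Plane → E}
    (hf : ∀ i, ContDiff ℝ ∞ (f i)) (j : Fin 2) (n : ℕ) :
    (pderiv j)^[n] (fun t => ∑ i ∈ s, f i t) = fun t => ∑ i ∈ s, (pderiv j)^[n] (f i) t := by
  induction n generalizing f with
  | zero => rfl
  | succ n ih =>
    refine (congrArg (pderiv j)^[n] (funext fun t => ?_)).trans
      (ih fun i => contDiff_dirDeriv_iterate (hf i) _ 1)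
    simp [dirDeriv, fderiv_fun_sum fun i _ => (hf i).differentiable (by simp) t]

variable {ι : Type*} [Fintype ι]

/-- The polynomial in `t` whose derivative of order `e i` at `c` is `w i`, and whose derivatives of
all other orders at `c` vanish. -/
def taylor (e : ι → ℕ × ℕ) (c : Plane) (w : ι → E) (t : Plane) : E :=
  ∑ i, ((t 0 - c 0) ^ (e i).1 * (t 1 - c 1) ^ (e i).2) •
    (((e i).1.factorial * (e i).2.factorial : ℝ)⁻¹ • w i)

lemma contDiff_taylor {X : Type*} [NormedAddCommGroup X] [NormedSpace ℝ X]
    (e : ι → ℕ × ℕ) {c t : X → Plane} {w : X → ι → E} (hc : ContDiff ℝ ∞ c) (ht : ContDiff ℝ ∞ t)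
    (hw : ContDiff ℝ ∞ w) : ContDiff ℝ ∞ (fun x => taylor e (c x) (w x) (t x)) := by
  unfold taylor
  fun_prop

variable {e : ι → ℕ × ℕ} {c : Plane} {w : ι → E}

open Classical in
lemma pderiv_iterate_taylor (a b : ℕ) : (pderiv 0)^[a] ((pderiv 1)^[b] (taylor e c w)) c
      = ∑ i, if e i = (a, b) then w i else 0 := by
  have smooth_term : ∀ i, ContDiff ℝ ∞ (fun t : Plane =>
      ((t 0 - c 0) ^ (e i).1 * (t 1 - c 1) ^ (e i).2) •
        (((e i).1.factorial * (e i).2.factorial : ℝ)⁻¹ • w i)) := fun i => by fun_prop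
  unfold taylor
  rw [pderiv_iterate_sum smooth_term,
    pderiv_iterate_sum fun i => contDiff_dirDeriv_iterate (smooth_term i) _ _]
  refine Finset.sum_congr rfl fun i _ => ?_
  rw [pderiv_iterate_mul_smul (g := fun s => s ^ (e i).1) (h := fun s => s ^ (e i).2)
    (by fun_prop) (by fun_prop)]
  simp only [sub_self, iteratedDeriv_fun_pow_zero, smul_smul]
  by_cases ha : a = (e i).1 <;> by_cases hb : b = (e i).2 <;>
    simp only [ha, hb, Prod.ext_iff, eq_comm (a := (e i).1), eq_comm (a := (e i).2), and_self,
      and_false, false_and, if_true, if_false, Nat.cast_zero, zero_mul, mul_zero, zero_smul]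
  rw [mul_inv_cancel₀ (by positivity), one_smul]

lemma pderiv_iterate_taylor_apply (he : Function.Injective e) (i : ι) :
    (pderiv 0)^[(e i).1] ((pderiv 1)^[(e i).2] (taylor e c w)) c = w i := by
  classical
  simp [pderiv_iterate_taylor, he.eq_iff]

end Taylor

section TaylorJet

variable {E : Type*} [NormedAddCommGroup E] [NormedSpace ℝ E] {m : ℕ} {f : Plane → E} {c : Plane}

/-- Multi-indices `(p, q)` with `1 ≤ p + q ≤ m + 1`. -/
abbrev PosIndex (m : ℕ) : Type :=
  {p : Fin (m + 2) × Fin (m + 2) // 1 ≤ (p.1 : ℕ) + p.2 ∧ (p.1 : ℕ) + p.2 ≤ m + 1}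

/-- A multi-index as a pair of natural numbers. -/
def ord {k : ℕ} {P : Fin k × Fin k → Prop} (I : Subtype P) : ℕ × ℕ := (I.1.1, I.1.2)

lemma ord_injective {k : ℕ} {P : Fin k × Fin k → Prop} :
    Function.Injective (ord : Subtype P → ℕ × ℕ) := fun _ _ h =>
  Subtype.ext (Prod.ext (Fin.ext (congrArg Prod.fst h)) (Fin.ext (congrArg Prod.snd h)))

/-- The derivatives of `f` at `c` of the orders prescribed by a set of multi-indices. -/
def derivsAt {k : ℕ} {P : Fin k × Fin k → Prop} (f : Plane → E) (c : Plane) (I : Subtype P) : E :=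
  (pderiv 0)^[(ord I).1] ((pderiv 1)^[(ord I).2] f) c

lemma contDiff_taylor_right {ι : Type*} [Fintype ι] (e : ι → ℕ × ℕ) (c : Plane) (w : ι → E) :
    ContDiff ℝ ∞ (taylor e c w) :=
  contDiff_taylor e contDiff_const contDiff_id contDiff_const

lemma sameJet_taylor (hf : ContDiffAt ℝ ∞ f c) :
    SameJet m f (taylor ord c (derivsAt f c : MultiIndex m → E)) c :=
  (sameJet_iff_pderiv_iterate hf (contDiff_taylor_right _ _ _).contDiffAt).2 fun a b hab =>
    (pderiv_iterate_taylor_apply (w := derivsAt f c) ord_injective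
      (⟨(⟨a, by omega⟩, ⟨b, by omega⟩), hab⟩ : MultiIndex m)).symm

lemma taylor_posIndex_self (w : PosIndex m → E) : taylor ord c w c = 0 := by
  classical
  refine (pderiv_iterate_taylor 0 0).trans (Finset.sum_eq_zero fun I _ => if_neg fun h => ?_)
  obtain ⟨h1, h2⟩ := Prod.mk.inj h
  have := I.2.1
  omega

lemma pderiv_iterate_const_add (e : E) {a b : ℕ} (hab : a + b ≠ 0) :
    (pderiv 0)^[a] ((pderiv 1)^[b] fun t => e + f t) = (pderiv 0)^[a] ((pderiv 1)^[b] f) := by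
  have dirDeriv_const_add : ∀ w : Plane, dirDeriv w (fun t => e + f t) = dirDeriv w f := fun w =>
    funext fun t => by rw [dirDeriv, dirDeriv, fderiv_const_add]
  rcases b with _ | b
  · obtain ⟨a, rfl⟩ := Nat.exists_eq_succ_of_ne_zero hab
    exact congrArg (pderiv 0)^[a] (dirDeriv_const_add _)
  · exact congrArg (fun g => (pderiv 0)^[a] ((pderiv 1)^[b] g)) (dirDeriv_const_add _)

lemma sameJet_taylor_posIndex (hf : ContDiffAt ℝ ∞ f c) : SameJet (m + 1) f
    (fun t => f c + taylor ord c (derivsAt f c : PosIndex m → E) t) c := by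
  refine (sameJet_iff_pderiv_iterate hf
    (contDiffAt_const.add (contDiff_taylor_right _ _ _).contDiffAt)).2 fun a b hab => ?_
  by_cases h0 : a + b = 0
  · obtain ⟨rfl, rfl⟩ : a = 0 ∧ b = 0 := by omega
    simp [taylor_posIndex_self]
  · rw [pderiv_iterate_const_add _ h0]
    exact (pderiv_iterate_taylor_apply (w := derivsAt f c) ord_injective
      (⟨(⟨a, by omega⟩, ⟨b, by omega⟩), Nat.one_le_iff_ne_zero.2 h0, hab⟩ : PosIndex m)).symm

lemma eq_zero_of_flat_taylor {k : ℕ} {P : Fin k × Fin k → Prop} [Fintype (Subtype P)]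
    {w : Subtype P → E} (hP : ∀ p, P p → (p.1 : ℕ) + p.2 ≤ m) (h : Flat m (taylor ord c w) c) :
    w = 0 := by
  funext I
  rw [← pderiv_iterate_taylor_apply (c := c) (w := w) ord_injective I]
  exact (flat_iff_pderiv_iterate (contDiff_taylor_right _ _ _).contDiffAt).1 h _ _ (hP _ I.2)

end TaylorJet

section MatrixCalculus

lemma hasDerivAt_transpose {n : Type*} [Finite n] {A : ℝ → Matrix n n ℝ} {A' : Matrix n n ℝ}
    {s : ℝ} (hA : HasDerivAt A A' s) : HasDerivAt (fun s => (A s)ᵀ) A'ᵀ s := by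
  have := Fintype.ofFinite n
  exact hasDerivAt_pi.2 fun i => hasDerivAt_pi.2 fun j =>
    hasDerivAt_pi.1 (hasDerivAt_pi.1 hA j) i

variable {n : Type*} [Fintype n] [DecidableEq n]
  {X : Type*} [NormedAddCommGroup X] [NormedSpace ℝ X] {A : X → Matrix n n ℝ} {x : X}

@[fun_prop]
lemma contDiffAt_transpose (hA : ContDiffAt ℝ ∞ A x) : ContDiffAt ℝ ∞ (fun y => (A y)ᵀ) x :=
  (Matrix.transposeLinearEquiv n n ℝ ℝ).toLinearMap.toContinuousLinearMap.contDiff.contDiffAt.comp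
    x hA

lemma contDiffAt_nonsing_inv (hA : ContDiffAt ℝ ∞ A x) (h : (A x).det ≠ 0) :
    ContDiffAt ℝ ∞ (fun y => (A y)⁻¹) x := by
  obtain ⟨u, hu⟩ := (Matrix.isUnit_iff_isUnit_det (A x)).2 (isUnit_iff_ne_zero.2 h)
  simp only [Matrix.nonsing_inv_eq_ringInverse]
  exact ContDiffAt.comp x (hu ▸ contDiffAt_ringInverse ℝ u) hA

end MatrixCalculus

/-- Real `2 × 2` matrices. -/
abbrev M2 : Type := Matrix (Fin 2) (Fin 2) ℝ

/-- The metric coefficients whose blocks are the symmetrization of `B`, `F`, and the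
symmetrization of `H`. -/
def coeffOf (B F H : M2) : Coeff :=
  (Sym2.lift ⟨fun i j => (B i j + B j i) / 2, fun i j => by ring⟩, fun i k => F i k,
    Sym2.lift ⟨fun i j => (H i j + H j i) / 2, fun i j => by ring⟩)

lemma bMat_coeffOf {B F H : M2} (hB : Bᵀ = B) : bMat (coeffOf B F H) = B := by
  ext i j
  have : B j i = B i j := congrFun (congrFun hB i) j
  simp [bMat, coeffOf, this]

lemma hMat_coeffOf {B F H : M2} (hH : Hᵀ = H) : hMat (coeffOf B F H) = H := by
  ext i j
  have : H j i = H i j := congrFun (congrFun hH i) j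
  simp [hMat, coeffOf, this]

@[simp] lemma bMat_transpose (c : Coeff) : (bMat c)ᵀ = bMat c := by
  ext i j
  simp [bMat, Sym2.eq_swap]

@[simp] lemma hMat_transpose (c : Coeff) : (hMat c)ᵀ = hMat c := by
  ext i j
  simp [hMat, Sym2.eq_swap]

lemma coeff_ext {c c' : Coeff} (hb : bMat c = bMat c') (hf : fMat c = fMat c')
    (hh : hMat c = hMat c') : c = c' := by
  refine Prod.ext (funext fun s => ?_) (Prod.ext hf (funext fun s => ?_))
  · induction s using Sym2.ind with
    | _ i j => exact congrFun (congrFun hb i) j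
  · induction s using Sym2.ind with
    | _ i j => exact congrFun (congrFun hh i) j

section Blocks

@[fun_prop]
lemma contDiff_bMat : ContDiff ℝ ∞ bMat :=
  LinearMap.toContinuousLinearMap (⟨⟨bMat, fun _ _ => rfl⟩, fun _ _ => rfl⟩ : Coeff →ₗ[ℝ] M2)
    |>.contDiff

@[fun_prop]
lemma contDiff_fMat : ContDiff ℝ ∞ fMat :=
  LinearMap.toContinuousLinearMap (⟨⟨fMat, fun _ _ => rfl⟩, fun _ _ => rfl⟩ : Coeff →ₗ[ℝ] M2)
    |>.contDiff

@[fun_prop]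
lemma contDiff_hMat : ContDiff ℝ ∞ hMat :=
  LinearMap.toContinuousLinearMap (⟨⟨hMat, fun _ _ => rfl⟩, fun _ _ => rfl⟩ : Coeff →ₗ[ℝ] M2)
    |>.contDiff

variable {X : Type*} [NormedAddCommGroup X] [NormedSpace ℝ X] {x : X}

lemma isLinearMap_coeffOf :
    IsLinearMap ℝ fun M : M2 × M2 × M2 => coeffOf M.1 M.2.1 M.2.2 where
  map_add M N := by
    refine Prod.ext (funext fun s => ?_) (Prod.ext rfl (funext fun s => ?_)) <;>
    · induction s using Sym2.ind with
      | _ i j =>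
        simp only [coeffOf, Prod.fst_add, Prod.snd_add, Prod.mk_add_mk, Matrix.add_apply,
          Sym2.lift_mk, Pi.add_apply]
        ring
  map_smul a M := by
    refine Prod.ext (funext fun s => ?_) (Prod.ext rfl (funext fun s => ?_)) <;>
    · induction s using Sym2.ind with
      | _ i j =>
        simp only [coeffOf, Prod.smul_fst, Prod.smul_snd, Prod.smul_mk, Matrix.smul_apply,
          Sym2.lift_mk, Pi.smul_apply, smul_eq_mul]
        ring

@[fun_prop]
lemma contDiffAt_coeffOf {B F H : X → M2} (hB : ContDiffAt ℝ ∞ B x) (hF : ContDiffAt ℝ ∞ F x)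
    (hH : ContDiffAt ℝ ∞ H x) : ContDiffAt ℝ ∞ (fun y => coeffOf (B y) (F y) (H y)) x :=
  (LinearMap.toContinuousLinearMap isLinearMap_coeffOf.mk').contDiff.contDiffAt.comp x
    (hB.prodMk (hF.prodMk hH))

end Blocks

lemma gForm_eq (c : Coeff) (u v : Space) :
    gForm c u v = u.1 ⬝ᵥ (bMat c *ᵥ v.1 + fMat c *ᵥ v.2)
      + u.2 ⬝ᵥ ((fMat c)ᵀ *ᵥ v.1 + hMat c *ᵥ v.2) := by
  rw [gForm, gMat, Matrix.fromBlocks_mulVec]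
  simp [sumElim_dotProduct_sumElim]

/-- The linear map `(u, v) ↦ (J u, K u + α v)`, which preserves the leaf directions `(0, v)`. -/
def blockMap (J K α : M2) : Space →L[ℝ] Space :=
  LinearMap.toContinuousLinearMap <|
    ((Matrix.mulVecLin J).comp (LinearMap.fst ℝ Plane Plane)).prod
      ((Matrix.mulVecLin K).coprod (Matrix.mulVecLin α))

lemma blockMap_apply (J K α : M2) (u : Space) :
    blockMap J K α u = (J *ᵥ u.1, K *ᵥ u.1 + α *ᵥ u.2) := rfl

lemma blockMap_injective_iff {J K α : M2} :
    Function.Injective (blockMap J K α) ↔ J.det ≠ 0 ∧ α.det ≠ 0 := by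
  refine (injective_iff_map_eq_zero _).trans ⟨fun h => ?_, fun ⟨hJ, hα⟩ u hu => ?_⟩
  · have hα : α.det ≠ 0 := fun h0 => by
      obtain ⟨v, hv, hαv⟩ := Matrix.exists_mulVec_eq_zero_iff.2 h0
      exact hv (congrArg Prod.snd (h (0, v) (by simp [blockMap_apply, hαv])))
    refine ⟨fun h0 => ?_, hα⟩
    obtain ⟨u, hu, hJu⟩ := Matrix.exists_mulVec_eq_zero_iff.2 h0
    refine hu (congrArg Prod.fst (h (u, -(α⁻¹ *ᵥ (K *ᵥ u))) ?_))
    have cancel : α *ᵥ (α⁻¹ *ᵥ (K *ᵥ u)) = K *ᵥ u := by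
      rw [Matrix.mulVec_mulVec, Matrix.mul_nonsing_inv α (isUnit_iff_ne_zero.2 hα),
        Matrix.one_mulVec]
    rw [blockMap_apply, hJu, Matrix.mulVec_neg, cancel, add_neg_cancel, Prod.mk_zero_zero]
  · obtain ⟨hu₁, hu₂⟩ := Prod.mk.inj ((blockMap_apply J K α u).symm.trans hu)
    have u₁_eq_zero : u.1 = 0 := Matrix.eq_zero_of_mulVec_eq_zero hJ hu₁
    rw [u₁_eq_zero, Matrix.mulVec_zero, zero_add] at hu₂
    exact Prod.ext u₁_eq_zero (Matrix.eq_zero_of_mulVec_eq_zero hα hu₂)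

/-- The coefficients of the pullback of the metric `c` by `blockMap J K α`. -/
def pull (J K α : M2) (c : Coeff) : Coeff :=
  coeffOf (Jᵀ * bMat c * J + Jᵀ * fMat c * K + Kᵀ * (fMat c)ᵀ * J + Kᵀ * hMat c * K)
    ((Jᵀ * fMat c + Kᵀ * hMat c) * α) (αᵀ * hMat c * α)

lemma bMat_pull (J K α : M2) (c : Coeff) : bMat (pull J K α c) =
    Jᵀ * bMat c * J + Jᵀ * fMat c * K + Kᵀ * (fMat c)ᵀ * J + Kᵀ * hMat c * K :=
  bMat_coeffOf (by simp [Matrix.transpose_mul, Matrix.mul_assoc]; ac_rfl)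

lemma fMat_pull (J K α : M2) (c : Coeff) : fMat (pull J K α c) =
    (Jᵀ * fMat c + Kᵀ * hMat c) * α := rfl

lemma hMat_pull (J K α : M2) (c : Coeff) : hMat (pull J K α c) = αᵀ * hMat c * α :=
  hMat_coeffOf (by simp [Matrix.transpose_mul, Matrix.mul_assoc])

lemma gForm_pull (J K α : M2) (c : Coeff) (u v : Space) :
    gForm (pull J K α c) u v = gForm c (blockMap J K α u) (blockMap J K α v) := by
  have h1 : bMat c 1 0 = bMat c 0 1 := congrFun (congrFun (bMat_transpose c) 0) 1
  have h2 : hMat c 1 0 = hMat c 0 1 := congrFun (congrFun (hMat_transpose c) 0) 1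
  simp only [gForm_eq, bMat_pull, fMat_pull, hMat_pull, blockMap_apply]
  simp only [dotProduct, Matrix.mulVec, Fin.sum_univ_two, Matrix.mul_apply, Matrix.add_apply,
    Matrix.transpose_apply, Pi.add_apply, h1, h2]
  ring

lemma gForm_ext {c c' : Coeff} (h : ∀ u v, gForm c u v = gForm c' u v) : c = c' := by
  simp only [gForm_eq] at h
  refine coeff_ext ?_ ?_ ?_ <;> ext i j
  · simpa [dotProduct, Matrix.mulVec, Pi.single_apply] using h (Pi.single i 1, 0) (Pi.single j 1, 0)
  · simpa [dotProduct, Matrix.mulVec, Pi.single_apply] using h (Pi.single i 1, 0) (0, Pi.single j 1)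
  · simpa [dotProduct, Matrix.mulVec, Pi.single_apply] using h (0, Pi.single i 1) (0, Pi.single j 1)

/-- The connection coefficients `f h⁻¹`. -/
def aMat (c : Coeff) : M2 := fMat c * (hMat c)⁻¹

/-- The metric on the quotient by the leaves. -/
def qMat (c : Coeff) : M2 := bMat c - fMat c * (hMat c)⁻¹ * (fMat c)ᵀ

/-- The metric is nondegenerate, and so is its restriction to the leaves. -/
def Nondeg (c : Coeff) : Prop := (gMat c).det ≠ 0 ∧ (hMat c).det ≠ 0

lemma nondeg_iff (c : Coeff) : Nondeg c ↔ (qMat c).det ≠ 0 ∧ (hMat c).det ≠ 0 := by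
  refine and_congr_left fun h => ?_
  have : Invertible (hMat c) := Matrix.invertibleOfIsUnitDet _ (isUnit_iff_ne_zero.2 h)
  rw [gMat, Matrix.det_fromBlocks₂₂, Matrix.invOf_eq_nonsing_inv, qMat]
  simp [h]

lemma qMat_transpose (c : Coeff) : (qMat c)ᵀ = qMat c := by
  simp [qMat, Matrix.transpose_mul, Matrix.transpose_nonsing_inv, Matrix.mul_assoc]

/-- The metric with the given quotient metric `B`, connection coefficients `A` and leaf
metric `H`. -/
def ofReduced (B A H : M2) : Coeff := coeffOf (B + A * H * Aᵀ) (A * H) H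

section Reduced

variable {B A H : M2}

lemma bMat_ofReduced (hB : Bᵀ = B) (hH : Hᵀ = H) : bMat (ofReduced B A H) = B + A * H * Aᵀ :=
  bMat_coeffOf (by simp [Matrix.transpose_mul, Matrix.mul_assoc, hB, hH])

lemma fMat_ofReduced : fMat (ofReduced B A H) = A * H := rfl

lemma hMat_ofReduced (hH : Hᵀ = H) : hMat (ofReduced B A H) = H := hMat_coeffOf hH

lemma aMat_ofReduced (hH : Hᵀ = H) (h : H.det ≠ 0) : aMat (ofReduced B A H) = A := by
  rw [aMat, fMat_ofReduced, hMat_ofReduced hH,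
    Matrix.mul_nonsing_inv_cancel_right _ _ (isUnit_iff_ne_zero.2 h)]

lemma qMat_ofReduced (hB : Bᵀ = B) (hH : Hᵀ = H) (h : H.det ≠ 0) :
    qMat (ofReduced B A H) = B := by
  rw [qMat, bMat_ofReduced hB hH, fMat_ofReduced, hMat_ofReduced hH,
    Matrix.mul_nonsing_inv_cancel_right _ _ (isUnit_iff_ne_zero.2 h), Matrix.transpose_mul, hH,
    Matrix.mul_assoc]
  simp

lemma ofReduced_eq {c : Coeff} (h : (hMat c).det ≠ 0) :
    ofReduced (qMat c) (aMat c) (hMat c) = c := by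
  have hu := isUnit_iff_ne_zero.2 h
  have hf : aMat c * hMat c = fMat c := by
    rw [aMat, Matrix.nonsing_inv_mul_cancel_right _ _ hu]
  refine coeff_ext ?_ ?_ ?_
  · rw [bMat_ofReduced (qMat_transpose c) (hMat_transpose c), hf, qMat, aMat]
    simp [Matrix.transpose_mul, Matrix.transpose_nonsing_inv, Matrix.mul_assoc]
  · rw [fMat_ofReduced, hf]
  · rw [hMat_ofReduced (hMat_transpose c)]

lemma pull_ofReduced (hB : Bᵀ = B) (hH : Hᵀ = H) {J K α : M2} (hα : α.det ≠ 0) :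
    pull J K α (ofReduced B A H)
      = ofReduced (Jᵀ * B * J) ((Jᵀ * A + Kᵀ) * (α⁻¹)ᵀ) (αᵀ * H * α) := by
  have mul_inv_α : α * α⁻¹ = 1 := Matrix.mul_nonsing_inv _ (isUnit_iff_ne_zero.2 hα)
  have inv_transpose_cancel : ∀ M N : M2, M * (α⁻¹)ᵀ * (αᵀ * N) = M * N := fun M N => by
    rw [Matrix.mul_assoc, ← Matrix.mul_assoc _ αᵀ, ← Matrix.transpose_mul, mul_inv_α,
      Matrix.transpose_one, one_mul]
  have hB' : (Jᵀ * B * J)ᵀ = Jᵀ * B * J := by simp [Matrix.transpose_mul, Matrix.mul_assoc, hB]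
  have hH' : (αᵀ * H * α)ᵀ = αᵀ * H * α := by simp [Matrix.transpose_mul, Matrix.mul_assoc, hH]
  refine coeff_ext ?_ ?_ ?_
  · rw [bMat_pull, bMat_ofReduced hB hH, fMat_ofReduced, hMat_ofReduced hH,
      bMat_ofReduced hB' hH', Matrix.mul_assoc αᵀ, inv_transpose_cancel,
      Matrix.transpose_mul (Jᵀ * A + Kᵀ), Matrix.transpose_transpose, Matrix.mul_assoc _ (H * α),
      Matrix.mul_assoc H α, ← Matrix.mul_assoc α, mul_inv_α, one_mul]
    simp only [Matrix.transpose_mul, Matrix.transpose_add, Matrix.transpose_transpose, hH]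
    noncomm_ring
  · rw [fMat_pull, fMat_ofReduced, fMat_ofReduced, hMat_ofReduced hH, Matrix.mul_assoc αᵀ,
      inv_transpose_cancel]
    noncomm_ring
  · rw [hMat_pull, hMat_ofReduced hH, hMat_ofReduced hH']

end Reduced

lemma qMat_pull {c : Coeff} (hc : (hMat c).det ≠ 0) {J K α : M2} (hα : α.det ≠ 0) :
    qMat (pull J K α c) = Jᵀ * qMat c * J := by
  conv_lhs => rw [← ofReduced_eq hc, pull_ofReduced (qMat_transpose c) (hMat_transpose c) hα]
  refine qMat_ofReduced ?_ ?_ ?_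
  · simp [Matrix.transpose_mul, Matrix.mul_assoc, qMat_transpose]
  · simp [Matrix.transpose_mul, Matrix.mul_assoc]
  · simp [hα, hc]

lemma aMat_pull {c : Coeff} (hc : (hMat c).det ≠ 0) {J K α : M2} (hα : α.det ≠ 0) :
    aMat (pull J K α c) = (Jᵀ * aMat c + Kᵀ) * (α⁻¹)ᵀ := by
  conv_lhs => rw [← ofReduced_eq hc, pull_ofReduced (qMat_transpose c) (hMat_transpose c) hα]
  refine aMat_ofReduced ?_ ?_
  · simp [Matrix.transpose_mul, Matrix.mul_assoc]
  · simp [hα, hc]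

lemma nondeg_ofReduced {B A H : M2} (hB : Bᵀ = B) (hH : Hᵀ = H) (hBd : B.det ≠ 0)
    (hHd : H.det ≠ 0) : Nondeg (ofReduced B A H) := by
  rw [nondeg_iff, qMat_ofReduced hB hH hHd, hMat_ofReduced hH]
  exact ⟨hBd, hHd⟩

lemma nondeg_pull {c : Coeff} (hc : Nondeg c) {J K α : M2} (hJ : J.det ≠ 0) (hα : α.det ≠ 0) :
    Nondeg (pull J K α c) := by
  rw [nondeg_iff] at hc ⊢
  rw [qMat_pull hc.2 hα, hMat_pull]
  simp [hJ, hc, hα]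

lemma isOpen_nondeg : IsOpen {c : Coeff | Nondeg c} := by
  have continuous_gMat : Continuous gMat := contDiff_bMat.continuous.matrix_fromBlocks
    contDiff_fMat.continuous contDiff_fMat.continuous.matrix_transpose contDiff_hMat.continuous
  exact (isOpen_ne.preimage continuous_gMat.matrix_det).inter
    (isOpen_ne.preimage contDiff_hMat.continuous.matrix_det)

section Smoothness

variable {X : Type*} [NormedAddCommGroup X] [NormedSpace ℝ X] {x : X} {σ : X → Coeff}

@[fun_prop]
lemma contDiffAt_pull {J K α : X → M2} (hJ : ContDiffAt ℝ ∞ J x) (hK : ContDiffAt ℝ ∞ K x)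
    (hα : ContDiffAt ℝ ∞ α x) (hσ : ContDiffAt ℝ ∞ σ x) :
    ContDiffAt ℝ ∞ (fun y => pull (J y) (K y) (α y) (σ y)) x := by
  unfold pull
  fun_prop

@[fun_prop]
lemma contDiffAt_ofReduced {B A H : X → M2} (hB : ContDiffAt ℝ ∞ B x)
    (hA : ContDiffAt ℝ ∞ A x) (hH : ContDiffAt ℝ ∞ H x) :
    ContDiffAt ℝ ∞ (fun y => ofReduced (B y) (A y) (H y)) x := by
  unfold ofReduced
  fun_prop

lemma contDiffAt_aMat {c : Coeff} (h : (hMat c).det ≠ 0) : ContDiffAt ℝ ∞ aMat c := by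
  unfold aMat
  exact contDiff_fMat.contDiffAt.mul (contDiffAt_nonsing_inv contDiff_hMat.contDiffAt h)

lemma contDiffAt_qMat {c : Coeff} (h : (hMat c).det ≠ 0) : ContDiffAt ℝ ∞ qMat c := by
  unfold qMat
  have := contDiffAt_nonsing_inv contDiff_hMat.contDiffAt h
  fun_prop

end Smoothness

section Skew

lemma eq_smul_of_skew {S : M2} (hS : Sᵀ + S = 0) : S = S 0 1 • !![0, 1; -1, 0] := by
  have hS' : ∀ i j, S j i + S i j = 0 := fun i j => congrFun (congrFun hS i) j
  ext i j
  fin_cases i <;> fin_cases j <;> simp <;> linarith [hS' 0 0, hS' 0 1, hS' 1 1]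

variable {h k Y : M2}

lemma skew_mul (hs : hᵀ = h) (hY : Yᵀ * h + h * Y = 0) : (h * Y)ᵀ + h * Y = 0 := by
  rwa [Matrix.transpose_mul, hs]

lemma eq_zero_of_skew_of_det_eq_zero (hd : h.det ≠ 0) (hs : hᵀ = h) (hY : Yᵀ * h + h * Y = 0)
    (hYd : Y.det = 0) : Y = 0 := by
  have hdet : (h * Y).det = 0 := by rw [Matrix.det_mul, hYd, mul_zero]
  rw [eq_smul_of_skew (skew_mul hs hY), Matrix.det_smul] at hdet
  have entry_eq_zero : (h * Y) 0 1 = 0 := by simpa [Matrix.det_fin_two_of] using hdet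
  rw [← Matrix.nonsing_inv_mul_cancel_left h Y (isUnit_iff_ne_zero.2 hd),
    eq_smul_of_skew (skew_mul hs hY), entry_eq_zero, zero_smul, Matrix.mul_zero]

/-- A nonzero element of the Lie algebra `𝔰𝔬(h)` determines `h` up to a factor, as `h Y` and
`k Y` are proportional to the same skew matrix. -/
lemma proportional_of_skew (hd : h.det ≠ 0) (hs : hᵀ = h) (ks : kᵀ = k)
    (hY : Yᵀ * h + h * Y = 0) (kY : Yᵀ * k + k * Y = 0) (hY0 : Y ≠ 0) (a b c d : Fin 2) :
    h a b * k c d = h c d * k a b := by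
  have hYd : Y.det ≠ 0 := fun h0 => hY0 (eq_zero_of_skew_of_det_eq_zero hd hs hY h0)
  have cross : ((h * Y) 0 1 • k) * Y = ((k * Y) 0 1 • h) * Y := by
    rw [Matrix.smul_mul, Matrix.smul_mul, eq_smul_of_skew (skew_mul hs hY),
      eq_smul_of_skew (skew_mul ks kY)]
    simp [mul_comm]
  have proportional : (h * Y) 0 1 • k = (k * Y) 0 1 • h := by
    simpa only [Matrix.mul_nonsing_inv_cancel_right _ _ (isUnit_iff_ne_zero.2 hYd)] using
      congrArg (· * Y⁻¹) cross
  have entry_ne_zero : (h * Y) 0 1 ≠ 0 := fun h0 => by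
    have hdet : (h * Y).det ≠ 0 := by
      rw [Matrix.det_mul]
      exact mul_ne_zero hd hYd
    rw [eq_smul_of_skew (skew_mul hs hY), h0] at hdet
    simp at hdet
  have entries : ∀ i j, (h * Y) 0 1 * k i j = (k * Y) 0 1 * h i j := fun i j =>
    congrFun (congrFun proportional i) j
  refine mul_left_cancel₀ entry_ne_zero ?_
  linear_combination h a b * entries c d - h c d * entries a b

end Skew

section Rigid

/-- The trace part of some derivative `k i` of the leaf metric `h` is not zero, and neither is the
trace-free part of some `k i`. -/
def Regular (h : M2) (k : Fin 2 → M2) : Prop :=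
  (∃ i, (h.adjugate * k i).trace ≠ 0) ∧ ∃ i a b c d, h a b * k i c d ≠ h c d * k i a b

lemma trace_adjugate_mul_eq_zero {n : Type*} [Fintype n] [DecidableEq n] {h Y : Matrix n n ℝ}
    (hd : h.det ≠ 0) (hY : Yᵀ * h + h * Y = 0) (k : Matrix n n ℝ) :
    (h.adjugate * (Yᵀ * k + k * Y)).trace = 0 := by
  have skew_sandwich : h.det • (h.adjugate * Yᵀ + Y * h.adjugate) = 0 := calc
    _ = h.adjugate * Yᵀ * (h * h.adjugate) + h.adjugate * h * Y * h.adjugate := by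
      simp [Matrix.mul_adjugate, Matrix.adjugate_mul, smul_add]
    _ = h.adjugate * (Yᵀ * h + h * Y) * h.adjugate := by noncomm_ring
    _ = 0 := by rw [hY, Matrix.mul_zero, Matrix.zero_mul]
  rw [Matrix.mul_add, Matrix.trace_add, ← Matrix.mul_assoc, ← Matrix.mul_assoc,
    Matrix.trace_mul_comm _ Y, ← Matrix.trace_add, ← Matrix.mul_assoc, ← Matrix.add_mul,
    (smul_eq_zero.1 skew_sandwich).resolve_left hd, Matrix.zero_mul, Matrix.trace_zero]

/-- Traces of the equations `hk` show that `X` annihilates a vector; hence `X = 0`, being skew with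
respect to `b`, and then `Y` is skew with respect to metrics that are not proportional. -/
lemma Regular.rigid {h b X Y : M2} {k : Fin 2 → M2} (hr : Regular h k) (hd : h.det ≠ 0)
    (hs : hᵀ = h) (bd : b.det ≠ 0) (bs : bᵀ = b) (ks : ∀ i, (k i)ᵀ = k i)
    (hY : Yᵀ * h + h * Y = 0) (hX : Xᵀ * b + b * X = 0)
    (hk : ∀ j, Yᵀ * k j + k j * Y + ∑ c, X c j • k c = 0) : X = 0 ∧ Y = 0 := by
  obtain ⟨⟨i₀, trace_ne_zero⟩, i, a₁, a₂, c₁, c₂, not_proportional⟩ := hr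
  have trace_kernel : Xᵀ *ᵥ (fun i => (h.adjugate * k i).trace) = 0 := by
    ext j
    have trace_hk : (h.adjugate * (Yᵀ * k j + k j * Y + ∑ c, X c j • k c)).trace = 0 := by
      rw [hk j, Matrix.mul_zero, Matrix.trace_zero]
    rw [Matrix.mul_add, Matrix.trace_add, trace_adjugate_mul_eq_zero hd hY, zero_add] at trace_hk
    simpa [Matrix.mulVec, dotProduct, Matrix.mul_add] using trace_hk
  have hXd : X.det = 0 := by
    rw [← Matrix.det_transpose]
    exact Matrix.exists_mulVec_eq_zero_iff.1
      ⟨_, fun h0 => trace_ne_zero (congrFun h0 i₀), trace_kernel⟩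
  obtain rfl := eq_zero_of_skew_of_det_eq_zero bd bs hX hXd
  refine ⟨rfl, by_contra fun hY0 => not_proportional ?_⟩
  exact proportional_of_skew hd hs (ks i) hY (by simpa using hk i) hY0 a₁ a₂ c₁ c₂

end Rigid

section Killing

lemma flat_pi {ι : Type*} [Fintype ι] {V : Type*} [NormedAddCommGroup V] [NormedSpace ℝ V]
    {m : ℕ} {f : V → ι → ℝ} {v : V}
    (hf : ContDiffAt ℝ ∞ f v) (h : ∀ i, Flat m (fun y => f y i) v) : Flat m f v := by
  classical
  have flat_term : ∀ i, SameJet m (fun y => f y i • (Pi.single i 1 : ι → ℝ)) (fun _ => 0) v :=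
    fun i => (h i).comp (f := fun r : ℝ => r • (Pi.single i 1 : ι → ℝ)) (by fun_prop)
      (zero_smul ℝ _) (by fun_prop)
  have flat_sum := SameJet.sum (s := Finset.univ) flat_term (fun i => by fun_prop)
    fun _ => contDiffAt_const
  simp only [Finset.sum_const_zero] at flat_sum
  exact Flat.congr flat_sum (Eventually.of_forall fun y => (pi_eq_sum_univ' (f y)).symm)

variable {ι : Type*} [Fintype ι] [DecidableEq ι] {m : ℕ} {x : ι → ℝ}

lemma flat_succ_iff_pderiv {E : Type*} [NormedAddCommGroup E] [NormedSpace ℝ E]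
    {f : (ι → ℝ) → E} (hf : ContDiffAt ℝ ∞ f x) :
    Flat (m + 1) f x ↔ f x = 0 ∧ ∀ i, Flat m (pderiv i f) x := by
  rw [Flat, sameJet_succ_iff_pderiv hf contDiffAt_const]
  simp only [dirDeriv_zero, Flat]

/-- The second derivatives of `κ` are combinations of the derivatives of `∂_a κ_b + ∂_b κ_a`, as
in the formula for the Christoffel symbols. -/
lemma flat_of_symmetrized_pderiv {κ : (ι → ℝ) → ι → ℝ} (hκ : ContDiffAt ℝ ∞ κ x)
    (h : Flat (m + 1) κ x)
    (hS : ∀ a b, Flat (m + 1) (fun y => pderiv a κ y b + pderiv b κ y a) x) :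
    Flat (m + 2) κ x := by
  have smooth_pderiv : ∀ a, ContDiffAt ℝ ∞ (pderiv a κ) x := fun a => contDiffAt_dirDeriv _ hκ
  have smooth_pderiv₂ : ∀ c a, ContDiffAt ℝ ∞ (pderiv c (pderiv a κ)) x := fun c a =>
    contDiffAt_dirDeriv _ (smooth_pderiv a)
  have flat_sum : ∀ c a b, Flat m
      (fun y => pderiv c (pderiv a κ) y b + pderiv c (pderiv b κ) y a) x := fun c a b => by
    refine ((hS a b).dirDeriv (by fun_prop) (Pi.single c 1)).congr ?_
    filter_upwards [eventually_differentiableAt (smooth_pderiv a),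
      eventually_differentiableAt (smooth_pderiv b)] with y ha hb
    have deriv_sum := (hasFDerivAt_pi'.1 ha.hasFDerivAt b).add (hasFDerivAt_pi'.1 hb.hasFDerivAt a)
    exact congrArg (fun L => L (Pi.single c 1)) deriv_sum.fderiv
  have flat_pderiv₂ : ∀ c a, Flat m (pderiv c (pderiv a κ)) x := fun c a =>
    flat_pi (smooth_pderiv₂ c a) fun b => by
      have flat_double := ((flat_sum c a b).add (flat_sum a b c) (by fun_prop) (by fun_prop)).sub
        (flat_sum b c a) (by fun_prop) (by fun_prop)
      refine (flat_double.comp (f := fun r : ℝ => r / 2) (by fun_prop) (zero_div 2)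
        (by fun_prop)).congr ?_
      filter_upwards [dirDeriv_comm hκ (Pi.single a 1) (Pi.single c 1),
        dirDeriv_comm hκ (Pi.single b 1) (Pi.single a 1),
        dirDeriv_comm hκ (Pi.single c 1) (Pi.single b 1)] with y hac hba hcb
      simp only [hac, hba, hcb]
      ring
  rw [flat_succ_iff_pderiv hκ] at h ⊢
  exact ⟨h.1, fun a => (flat_succ_iff_pderiv (smooth_pderiv a)).2
    ⟨(h.2 a).eq_zero, fun c => flat_pderiv₂ c a⟩⟩

end Killing

/-- The Jacobian matrix of a map of the plane. -/
def jac (φ : Plane → Plane) (t : Plane) : M2 :=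
  LinearMap.toMatrix' (fderiv ℝ φ t : Plane →ₗ[ℝ] Plane)

section Jacobian

variable {m : ℕ} {φ ξ : Plane → Plane} {t : Plane}

lemma jac_mulVec (φ : Plane → Plane) (t v : Plane) : jac φ t *ᵥ v = fderiv ℝ φ t v :=
  LinearMap.toMatrix'_mulVec _ v

lemma transpose_jac_apply (φ : Plane → Plane) (t : Plane) (i : Fin 2) :
    (jac φ t)ᵀ i = pderiv i φ t := by
  ext j
  simp [jac, LinearMap.toMatrix'_apply, dirDeriv]

lemma contDiff_toMatrix' :
    ContDiff ℝ ∞ fun L : Plane →L[ℝ] Plane => LinearMap.toMatrix' (L : Plane →ₗ[ℝ] Plane) :=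
  (LinearMap.toContinuousLinearMap ((LinearMap.toMatrix' (R := ℝ)).toLinearMap ∘ₗ
    ContinuousLinearMap.coeLM ℝ : (Plane →L[ℝ] Plane) →ₗ[ℝ] M2)).contDiff

@[fun_prop]
lemma contDiffAt_jac (hφ : ContDiffAt ℝ ∞ φ t) : ContDiffAt ℝ ∞ (jac φ) t :=
  contDiff_toMatrix'.contDiffAt.comp t (contDiffAt_fderiv hφ)

lemma flat_succ_iff_jac (hξ : ContDiffAt ℝ ∞ ξ t) :
    Flat (m + 1) ξ t ↔ ξ t = 0 ∧ Flat m (jac ξ) t := by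
  refine flat_succ_iff.trans (and_congr_right fun _ => ⟨fun h => ?_, fun h => ?_⟩)
  · exact h.comp contDiff_toMatrix'.contDiffAt (map_zero LinearMap.toMatrix')
      (contDiffAt_fderiv hξ)
  · refine (h.comp (LinearMap.toContinuousLinearMap (LinearMap.toContinuousLinearMap.toLinearMap ∘ₗ
      LinearMap.toMatrix'.symm.toLinearMap)).contDiff.contDiffAt (map_zero _)
      (contDiffAt_jac hξ)).congr (Eventually.of_forall fun s => ?_)
    exact ContinuousLinearMap.coe_injective (LinearMap.toMatrix'.symm_apply_apply _)

end Jacobian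

section KillingMatrix

variable {m : ℕ} {X : Type*} [NormedAddCommGroup X] [NormedSpace ℝ X] {x : X}

lemma isBoundedBilinearMap_vecMul :
    IsBoundedBilinearMap ℝ fun p : Plane × M2 => p.1 ᵥ* p.2 :=
  (LinearMap.toContinuousBilinearMap (Matrix.vecMulBilin ℝ ℝ :
    Plane →ₗ[ℝ] M2 →ₗ[ℝ] Plane)).isBoundedBilinearMap

@[fun_prop]
lemma contDiffAt_vecMul {v : X → Plane} {M : X → M2} (hv : ContDiffAt ℝ ∞ v x)
    (hM : ContDiffAt ℝ ∞ M x) : ContDiffAt ℝ ∞ (fun y => v y ᵥ* M y) x :=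
  isBoundedBilinearMap_vecMul.contDiff.contDiffAt.comp x (hv.prodMk hM)

lemma contDiffAt_entry {M : X → M2} (hM : ContDiffAt ℝ ∞ M x) (a b : Fin 2) :
    ContDiffAt ℝ ∞ (fun y => M y a b) x :=
  (LinearMap.toContinuousLinearMap (Matrix.entryLinearMap ℝ ℝ a b)).contDiff.contDiffAt.comp x hM

lemma Flat.entry {M : X → M2} (h : Flat m M x) (hM : ContDiffAt ℝ ∞ M x) (a b : Fin 2) :
    Flat m (fun y => M y a b) x :=
  h.comp (f := fun N : M2 => N a b) (contDiffAt_entry contDiffAt_id a b) rfl hM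

lemma fderiv_vecMul {v : X → Plane} {M : X → M2} (hv : DifferentiableAt ℝ v x)
    (hM : DifferentiableAt ℝ M x) (w : X) :
    fderiv ℝ (fun y => v y ᵥ* M y) x w = fderiv ℝ v x w ᵥ* M x + v x ᵥ* fderiv ℝ M x w := by
  have h := (isBoundedBilinearMap_vecMul.hasFDerivAt (v x, M x)).comp x
    (hv.hasFDerivAt.prodMk hM.hasFDerivAt)
  exact (congrArg (fun L => L w) h.fderiv).trans (add_comm _ _)

lemma pderiv_vecMul {ξ : Plane → Plane} {B : Plane → M2} {t : Plane}
    (hξ : DifferentiableAt ℝ ξ t) (hB : DifferentiableAt ℝ B t) (i j : Fin 2) :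
    pderiv i (fun s => ξ s ᵥ* B s) t j
      = ((jac ξ t)ᵀ * B t) i j + (ξ t ᵥ* pderiv i B t) j := by
  rw [pderiv, dirDeriv, fderiv_vecMul hξ hB, Matrix.mul_apply_eq_vecMul, transpose_jac_apply]
  rfl

/-- The one-form `κ = B ξ` has a flat symmetrized derivative. -/
lemma flat_of_killing {ξ : Plane → Plane} {B : Plane → M2} {t : Plane}
    (hξ : ContDiffAt ℝ ∞ ξ t) (hB : ContDiffAt ℝ ∞ B t) (hd : (B t).det ≠ 0)
    (flat_ξ : Flat (m + 1) ξ t)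
    (killing : Flat (m + 1) (fun s => (jac ξ s)ᵀ * B s + (B s)ᵀ * jac ξ s) t) :
    Flat (m + 2) ξ t := by
  have smooth_killing : ContDiffAt ℝ ∞ (fun s => (jac ξ s)ᵀ * B s + (B s)ᵀ * jac ξ s) t := by
    fun_prop
  have smooth_entry := contDiffAt_entry smooth_killing
  have smooth_pderiv : ∀ a, ContDiffAt ℝ ∞ (pderiv a B) t := fun a => contDiffAt_dirDeriv _ hB
  have flat_κ : Flat (m + 1) (fun s => ξ s ᵥ* B s) t :=
    flat_ξ.map (Φ := fun p : M2 × Plane => p.2 ᵥ* p.1) (by fun_prop)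
      (fun _ => Matrix.zero_vecMul _) hB hξ
  have flat_symmetrized : ∀ a b, Flat (m + 1) (fun s =>
      pderiv a (fun s => ξ s ᵥ* B s) s b + pderiv b (fun s => ξ s ᵥ* B s) s a) t := fun a b => by
    have flat_rest :
        Flat (m + 1) (fun s => (ξ s ᵥ* pderiv a B s) b + (ξ s ᵥ* pderiv b B s) a) t :=
      flat_ξ.map (Φ := fun p : (M2 × M2) × Plane => (p.2 ᵥ* p.1.1) b + (p.2 ᵥ* p.1.2) a)
        (by fun_prop) (fun _ => by simp) ((smooth_pderiv a).prodMk (smooth_pderiv b)) hξ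
    refine ((killing.entry smooth_killing a b).add flat_rest (smooth_entry a b)
      (by fun_prop)).congr ?_
    filter_upwards [eventually_differentiableAt hξ, eventually_differentiableAt hB] with s hξs hBs
    have transposed : ((B s)ᵀ * jac ξ s) a b = ((jac ξ s)ᵀ * B s) b a := by
      rw [← Matrix.transpose_apply (_ * _), Matrix.transpose_mul, Matrix.transpose_transpose]
    rw [pderiv_vecMul hξs hBs, pderiv_vecMul hξs hBs, Matrix.add_apply, transposed]
    ring
  have flat_lowered := flat_of_symmetrized_pderiv (by fun_prop) flat_κ flat_symmetrized
  have smooth_inv := contDiffAt_nonsing_inv hB hd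
  refine (flat_lowered.map (Φ := fun p : M2 × Plane => p.2 ᵥ* p.1) (by fun_prop)
    (fun _ => Matrix.zero_vecMul _) smooth_inv (by fun_prop)).congr ?_
  have det_ne_zero : ∀ᶠ s in 𝓝 t, (B s).det ≠ 0 :=
    hB.continuousAt.eventually ((continuous_id.matrix_det.continuousAt.eventually_ne hd))
  filter_upwards [det_ne_zero] with s hs
  rw [Matrix.vecMul_vecMul, Matrix.mul_nonsing_inv _ (isUnit_iff_ne_zero.2 hs), Matrix.vecMul_one]

end KillingMatrix

section Rigidity

variable {m : ℕ} {φ ξ : Plane → Plane} {q h : Plane → M2} {t : Plane} {α a : M2}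

lemma contDiffAt_fderiv_apply {V E X : Type*} [NormedAddCommGroup V] [NormedSpace ℝ V]
    [NormedAddCommGroup E] [NormedSpace ℝ E] [NormedAddCommGroup X] [NormedSpace ℝ X]
    {f : V → E} {φ ξ : X → V} {x : X} (hf : ContDiffAt ℝ ∞ f (φ x))
    (hφ : ContDiffAt ℝ ∞ φ x) (hξ : ContDiffAt ℝ ∞ ξ x) :
    ContDiffAt ℝ ∞ (fun y => fderiv ℝ f (φ y) (ξ y)) x :=
  ((contDiffAt_fderiv hf).comp x hφ).clm_apply hξ

lemma Flat.of_congruence {X : Type*} [NormedAddCommGroup X] [NormedSpace ℝ X] {x : X}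
    {M : X → M2} (hM : ContDiffAt ℝ ∞ M x) (hα : α.det ≠ 0)
    (flat : Flat m (fun y => αᵀ * M y * α) x) : Flat m M x := by
  refine (flat.comp (f := fun N => (α⁻¹)ᵀ * N * α⁻¹) (by fun_prop) (by simp) (by fun_prop)).congr
    (Eventually.of_forall fun y => ?_)
  have mul_inv_α : α * α⁻¹ = 1 := Matrix.mul_nonsing_inv _ (isUnit_iff_ne_zero.2 hα)
  calc (α⁻¹)ᵀ * (αᵀ * M y * α) * α⁻¹ = (α * α⁻¹)ᵀ * M y * (α * α⁻¹) := by
        rw [Matrix.transpose_mul]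
        noncomm_ring
    _ = M y := by rw [mul_inv_α, Matrix.transpose_one, one_mul, mul_one]

lemma transpose_fderiv (hs : ∀ t, (h t)ᵀ = h t) (t w : Plane) :
    (fderiv ℝ h t w)ᵀ = fderiv ℝ h t w := by
  let T := (Matrix.transposeLinearEquiv (Fin 2) (Fin 2) ℝ ℝ).toContinuousLinearEquiv
  have T_comp_h : T ∘ h = h := funext hs
  calc (fderiv ℝ h t w)ᵀ = fderiv ℝ (T ∘ h) t w :=
        (congrArg (fun L => L w) (T.comp_fderiv (f := h) (x := t))).symm
    _ = fderiv ℝ h t w := by rw [T_comp_h]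

lemma flat_fderiv_apply (flat : Flat m ξ t) (hq : ContDiffAt ℝ ∞ q (φ t))
    (hφ : ContDiffAt ℝ ∞ φ t) (hξ : ContDiffAt ℝ ∞ ξ t) :
    Flat m (fun s => fderiv ℝ q (φ s) (ξ s)) t :=
  flat.map (Φ := fun p : Plane × Plane => fderiv ℝ q p.1 p.2)
    (contDiffAt_fderiv_apply hq contDiffAt_fst contDiffAt_snd) (fun _ => map_zero _) hφ hξ

lemma fderiv_leaf_variation {Y : M2} (hφ : DifferentiableAt ℝ φ t) (hξ : DifferentiableAt ℝ ξ t)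
    (hh : ContDiffAt ℝ ∞ h (φ t)) (ξ_zero : ξ t = 0) (w : Plane) :
    fderiv ℝ (fun s => Yᵀ * h (φ s) + fderiv ℝ h (φ s) (ξ s) + h (φ s) * Y) t w
      = Yᵀ * fderiv ℝ h (φ t) (jac φ t *ᵥ w) + fderiv ℝ h (φ t) (jac ξ t *ᵥ w)
        + fderiv ℝ h (φ t) (jac φ t *ᵥ w) * Y := by
  have deriv_h : HasFDerivAt (fun s => h (φ s)) ((fderiv ℝ h (φ t)).comp (fderiv ℝ φ t)) t :=
    (hh.differentiableAt (by simp)).hasFDerivAt.comp t hφ.hasFDerivAt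
  have deriv_Dh := (((contDiffAt_fderiv hh).differentiableAt (by simp)).hasFDerivAt.comp t
    hφ.hasFDerivAt).clm_apply hξ.hasFDerivAt
  have total := ((deriv_h.const_mul Yᵀ).add deriv_Dh).add (deriv_h.mul_const' Y)
  refine (congrArg (fun L => L w) total.fderiv).trans ?_
  rw [jac_mulVec, jac_mulVec]
  simp only [Function.comp_apply, ξ_zero, map_zero, add_zero, _root_.add_apply,
    ContinuousLinearMap.comp_apply]
  rfl

/-- The value and the first derivatives of the variation of `h`, and the value of that of `q`, are
the hypotheses of `Regular.rigid` on `X = (jac ξ) (jac φ)⁻¹` and `Y = a α⁻¹`. -/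
lemma jac_eq_zero_of_variation {Y : M2} (hJ : (jac φ t).det ≠ 0)
    (hq : (q (φ t)).det ≠ 0) (qs : (q (φ t))ᵀ = q (φ t))
    (hh : (h (φ t)).det ≠ 0) (hs : ∀ s, (h s)ᵀ = h s)
    (hr : Regular (h (φ t)) fun i => pderiv i h (φ t))
    (hQ : (jac ξ t)ᵀ * q (φ t) * jac φ t + (jac φ t)ᵀ * q (φ t) * jac ξ t = 0)
    (hH : Yᵀ * h (φ t) + h (φ t) * Y = 0)
    (hH' : ∀ w, Yᵀ * fderiv ℝ h (φ t) (jac φ t *ᵥ w) + fderiv ℝ h (φ t) (jac ξ t *ᵥ w)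
      + fderiv ℝ h (φ t) (jac φ t *ᵥ w) * Y = 0) : jac ξ t = 0 ∧ Y = 0 := by
  set J := jac φ t
  have mul_inv_J : J * J⁻¹ = 1 := Matrix.mul_nonsing_inv _ (isUnit_iff_ne_zero.2 hJ)
  have skew_X : (jac ξ t * J⁻¹)ᵀ * q (φ t) + q (φ t) * (jac ξ t * J⁻¹) = 0 := calc
    _ = (J⁻¹)ᵀ * (jac ξ t)ᵀ * q (φ t) * (J * J⁻¹) + (J * J⁻¹)ᵀ * q (φ t) * (jac ξ t * J⁻¹) := by
      rw [mul_inv_J, Matrix.transpose_one, one_mul, mul_one, Matrix.transpose_mul]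
    _ = (J⁻¹)ᵀ * ((jac ξ t)ᵀ * q (φ t) * J + Jᵀ * q (φ t) * jac ξ t) * J⁻¹ := by
      rw [Matrix.transpose_mul]
      noncomm_ring
    _ = 0 := by rw [hQ, Matrix.mul_zero, Matrix.zero_mul]
  have leaf_eq : ∀ j, Yᵀ * pderiv j h (φ t) + pderiv j h (φ t) * Y
      + ∑ c, (jac ξ t * J⁻¹) c j • pderiv c h (φ t) = 0 := fun j => by
    have column_deriv : fderiv ℝ h (φ t) ((jac ξ t * J⁻¹).col j)
        = ∑ c, (jac ξ t * J⁻¹) c j • pderiv c h (φ t) := fderiv_eq_sum_pderiv h _ _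
    have h_w := hH' (J⁻¹ *ᵥ Pi.single j 1)
    rw [Matrix.mulVec_mulVec, Matrix.mulVec_mulVec, mul_inv_J, Matrix.one_mulVec,
      Matrix.mulVec_single_one, column_deriv] at h_w
    rw [← h_w]
    exact add_right_comm _ _ _
  obtain ⟨hX, hY⟩ := hr.rigid hh (hs _) hq qs (fun i => transpose_fderiv hs _ _) hH skew_X leaf_eq
  exact ⟨by rw [← Matrix.nonsing_inv_mul_cancel_right J (jac ξ t) (isUnit_iff_ne_zero.2 hJ), hX,
    Matrix.zero_mul], hY⟩

lemma flat_succ_of_flat_variation (hφ : ContDiffAt ℝ ∞ φ t)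
    (hξ : ContDiffAt ℝ ∞ ξ t) (hq : ContDiffAt ℝ ∞ q (φ t)) (hJ : (jac φ t).det ≠ 0)
    (hqd : (q (φ t)).det ≠ 0) (qs : ∀ s, (q s)ᵀ = q s) (jac_zero : jac ξ t = 0) (ξ_zero : ξ t = 0)
    (hQ : Flat m (fun s => (jac ξ s)ᵀ * q (φ s) * jac φ s
      + (jac φ s)ᵀ * fderiv ℝ q (φ s) (ξ s) * jac φ s + (jac φ s)ᵀ * q (φ s) * jac ξ s) t) :
    Flat (m + 1) ξ t := by
  have : ContDiffAt ℝ ∞ (fun s => q (φ s)) t := hq.comp t hφ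
  have smooth_Dq : ContDiffAt ℝ ∞ (fun s => fderiv ℝ q (φ s) (ξ s)) t :=
    contDiffAt_fderiv_apply hq hφ hξ
  suffices flat : ∀ k ≤ m, Flat (k + 1) ξ t from flat m le_rfl
  intro k hk
  induction k with
  | zero => exact (flat_succ_iff_jac hξ).2 ⟨ξ_zero, flat_zero_iff.2 jac_zero⟩
  | succ k ih =>
    have flat_ξ := ih (by omega)
    have flat_Dq : Flat (k + 1) (fun s => (jac φ s)ᵀ * fderiv ℝ q (φ s) (ξ s) * jac φ s) t :=
      (flat_fderiv_apply flat_ξ hq hφ hξ).map (Φ := fun p : M2 × M2 => p.1ᵀ * p.2 * p.1)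
        (by fun_prop) (fun _ => by simp) (contDiffAt_jac hφ) smooth_Dq
    refine flat_of_killing hξ (B := fun s => q (φ s) * jac φ s) (by fun_prop)
      (by rw [Matrix.det_mul]; exact mul_ne_zero hqd hJ) flat_ξ ?_
    refine ((hQ.mono hk).sub flat_Dq (by fun_prop) (by fun_prop)).congr
      (Eventually.of_forall fun s => ?_)
    simp only [Matrix.transpose_mul, qs, Matrix.mul_assoc]
    abel

lemma rigidity (hφ : ContDiffAt ℝ ∞ φ t) (hξ : ContDiffAt ℝ ∞ ξ t)
    (hq : ContDiffAt ℝ ∞ q (φ t)) (hh : ContDiffAt ℝ ∞ h (φ t)) (hJ : (jac φ t).det ≠ 0)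
    (hα : α.det ≠ 0) (hqd : (q (φ t)).det ≠ 0) (hhd : (h (φ t)).det ≠ 0)
    (qs : ∀ s, (q s)ᵀ = q s) (hs : ∀ s, (h s)ᵀ = h s)
    (hr : Regular (h (φ t)) fun i => pderiv i h (φ t)) (ξ_zero : ξ t = 0)
    (hQ : Flat (m + 1) (fun s => (jac ξ s)ᵀ * q (φ s) * jac φ s
      + (jac φ s)ᵀ * fderiv ℝ q (φ s) (ξ s) * jac φ s + (jac φ s)ᵀ * q (φ s) * jac ξ s) t)
    (hH : Flat (m + 1) (fun s => aᵀ * h (φ s) * α + αᵀ * fderiv ℝ h (φ s) (ξ s) * α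
      + αᵀ * h (φ s) * a) t) :
    Flat (m + 2) ξ t ∧ a = 0 := by
  have : ContDiffAt ℝ ∞ (fun s => h (φ s)) t := hh.comp t hφ
  have smooth_Dh : ContDiffAt ℝ ∞ (fun s => fderiv ℝ h (φ s) (ξ s)) t :=
    contDiffAt_fderiv_apply hh hφ hξ
  have a_eq : a = a * α⁻¹ * α :=
    (Matrix.nonsing_inv_mul_cancel_right α a (isUnit_iff_ne_zero.2 hα)).symm
  set Y := a * α⁻¹
  have flat_leaf :
      Flat (m + 1) (fun s => Yᵀ * h (φ s) + fderiv ℝ h (φ s) (ξ s) + h (φ s) * Y) t := by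
    refine Flat.of_congruence (by fun_prop) hα (hH.congr (Eventually.of_forall fun s => ?_))
    simp only [a_eq, Matrix.transpose_mul]
    noncomm_ring
  have leaf_value : Yᵀ * h (φ t) + h (φ t) * Y = 0 := by
    simpa [ξ_zero] using flat_leaf.eq_zero
  have leaf_deriv := fun w => (fderiv_leaf_variation (Y := Y) (hφ.differentiableAt (by simp))
    (hξ.differentiableAt (by simp)) hh ξ_zero w).symm.trans
      (congrArg (fun L => L w) flat_leaf.fderiv.eq_zero)
  have quotient_value : (jac ξ t)ᵀ * q (φ t) * jac φ t + (jac φ t)ᵀ * q (φ t) * jac ξ t = 0 := by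
    simpa [ξ_zero] using hQ.eq_zero
  obtain ⟨jac_zero, hY⟩ :=
    jac_eq_zero_of_variation hJ hqd (qs _) hhd hs hr quotient_value leaf_value leaf_deriv
  exact ⟨flat_succ_of_flat_variation hφ hξ hq hJ hqd qs jac_zero ξ_zero hQ,
    by rw [a_eq, hY, Matrix.zero_mul]⟩

end Rigidity

section Coordinates

variable {m : ℕ}

/-- The multi-index of order zero. -/
def zeroIndex : MultiIndex m := ⟨(0, 0), Nat.zero_le m⟩

/-- The multi-index of `∂/∂tⁱ`. -/
def unitIndex (i : Fin 2) : MultiIndex (m + 1) :=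
  ![⟨(⟨1, by omega⟩, 0), by simp⟩, ⟨(0, ⟨1, by omega⟩), by simp⟩] i

lemma unitIndex_ne_zeroIndex (i : Fin 2) : (unitIndex i : MultiIndex (m + 1)) ≠ zeroIndex := by
  intro h
  fin_cases i <;> simpa [ord, unitIndex, zeroIndex] using congrArg ord h

/-- The coordinates of order zero of a jet. -/
def jetValue (θ : JetSpace m) : Coeff := θ.2 zeroIndex

/-- The coordinates `∂/∂tⁱ` of order one of a jet. -/
def jetPartial (i : Fin 2) (θ : JetSpace (m + 1)) : Coeff := θ.2 (unitIndex i)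

lemma jetValue_jet (σ : Plane → Coeff) (x : Space) : jetValue (jet m σ x) = σ x.1 := rfl

lemma jetPartial_jet (i : Fin 2) (σ : Plane → Coeff) (x : Space) :
    jetPartial i (jet (m + 1) σ x) = pderiv i σ x.1 := by
  fin_cases i <;> rfl

lemma pderiv_hMat {σ : Plane → Coeff} {t : Plane} (hσ : DifferentiableAt ℝ σ t) (i : Fin 2) :
    pderiv i (fun s => hMat (σ s)) t = hMat (pderiv i σ t) := by
  have chain := (LinearMap.toContinuousLinearMap
    (⟨⟨hMat, fun _ _ => rfl⟩, fun _ _ => rfl⟩ : Coeff →ₗ[ℝ] M2)).hasFDerivAt.comp t hσ.hasFDerivAt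
  exact congrArg (fun L => L (Pi.single i 1)) chain.fderiv

/-- The jets of the metrics whose leaf metric is regular at the point considered. -/
def RegularJet (θ : JetSpace (m + 1)) : Prop :=
  Regular (hMat (jetValue θ)) fun i => hMat (jetPartial i θ)

lemma regularJet_jet_iff {σ : Plane → Coeff} {x : Space} (hσ : DifferentiableAt ℝ σ x.1) :
    RegularJet (jet (m + 1) σ x) ↔
      Regular (hMat (σ x.1)) fun i => pderiv i (fun s => hMat (σ s)) x.1 := by
  simp only [RegularJet, jetValue_jet, jetPartial_jet, pderiv_hMat hσ]

/-- The polynomial metric with a given jet. -/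
def taylorMetric (θ : JetSpace m) : Plane → Coeff := taylor ord θ.1.1 θ.2

@[fun_prop]
lemma contDiff_taylorMetric (θ : JetSpace m) : ContDiff ℝ ∞ (taylorMetric θ) :=
  contDiff_taylor_right _ _ _

lemma jet_taylorMetric (θ : JetSpace m) : jet m (taylorMetric θ) θ.1 = θ :=
  Prod.ext rfl (funext fun I => pderiv_iterate_taylor_apply ord_injective I)

lemma taylorMetric_base (θ : JetSpace m) : taylorMetric θ θ.1.1 = jetValue θ := by
  rw [← jetValue_jet (m := m) (taylorMetric θ), jet_taylorMetric]

lemma sameJet_taylorMetric {σ : Plane → Coeff} {x : Space} (hσ : ContDiffAt ℝ ∞ σ x.1) :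
    SameJet m σ (taylorMetric (jet m σ x)) x.1 :=
  sameJet_taylor hσ

lemma regularJet_iff {θ : JetSpace (m + 1)} : RegularJet θ ↔
    Regular (hMat (jetValue θ)) fun i => pderiv i (fun s => hMat (taylorMetric θ s)) θ.1.1 := by
  rw [← taylorMetric_base, ← regularJet_jet_iff (m := m)
    ((contDiff_taylorMetric θ).differentiable (by simp) _), jet_taylorMetric]

end Coordinates

/-- Parameters for the transformations of adapted coordinates: a point, the linear part in `z`,
and the jets at that point, without their constant terms, of the remaining components. -/
abbrev OrbitParam (m : ℕ) : Type := Space × M2 × (PosIndex m → Plane) × (PosIndex m → Plane)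

namespace OrbitParam

variable {m : ℕ}

/-- The component `φ` of the transformation `(t, z) ↦ (φ(t), α z + ψ(t))`, up to a translation. -/
def phi (p : OrbitParam m) : Plane → Plane := taylor ord p.1.1 p.2.2.1

/-- The component `ψ` of the transformation `(t, z) ↦ (φ(t), α z + ψ(t))`, up to a translation. -/
def psi (p : OrbitParam m) : Plane → Plane := taylor ord p.1.1 p.2.2.2

@[fun_prop]
lemma contDiff_phi : ContDiff ℝ ∞ fun q : OrbitParam m × Plane => q.1.phi q.2 :=
  contDiff_taylor _ (by fun_prop) (by fun_prop) (by fun_prop)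

@[fun_prop]
lemma contDiff_psi : ContDiff ℝ ∞ fun q : OrbitParam m × Plane => q.1.psi q.2 :=
  contDiff_taylor _ (by fun_prop) (by fun_prop) (by fun_prop)

lemma phi_base (p : OrbitParam m) : p.phi p.1.1 = 0 := taylor_posIndex_self _

lemma psi_base (p : OrbitParam m) : p.psi p.1.1 = 0 := taylor_posIndex_self _

end OrbitParam

lemma jac_const_add (φ : Plane → Plane) (c t : Plane) : jac (fun s => c + φ s) t = jac φ t := by
  rw [jac, fderiv_const_add, jac]

lemma contDiff_jac_slice {V : Type*} [NormedAddCommGroup V] [NormedSpace ℝ V]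
    {G : V × Plane → Plane} (hG : ContDiff ℝ ∞ G) :
    ContDiff ℝ ∞ fun q : V × Plane => jac (fun t => G (q.1, t)) q.2 := by
  have chain : ∀ q : V × Plane, fderiv ℝ (fun t => G (q.1, t)) q.2
      = (fderiv ℝ G q).comp (ContinuousLinearMap.inr ℝ V Plane) := fun q =>
    ((hG.differentiable (by simp) q).hasFDerivAt.comp q.2
      (hasFDerivAt_prodMk_right q.1 q.2)).fderiv
  simp only [jac, chain]
  exact contDiff_toMatrix'.comp ((hG.fderiv_right (m := ∞) le_rfl).clm_comp contDiff_const)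

section OrbitMap

variable {m : ℕ}

/-- The pullbacks of a metric by the transformations of adapted coordinates. -/
def orbitFamily (θ : JetSpace m) (q : OrbitParam m × Plane) : Coeff :=
  pull (jac q.1.phi q.2) (jac q.1.psi q.2) q.1.2.1 (taylorMetric θ (θ.1.1 + q.1.phi q.2))

lemma contDiff_orbitFamily (θ : JetSpace m) : ContDiff ℝ ∞ (orbitFamily θ) :=
  contDiff_iff_contDiffAt.2 fun _ => contDiffAt_pull
    (contDiff_jac_slice OrbitParam.contDiff_phi).contDiffAt
    (contDiff_jac_slice OrbitParam.contDiff_psi).contDiffAt (by fun_prop) (by fun_prop)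

/-- The jets of the pullbacks of a metric by the transformations of adapted coordinates. -/
def orbitMap (θ : JetSpace m) : OrbitParam m → JetSpace m :=
  jetMap m (orbitFamily θ) (ContinuousLinearMap.fst ℝ Space _)

lemma orbitMap_apply (θ : JetSpace m) (p : OrbitParam m) :
    orbitMap θ p = jet m (fun t => orbitFamily θ (p, t)) p.1 := rfl

/-- The parameters of the invertible transformations. -/
def orbitDomain (m : ℕ) : Set (OrbitParam m) :=
  {p | p.2.1.det ≠ 0 ∧ (jac p.phi p.1.1).det ≠ 0}

lemma isOpen_orbitDomain : IsOpen (orbitDomain m) := by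
  have continuous_jac : Continuous fun p : OrbitParam m => jac p.phi p.1.1 :=
    (contDiff_jac_slice OrbitParam.contDiff_phi).continuous.comp
      (f := fun p : OrbitParam m => (p, p.1.1)) (by fun_prop)
  exact (isOpen_ne.preimage (continuous_fst.comp continuous_snd).matrix_det).inter
    (isOpen_ne.preimage continuous_jac.matrix_det)

end OrbitMap

section Immersion

variable {V E F : Type*} [NormedAddCommGroup V] [NormedSpace ℝ V] [NormedAddCommGroup E]
  [NormedSpace ℝ E] [NormedAddCommGroup F] [NormedSpace ℝ F] {m : ℕ}

lemma hasDerivAt_add_smul (x v : V) : HasDerivAt (fun s : ℝ => x + s • v) v 0 := by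
  simpa using ((hasDerivAt_id (0 : ℝ)).smul_const v).const_add x

lemma hasDerivAt_line {f : V → E} {x : V} (hf : DifferentiableAt ℝ f x) (v : V) :
    HasDerivAt (fun s : ℝ => f (x + s • v)) (fderiv ℝ f x v) 0 :=
  hf.hasFDerivAt.hasLineDerivAt v

lemma flat_variation {G : V × Plane → E} (hG : ContDiff ℝ ∞ G) {p v : V} {c : Plane}
    (flat : Flat m (fun t => dirDeriv (v, 0) G (p, t)) c) {R : E → F}
    (hR : ContDiffAt ℝ ∞ R (G (p, c))) {D : Plane → F}
    (hD : ∀ᶠ t in 𝓝 c, HasDerivAt (fun s : ℝ => R (G (p + s • v, t))) (D t) 0) : Flat m D c := by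
  have smooth_slice : ContDiff ℝ ∞ fun t => G (p, t) := hG.comp (contDiff_prodMk_right p)
  have smooth_deriv : ContDiff ℝ ∞ fun t => dirDeriv (v, 0) G (p, t) :=
    (contDiff_dirDeriv_iterate hG (v, 0) 1).comp (contDiff_prodMk_right p)
  refine (flat.map (Φ := fun q : E × E => fderiv ℝ R q.1 q.2)
    (contDiffAt_fderiv_apply hR contDiffAt_fst contDiffAt_snd) (fun _ => map_zero _)
    smooth_slice.contDiffAt smooth_deriv.contDiffAt).congr ?_
  filter_upwards [hD, smooth_slice.continuous.continuousAt.eventually (p := fun e => _)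
    (eventually_differentiableAt hR)] with t hDt hRt
  have line := hasDerivAt_line (hG.differentiable (by simp) (p, t)) (v, 0)
  simp only [Prod.smul_mk, Prod.mk_add_mk, smul_zero, add_zero] at line
  have hRt : HasFDerivAt R (fderiv ℝ R (G (p, t))) (G (p + (0 : ℝ) • v, t)) := by
    simpa using hRt.hasFDerivAt
  exact (hRt.comp_hasDerivAt 0 line).unique hDt

lemma hasDerivAt_congruence_line {q : V → M2} {x : V} (hq : DifferentiableAt ℝ q x) (J J' : M2)
    (v : V) : HasDerivAt (fun s : ℝ => (J + s • J')ᵀ * q (x + s • v) * (J + s • J'))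
      (J'ᵀ * q x * J + Jᵀ * fderiv ℝ q x v * J + Jᵀ * q x * J') 0 := by
  have line : HasDerivAt (fun s : ℝ => J + s • J') J' 0 := hasDerivAt_add_smul J J'
  have product := ((hasDerivAt_transpose line).mul (hasDerivAt_line hq v)).mul line
  simp only [Pi.mul_apply, zero_smul, add_zero, Matrix.add_mul] at product
  exact product

lemma taylor_add_smul {ι : Type*} [Fintype ι] (e : ι → ℕ × ℕ) (c : Plane) (w v : ι → E) (s : ℝ)
    (t : Plane) : taylor e c (w + s • v) t = taylor e c w t + s • taylor e c v t := by
  simp only [taylor, Pi.add_apply, Pi.smul_apply, smul_add, Finset.sum_add_distrib,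
    Finset.smul_sum, smul_comm s]

lemma jac_add_smul {φ ξ : Plane → Plane} {t : Plane} (hφ : DifferentiableAt ℝ φ t)
    (hξ : DifferentiableAt ℝ ξ t) (s : ℝ) :
    jac (fun t => φ t + s • ξ t) t = jac φ t + s • jac ξ t := by
  have sum_deriv : HasFDerivAt (fun t => φ t + s • ξ t) (fderiv ℝ φ t + s • fderiv ℝ ξ t) t :=
    hφ.hasFDerivAt.add (hξ.hasFDerivAt.const_smul s)
  rw [jac, sum_deriv.fderiv]
  simp [jac]

/-- The variation of `φ` along a line of parameters with fixed base point. -/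
def OrbitParam.varPhi (p v : OrbitParam m) : Plane → Plane := taylor ord p.1.1 v.2.2.1

/-- The variation of `ψ` along a line of parameters with fixed base point. -/
def OrbitParam.varPsi (p v : OrbitParam m) : Plane → Plane := taylor ord p.1.1 v.2.2.2

variable {θ : JetSpace m} {p v : OrbitParam m}

lemma orbitFamily_line (hv : v.1 = 0) (s : ℝ) (t : Plane) :
    orbitFamily θ (p + s • v, t)
      = pull (jac p.phi t + s • jac (p.varPhi v) t) (jac p.psi t + s • jac (p.varPsi v) t)
        (p.2.1 + s • v.2.1) (taylorMetric θ (θ.1.1 + p.phi t + s • p.varPhi v t)) := by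
  have phi_line : (p + s • v).phi = fun t => p.phi t + s • p.varPhi v t := funext fun t => by
    simp only [OrbitParam.phi, OrbitParam.varPhi, Prod.fst_add, Prod.snd_add, Prod.smul_fst,
      Prod.smul_snd, hv, smul_zero, add_zero, taylor_add_smul]
  have psi_line : (p + s • v).psi = fun t => p.psi t + s • p.varPsi v t := funext fun t => by
    simp only [OrbitParam.psi, OrbitParam.varPsi, Prod.fst_add, Prod.snd_add, Prod.smul_fst,
      Prod.smul_snd, hv, smul_zero, add_zero, taylor_add_smul]
  have differentiable_taylor : ∀ w : PosIndex m → Plane, Differentiable ℝ (taylor ord p.1.1 w) :=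
    fun w => (contDiff_taylor_right _ _ _).differentiable (by simp)
  have jac_phi : jac (p + s • v).phi t = jac p.phi t + s • jac (p.varPhi v) t := by
    rw [phi_line]
    exact jac_add_smul (differentiable_taylor _ _) (differentiable_taylor _ _) s
  have jac_psi : jac (p + s • v).psi t = jac p.psi t + s • jac (p.varPsi v) t := by
    rw [psi_line]
    exact jac_add_smul (differentiable_taylor _ _) (differentiable_taylor _ _) s
  simp only [orbitFamily]
  rw [jac_phi, jac_psi, phi_line, add_assoc]
  rfl

lemma orbitFamily_base : orbitFamily θ (p, p.1.1)
    = pull (jac p.phi p.1.1) (jac p.psi p.1.1) p.2.1 (jetValue θ) := by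
  rw [orbitFamily, OrbitParam.phi_base, add_zero, taylorMetric_base]

lemma eventually_nondeg_taylorMetric (hn : Nondeg (jetValue θ)) :
    ∀ᶠ t in 𝓝 p.1.1, Nondeg (taylorMetric θ (θ.1.1 + p.phi t)) := by
  have continuous_pullback : Continuous fun t => taylorMetric θ (θ.1.1 + p.phi t) :=
    ContDiff.continuous (n := ∞) (by fun_prop)
  refine continuous_pullback.continuousAt.eventually (isOpen_nondeg.mem_nhds ?_)
  change Nondeg (taylorMetric θ (θ.1.1 + p.phi p.1.1))
  rwa [OrbitParam.phi_base, add_zero, taylorMetric_base]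

lemma eventually_nondeg_line {x : Plane} (hx : Nondeg (taylorMetric θ x)) (w : Plane) :
    ∀ᶠ s : ℝ in 𝓝 0, Nondeg (taylorMetric θ (x + s • w)) := by
  have continuous_line : Continuous fun s : ℝ => taylorMetric θ (x + s • w) :=
    (contDiff_taylorMetric θ).continuous.comp (by fun_prop)
  exact continuous_line.continuousAt.eventually (isOpen_nondeg.mem_nhds (by simpa using hx))

lemma eventually_det_line {α : M2} (hα : α.det ≠ 0) (a : M2) :
    ∀ᶠ s : ℝ in 𝓝 0, (α + s • a).det ≠ 0 := by
  have continuous_line : Continuous fun s : ℝ => (α + s • a).det :=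
    Continuous.matrix_det (by fun_prop)
  exact continuous_line.continuousAt.eventually_ne (by simpa using hα)

lemma varPhi_base : p.varPhi v p.1.1 = 0 := taylor_posIndex_self _

lemma varPsi_base : p.varPsi v p.1.1 = 0 := taylor_posIndex_self _

@[fun_prop]
lemma contDiff_varPhi : ContDiff ℝ ∞ (p.varPhi v) := contDiff_taylor_right _ _ _

@[fun_prop]
lemma contDiff_varPsi : ContDiff ℝ ∞ (p.varPsi v) := contDiff_taylor_right _ _ _

section Variation

variable (hv : v.1 = 0) (flat : Flat m (fun t => dirDeriv (v, 0) (orbitFamily θ) (p, t)) p.1.1)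

include hv flat

lemma flat_hMat_variation : Flat m (fun t =>
    v.2.1ᵀ * hMat (taylorMetric θ (θ.1.1 + p.phi t)) * p.2.1
      + p.2.1ᵀ * fderiv ℝ (fun s => hMat (taylorMetric θ s)) (θ.1.1 + p.phi t) (p.varPhi v t)
        * p.2.1
      + p.2.1ᵀ * hMat (taylorMetric θ (θ.1.1 + p.phi t)) * v.2.1) p.1.1 := by
  refine flat_variation (contDiff_orbitFamily θ) flat (R := hMat) (by fun_prop)
    (Eventually.of_forall fun t => ?_)
  simp only [orbitFamily_line hv, hMat_pull]
  exact hasDerivAt_congruence_line (q := fun s => hMat (taylorMetric θ s))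
    (ContDiffAt.differentiableAt (n := ∞) (by fun_prop) (by simp)) _ _ _

variable (hn : Nondeg (jetValue θ)) (hp : p ∈ orbitDomain m)

include hn hp

lemma flat_qMat_variation : Flat m (fun t =>
    (jac (p.varPhi v) t)ᵀ * qMat (taylorMetric θ (θ.1.1 + p.phi t)) * jac p.phi t
      + (jac p.phi t)ᵀ * fderiv ℝ (fun s => qMat (taylorMetric θ s)) (θ.1.1 + p.phi t)
        (p.varPhi v t) * jac p.phi t
      + (jac p.phi t)ᵀ * qMat (taylorMetric θ (θ.1.1 + p.phi t)) * jac (p.varPhi v) t) p.1.1 := by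
  refine flat_variation (contDiff_orbitFamily θ) flat (R := qMat) (contDiffAt_qMat ?_) ?_
  · rw [orbitFamily_base]
    exact (nondeg_pull hn hp.2 hp.1).2
  filter_upwards [eventually_nondeg_taylorMetric hn] with t ht
  have line := hasDerivAt_congruence_line (q := fun s => qMat (taylorMetric θ s))
    (((contDiffAt_qMat ht.2).comp _ (by fun_prop)).differentiableAt (by simp)) (jac p.phi t)
    (jac (p.varPhi v) t) (p.varPhi v t)
  refine line.congr_of_eventuallyEq ?_
  filter_upwards [eventually_nondeg_line ht (p.varPhi v t), eventually_det_line hp.1 v.2.1]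
    with s hs hα
  rw [orbitFamily_line hv, qMat_pull hs.2 hα]

lemma flat_aMat_variation (ha : v.2.1 = 0) : Flat m (fun t =>
    ((jac (p.varPhi v) t)ᵀ * aMat (taylorMetric θ (θ.1.1 + p.phi t))
      + (jac p.phi t)ᵀ * fderiv ℝ (fun s => aMat (taylorMetric θ s)) (θ.1.1 + p.phi t)
        (p.varPhi v t) + (jac (p.varPsi v) t)ᵀ) * (p.2.1⁻¹)ᵀ) p.1.1 := by
  refine flat_variation (contDiff_orbitFamily θ) flat (R := aMat) (contDiffAt_aMat ?_) ?_
  · rw [orbitFamily_base]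
    exact (nondeg_pull hn hp.2 hp.1).2
  filter_upwards [eventually_nondeg_taylorMetric hn] with t ht
  have line_jac_phi := hasDerivAt_transpose (hasDerivAt_add_smul (jac p.phi t) (jac (p.varPhi v) t))
  have line_jac_psi := hasDerivAt_transpose (hasDerivAt_add_smul (jac p.psi t) (jac (p.varPsi v) t))
  have line_aMat := hasDerivAt_line (f := fun s => aMat (taylorMetric θ s))
    (((contDiffAt_aMat ht.2).comp _ (by fun_prop)).differentiableAt (by simp)) (p.varPhi v t)
  have line := ((line_jac_phi.mul line_aMat).add line_jac_psi).mul_const (p.2.1⁻¹)ᵀ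
  simp only [zero_smul, add_zero] at line
  refine line.congr_of_eventuallyEq ?_
  filter_upwards [eventually_nondeg_line ht (p.varPhi v t)] with s hs
  simp only [orbitFamily_line hv, ha, smul_zero, add_zero]
  exact aMat_pull hs.2 hp.1

lemma flat_varPsi (ha : v.2.1 = 0) (flat_phi : Flat (m + 1) (p.varPhi v) p.1.1) :
    Flat (m + 1) (p.varPsi v) p.1.1 := by
  refine (flat_succ_iff_jac (by fun_prop)).2 ⟨varPsi_base, ?_⟩
  have flat_jac := ((flat_succ_iff_jac (by fun_prop)).1 flat_phi).2
  have nondeg := (eventually_nondeg_taylorMetric (p := p) hn).self_of_nhds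
  have smooth_aMat : ContDiffAt ℝ ∞ (fun s => aMat (taylorMetric θ s)) (θ.1.1 + p.phi p.1.1) :=
    (contDiffAt_aMat nondeg.2).comp _ (by fun_prop)
  have smooth_pullback : ContDiffAt ℝ ∞ (fun t => aMat (taylorMetric θ (θ.1.1 + p.phi t))) p.1.1 :=
    smooth_aMat.comp p.1.1 (f := fun t => θ.1.1 + p.phi t) (by fun_prop)
  have smooth_fderiv : ContDiffAt ℝ ∞ (fun t => fderiv ℝ (fun s => aMat (taylorMetric θ s))
      (θ.1.1 + p.phi t) (p.varPhi v t)) p.1.1 :=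
    contDiffAt_fderiv_apply smooth_aMat (by fun_prop) (by fun_prop)
  have flat_fderiv : Flat m (fun t => fderiv ℝ (fun s => aMat (taylorMetric θ s))
      (θ.1.1 + p.phi t) (p.varPhi v t)) p.1.1 :=
    flat_fderiv_apply (flat_phi.mono m.le_succ) smooth_aMat (by fun_prop) (by fun_prop)
  have flat_all := (flat_aMat_variation hv flat hn hp ha).prodMk
    (flat_jac.prodMk flat_fderiv (by fun_prop) smooth_fderiv) (by fun_prop) (by fun_prop)
  refine (flat_all.map (σ := fun t => (aMat (taylorMetric θ (θ.1.1 + p.phi t)), jac p.phi t))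
    (Φ := fun q : (M2 × M2) × (M2 × M2 × M2) =>
      (q.2.1 * p.2.1ᵀ - q.2.2.1ᵀ * q.1.1 - q.1.2ᵀ * q.2.2.2)ᵀ)
    (by fun_prop) (by simp) (by fun_prop) (by fun_prop)).congr (Eventually.of_forall fun t => ?_)
  have cancel : p.2.1⁻¹ᵀ * p.2.1ᵀ = 1 := by
    rw [← Matrix.transpose_mul, Matrix.mul_nonsing_inv _ (isUnit_iff_ne_zero.2 hp.1),
      Matrix.transpose_one]
  simp only [Matrix.mul_assoc, cancel, mul_one]
  simp only [Matrix.transpose_sub, Matrix.transpose_add, Matrix.transpose_mul,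
    Matrix.transpose_transpose]
  abel

end Variation

lemma orbitMap_immersion {θ : JetSpace (m + 1)} {p v : OrbitParam (m + 1)}
    (hn : Nondeg (jetValue θ)) (hr : RegularJet θ) (hp : p ∈ orbitDomain (m + 1))
    (h : fderiv ℝ (orbitMap θ) p v = 0) : v = 0 := by
  obtain ⟨hv, flat⟩ := flat_of_fderiv_jetMap_eq_zero (contDiff_orbitFamily θ) _ h
  replace hv : v.1 = 0 := hv
  have base : θ.1.1 + p.phi p.1.1 = θ.1.1 := by rw [OrbitParam.phi_base, add_zero]
  have value : taylorMetric θ (θ.1.1 + p.phi p.1.1) = jetValue θ := by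
    rw [base, taylorMetric_base]
  have hn' := (nondeg_iff _).1 hn
  obtain ⟨flat_phi, ha⟩ := rigidity (φ := fun t => θ.1.1 + p.phi t) (ξ := p.varPhi v)
    (q := fun s => qMat (taylorMetric θ s)) (h := fun s => hMat (taylorMetric θ s))
    (α := p.2.1) (a := v.2.1) (t := p.1.1) (m := m) (by fun_prop) (by fun_prop)
    ((contDiffAt_qMat (value.symm ▸ hn'.2)).comp _ (by fun_prop)) (by fun_prop)
    (by rw [jac_const_add]; exact hp.2) hp.1 (value.symm ▸ hn'.1) (value.symm ▸ hn'.2)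
    (fun _ => qMat_transpose _) (fun _ => hMat_transpose _)
    (by simpa only [base, taylorMetric_base] using regularJet_iff.1 hr) varPhi_base
    (by simpa only [jac_const_add] using flat_qMat_variation hv flat hn hp)
    (flat_hMat_variation hv flat)
  have flat_psi : Flat (m + 2) (p.varPsi v) p.1.1 :=
    flat_varPsi hv flat hn hp ha flat_phi
  exact Prod.ext hv (Prod.ext ha (Prod.ext
    (eq_zero_of_flat_taylor (fun _ h => h.2) flat_phi)
    (eq_zero_of_flat_taylor (fun _ h => h.2) flat_psi)))

end Immersion

section LocalDiffeomorphisms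

variable {E : Type*} [NormedAddCommGroup E] [NormedSpace ℝ E]

lemma fderiv_symm_fderiv {P : OpenPartialHomeomorph E E} (hP : ContDiffOn ℝ ∞ P P.source)
    (hP' : ContDiffOn ℝ ∞ P.symm P.target) {y : E} (hy : y ∈ P.source) (u : E) :
    fderiv ℝ P.symm (P y) (fderiv ℝ P y u) = u := by
  have hPy : DifferentiableAt ℝ P y :=
    (hP.contDiffAt (P.open_source.mem_nhds hy)).differentiableAt (by simp)
  have hPy' : DifferentiableAt ℝ P.symm (P y) :=
    (hP'.contDiffAt (P.open_target.mem_nhds (P.map_source hy))).differentiableAt (by simp)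
  have left_inverse : P.symm ∘ P =ᶠ[𝓝 y] id := P.eventually_left_inverse hy
  rw [← ContinuousLinearMap.comp_apply, ← fderiv_comp y hPy' hPy, left_inverse.fderiv_eq,
    fderiv_id, ContinuousLinearMap.id_apply]

lemma exists_openPartialHomeomorph_of_injective_fderiv [FiniteDimensional ℝ E] {f : E → E}
    (hf : ContDiff ℝ ∞ f) {N : Set E} (hN : IsOpen N) {x : E} (hx : x ∈ N)
    (inj : ∀ y ∈ N, Function.Injective (fderiv ℝ f y)) :
    ∃ Q : OpenPartialHomeomorph E E, ⇑Q = f ∧ x ∈ Q.source ∧ Q.source ⊆ N ∧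
      ContDiffOn ℝ ∞ Q.symm Q.target := by
  have : CompleteSpace E := FiniteDimensional.complete ℝ E
  have hasEquiv : ∀ y ∈ N, ∃ D : E ≃L[ℝ] E, HasFDerivAt f (D : E →L[ℝ] E) y := fun y hy =>
    ⟨(LinearEquiv.ofInjectiveEndo (fderiv ℝ f y : E →ₗ[ℝ] E) (inj y hy)).toContinuousLinearEquiv,
      (hf.differentiable (by simp) y).hasFDerivAt⟩
  obtain ⟨D, hD⟩ := hasEquiv x hx
  set Q := (hf.contDiffAt.toOpenPartialHomeomorph f hD (by simp)).restrOpen N hN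
  have hQf : ⇑Q = f := rfl
  refine ⟨Q, hQf, ⟨hf.contDiffAt.mem_toOpenPartialHomeomorph_source hD (by simp), hx⟩,
    fun y hy => hy.2, fun w hw => ?_⟩
  obtain ⟨D', hD'⟩ := hasEquiv _ (Q.map_target hw).2
  exact (Q.contDiffAt_symm hw hD' hf.contDiffAt).contDiffWithinAt

end LocalDiffeomorphisms

lemma IsAdapted.symm {P : OpenPartialHomeomorph Space Space} (hP : IsAdapted P) :
    IsAdapted P.symm := by
  obtain ⟨smooth, smooth', α, hα⟩ := hP
  refine ⟨smooth', smooth, α⁻¹, fun y hy v => ?_⟩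
  have key := fderiv_symm_fderiv smooth smooth' (P.map_target hy) (0, α⁻¹.val *ᵥ v)
  rwa [hα _ (P.map_target hy), P.right_inv hy, Matrix.mulVec_mulVec, ← Units.val_mul,
    mul_inv_cancel, Units.val_one, Matrix.one_mulVec] at key

lemma mem_jetOrbit_iff {m : ℕ} {θ θ' : JetSpace m} : θ' ∈ jetOrbit m θ ↔
    ∃ (Q : OpenPartialHomeomorph Space Space) (x : Space) (σ τ : Plane → Coeff),
      IsAdapted Q ∧ x ∈ Q.source ∧
      IsMetricOn σ (Prod.fst '' Q.target) ∧ IsMetricOn τ (Prod.fst '' Q.source) ∧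
      (∀ y ∈ Q.source, ∀ u v : Space,
        gForm (σ (Q y).1) (fderiv ℝ Q y u) (fderiv ℝ Q y v) = gForm (τ y.1) u v) ∧
      θ = jet m σ (Q x) ∧ θ' = jet m τ x := by
  constructor
  · rintro ⟨P, x, σ, τ, hP, hx, hσ, hτ, isometry, hθ, hθ'⟩
    refine ⟨P.symm, P x, σ, τ, hP.symm, P.map_source hx, hσ, hτ, fun y hy u v => ?_,
      by rwa [P.left_inv hx], hθ'⟩
    have hPy : ∀ w, fderiv ℝ P (P.symm y) (fderiv ℝ P.symm y w) = w :=
      fderiv_symm_fderiv (P := P.symm) hP.2.1 hP.1 hy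
    rw [← isometry _ (P.map_target hy), P.right_inv hy, hPy, hPy]
  · rintro ⟨Q, x, σ, τ, hQ, hx, hσ, hτ, isometry, hθ, hθ'⟩
    refine ⟨Q.symm, Q x, σ, τ, hQ.symm, Q.map_source hx, hσ, hτ, fun y hy u v => ?_, hθ,
      by rwa [Q.left_inv hx]⟩
    have hQy : ∀ w, fderiv ℝ Q (Q.symm y) (fderiv ℝ Q.symm y w) = w :=
      fderiv_symm_fderiv (P := Q.symm) hQ.2.1 hQ.1 hy
    rw [← isometry _ (Q.map_target hy), Q.right_inv hy, hQy, hQy]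

section OrbitMapMem

variable {m : ℕ}

namespace OrbitParam

/-- The transformation with the given parameters that carries the point `p.1` to `x`. -/
def map (p : OrbitParam m) (x y : Space) : Space :=
  (x.1 + p.phi y.1, x.2 + (p.2.1 *ᵥ (y.2 - p.1.2) + p.psi y.1))

lemma contDiff_phi_apply (p : OrbitParam m) : ContDiff ℝ ∞ p.phi :=
  contDiff_phi.comp (contDiff_prodMk_right p)

lemma contDiff_psi_apply (p : OrbitParam m) : ContDiff ℝ ∞ p.psi :=
  contDiff_psi.comp (contDiff_prodMk_right p)

lemma contDiff_map (p : OrbitParam m) (x : Space) : ContDiff ℝ ∞ (p.map x) := by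
  have linear : ContDiff ℝ ∞ fun y : Space => p.2.1 *ᵥ (y.2 - p.1.2) :=
    (LinearMap.toContinuousLinearMap (Matrix.mulVecLin p.2.1)).contDiff.comp
      (contDiff_snd.sub contDiff_const)
  exact (contDiff_const.add (p.contDiff_phi_apply.comp contDiff_fst)).prodMk
    (contDiff_const.add (linear.add (p.contDiff_psi_apply.comp contDiff_fst)))

lemma map_self (p : OrbitParam m) (x : Space) : p.map x p.1 = x := by
  simp [map, phi_base, psi_base]

lemma fderiv_map (p : OrbitParam m) (x y : Space) :
    fderiv ℝ (p.map x) y = blockMap (jac p.phi y.1) (jac p.psi y.1) p.2.1 := by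
  have hφ : HasFDerivAt (fun y : Space => p.phi y.1) _ y :=
    (p.contDiff_phi_apply.differentiable (by simp) y.1).hasFDerivAt.comp y hasFDerivAt_fst
  have hψ : HasFDerivAt (fun y : Space => p.psi y.1) _ y :=
    (p.contDiff_psi_apply.differentiable (by simp) y.1).hasFDerivAt.comp y hasFDerivAt_fst
  have linear : HasFDerivAt (fun y : Space => p.2.1 *ᵥ (y.2 - p.1.2)) _ y :=
    (LinearMap.toContinuousLinearMap (Matrix.mulVecLin p.2.1)).hasFDerivAt.comp y
      (hasFDerivAt_snd.sub_const p.1.2)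
  refine ((hφ.const_add x.1).prodMk ((linear.add hψ).const_add x.2)).fderiv.trans ?_
  refine ContinuousLinearMap.ext fun u => ?_
  rw [blockMap_apply, jac_mulVec, jac_mulVec]
  exact Prod.ext rfl (add_comm _ _)

end OrbitParam

lemma nondeg_orbitMap {θ : JetSpace m} (hn : Nondeg (jetValue θ)) {p : OrbitParam m}
    (hp : p ∈ orbitDomain m) : Nondeg (jetValue (orbitMap θ p)) := by
  rw [orbitMap_apply, jetValue_jet]
  exact orbitFamily_base ▸ nondeg_pull hn hp.2 hp.1

lemma orbitMap_mem_jetOrbit {θ : JetSpace m} (hn : Nondeg (jetValue θ)) {p : OrbitParam m}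
    (hp : p ∈ orbitDomain m) : orbitMap θ p ∈ jetOrbit m θ := by
  let N : Set Space :=
    {y | (jac p.phi y.1).det ≠ 0} ∩ {y | Nondeg (taylorMetric θ (p.map θ.1 y).1)}
  have continuous_jac : Continuous (jac p.phi) :=
    (contDiff_iff_contDiffAt.2 fun _ =>
      contDiffAt_jac p.contDiff_phi_apply.contDiffAt : ContDiff ℝ ∞ _).continuous
  have isOpen_N : IsOpen N :=
    (isOpen_ne.preimage (continuous_jac.comp continuous_fst).matrix_det).inter
      (isOpen_nondeg.preimage ((contDiff_taylorMetric θ).continuous.comp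
        (continuous_fst.comp (p.contDiff_map θ.1).continuous)))
  have base_mem : p.1 ∈ N :=
    ⟨hp.2, by rwa [Set.mem_ofPred_eq, p.map_self, taylorMetric_base]⟩
  obtain ⟨Q, hQ, mem_source, source_subset, smooth'⟩ :=
    exists_openPartialHomeomorph_of_injective_fderiv (p.contDiff_map θ.1) isOpen_N base_mem
      fun y hy => by
        rw [p.fderiv_map]
        exact blockMap_injective_iff.2 ⟨hy.1, hp.1⟩
  have smooth_family : ContDiff ℝ ∞ fun t => orbitFamily θ (p, t) :=
    (contDiff_orbitFamily θ).comp (contDiff_prodMk_right p)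
  refine mem_jetOrbit_iff.2 ⟨Q, p.1, taylorMetric θ, fun t => orbitFamily θ (p, t),
    ⟨hQ ▸ (p.contDiff_map θ.1).contDiffOn, smooth',
      Matrix.GeneralLinearGroup.mkOfDetNeZero p.2.1 hp.1, fun y _ v => ?_⟩,
    mem_source, ⟨(contDiff_taylorMetric θ).contDiffOn, ?_⟩, ⟨smooth_family.contDiffOn, ?_⟩,
    fun y _ u v => ?_, ?_, rfl⟩
  · rw [hQ, p.fderiv_map, blockMap_apply, Matrix.mulVec_zero, Matrix.mulVec_zero, zero_add]
    rfl
  · rintro _ ⟨w, hw, rfl⟩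
    have nondeg := (source_subset (Q.map_target hw)).2
    rwa [Set.mem_ofPred_eq, ← hQ, Q.right_inv hw] at nondeg
  · rintro _ ⟨y, hy, rfl⟩
    exact nondeg_pull (source_subset hy).2 (source_subset hy).1 hp.1
  · rw [hQ, p.fderiv_map, ← gForm_pull]
    rfl
  · rw [hQ, p.map_self, jet_taylorMetric]

end OrbitMapMem

section JetOrbitSubset

variable {m : ℕ}

lemma SameJet.jac {φ ψ : Plane → Plane} {t : Plane} (h : SameJet (m + 1) φ ψ t)
    (hφ : ContDiffAt ℝ ∞ φ t) (hψ : ContDiffAt ℝ ∞ ψ t) : SameJet m (jac φ) (jac ψ) t :=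
  (sameJet_succ_iff.1 h).2.comp_left contDiff_toMatrix'.contDiffAt (contDiffAt_fderiv hφ)
    (contDiffAt_fderiv hψ)

lemma SameJet.pull {J J' K K' : Plane → M2} {σ τ : Plane → Coeff} {t : Plane}
    (hJ : SameJet m J J' t) (hK : SameJet m K K' t) (hσ : SameJet m σ τ t) (α : M2)
    (sJ : ContDiffAt ℝ ∞ J t) (sJ' : ContDiffAt ℝ ∞ J' t) (sK : ContDiffAt ℝ ∞ K t)
    (sK' : ContDiffAt ℝ ∞ K' t) (sσ : ContDiffAt ℝ ∞ σ t) (sτ : ContDiffAt ℝ ∞ τ t) :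
    SameJet m (fun s => pull (J s) (K s) α (σ s)) (fun s => pull (J' s) (K' s) α (τ s)) t :=
  ((hJ.prodMk hK sJ sJ' sK sK').prodMk hσ (sJ.prodMk sK) (sJ'.prodMk sK') sσ sτ).comp_left
    (f := fun q : (M2 × M2) × Coeff => GTwo.pull q.1.1 q.1.2 α q.2)
    (contDiffAt_pull (by fun_prop) (by fun_prop) (by fun_prop) (by fun_prop))
    ((sJ.prodMk sK).prodMk sσ) ((sJ'.prodMk sK').prodMk sτ)

lemma fderiv_eq_blockMap {Q : Space → Space} {y : Space} (hQ : DifferentiableAt ℝ Q y) {α : M2}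
    (hα : ∀ v, fderiv ℝ Q y (0, v) = (0, α *ᵥ v)) :
    fderiv ℝ Q y = blockMap (jac (fun t => (Q (t, y.2)).1) y.1)
      (jac (fun t => (Q (t, y.2)).2) y.1) α := by
  have slice : HasFDerivAt (fun t => Q (t, y.2))
      ((fderiv ℝ Q y).comp (ContinuousLinearMap.inl ℝ Plane Plane)) y.1 :=
    hQ.hasFDerivAt.comp y.1 (hasFDerivAt_prodMk_left y.1 y.2)
  have hφ := (hasFDerivAt_fst.comp y.1 slice).fderiv
  have hψ := (hasFDerivAt_snd.comp y.1 slice).fderiv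
  refine ContinuousLinearMap.ext fun ⟨u, v⟩ => ?_
  have split : ((u, v) : Space) = (u, 0) + (0, v) := by simp
  rw [split, map_add, hα, ← split, blockMap_apply, jac_mulVec, jac_mulVec]
  exact Prod.ext ((add_zero _).trans (congrArg (fun L => L u) hφ).symm)
    (congrArg (fun L => L u + α *ᵥ v) hψ).symm

lemma exists_pull_eq {Q : OpenPartialHomeomorph Space Space} (hQ : IsAdapted Q) {x : Space}
    (hx : x ∈ Q.source) {σ τ : Plane → Coeff}
    (isometry : ∀ y ∈ Q.source, ∀ u v : Space,
      gForm (σ (Q y).1) (fderiv ℝ Q y u) (fderiv ℝ Q y v) = gForm (τ y.1) u v) :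
    ∃ (φ ψ : Plane → Plane) (α : M2), ContDiffAt ℝ ∞ φ x.1 ∧ ContDiffAt ℝ ∞ ψ x.1 ∧
      φ x.1 = (Q x).1 ∧ (jac φ x.1).det ≠ 0 ∧ α.det ≠ 0 ∧
      τ =ᶠ[𝓝 x.1] fun t => pull (jac φ t) (jac ψ t) α (σ (φ t)) := by
  obtain ⟨smooth, smooth', α, hα⟩ := hQ
  have smoothAt : ∀ y ∈ Q.source, ContDiffAt ℝ ∞ Q y := fun y hy =>
    smooth.contDiffAt (Q.open_source.mem_nhds hy)
  have hfderiv := fun y hy => fderiv_eq_blockMap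
    ((smoothAt y hy).differentiableAt (by simp)) (hα y hy)
  have injective : Function.Injective (fderiv ℝ Q x) :=
    Function.LeftInverse.injective (fderiv_symm_fderiv smooth smooth' hx)
  rw [hfderiv x hx, blockMap_injective_iff] at injective
  have smooth_slice : ContDiffAt ℝ ∞ (fun t => Q (t, x.2)) x.1 :=
    (smoothAt x hx).comp x.1 (contDiffAt_id.prodMk contDiffAt_const)
  have mem_source : ∀ᶠ t in 𝓝 x.1, (t, x.2) ∈ Q.source :=
    (Continuous.prodMk_left x.2).continuousAt.eventually (Q.open_source.mem_nhds hx)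
  refine ⟨fun t => (Q (t, x.2)).1, fun t => (Q (t, x.2)).2, α, smooth_slice.fst,
    smooth_slice.snd, rfl, injective.1, injective.2, ?_⟩
  filter_upwards [mem_source] with t ht
  refine gForm_ext fun u v => ?_
  rw [gForm_pull, ← isometry _ ht, hfderiv _ ht]

lemma jetOrbit_subset (θ : JetSpace m) : jetOrbit m θ ⊆ orbitMap θ '' orbitDomain m := by
  intro θ' hθ'
  obtain ⟨Q, x, σ, τ, hQ, hx, hσ, hτ, isometry, rfl, rfl⟩ := mem_jetOrbit_iff.1 hθ'
  obtain ⟨φ, ψ, α, hφ, hψ, φ_x, det_φ, det_α, hpull⟩ := exists_pull_eq hQ hx isometry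
  have smooth_σ : ContDiffAt ℝ ∞ σ (φ x.1) := φ_x ▸
    hσ.1.contDiffAt ((isOpenMap_fst _ Q.open_target).mem_nhds ⟨Q x, Q.map_source hx, rfl⟩)
  have smooth_τ : ContDiffAt ℝ ∞ τ x.1 :=
    hτ.1.contDiffAt ((isOpenMap_fst _ Q.open_source).mem_nhds ⟨x, hx, rfl⟩)
  let p : OrbitParam m := (x, α, derivsAt φ x.1, derivsAt ψ x.1)
  have sφ : ContDiffAt ℝ ∞ (fun t => φ x.1 + p.phi t) x.1 :=
    contDiffAt_const.add p.contDiff_phi_apply.contDiffAt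
  have sψ : ContDiffAt ℝ ∞ (fun t => ψ x.1 + p.psi t) x.1 :=
    contDiffAt_const.add p.contDiff_psi_apply.contDiffAt
  have jet_φ : SameJet (m + 1) φ (fun t => φ x.1 + p.phi t) x.1 := sameJet_taylor_posIndex hφ
  have jet_jac_φ := jet_φ.jac hφ sφ
  have jet_jac_ψ := SameJet.jac (m := m) (sameJet_taylor_posIndex hψ) hψ sψ
  have smooth_θ := contDiff_taylorMetric (jet m σ (Q x))
  have jet_metric : SameJet m (fun t => σ (φ t))
      (fun t => taylorMetric (jet m σ (Q x)) (φ x.1 + p.phi t)) x.1 :=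
    SameJet.comp (by rw [φ_x]; exact sameJet_taylorMetric (φ_x ▸ smooth_σ))
      (jet_φ.mono m.le_succ) smooth_σ smooth_θ.contDiffAt hφ sφ
  refine ⟨p, ⟨det_α, ?_⟩, (jet_eq_jet_iff ?_ smooth_τ).2 ?_⟩
  · rwa [← jac_const_add p.phi (φ x.1), ← jet_jac_φ.eq]
  · exact ((contDiff_orbitFamily _).comp (contDiff_prodMk_right p)).contDiffAt
  · refine SameJet.symm ((sameJet_of_eventuallyEq hpull).trans ?_)
    have key := jet_jac_φ.pull jet_jac_ψ jet_metric α (contDiffAt_jac hφ) (contDiffAt_jac sφ)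
      (contDiffAt_jac hψ) (contDiffAt_jac sψ) (smooth_σ.comp x.1 hφ)
      (smooth_θ.contDiffAt.comp x.1 sφ)
    simp only [φ_x, jac_const_add] at key
    exact key

theorem jetOrbit_eq {θ : JetSpace m} (hn : Nondeg (jetValue θ)) :
    jetOrbit m θ = orbitMap θ '' orbitDomain m :=
  (jetOrbit_subset θ).antisymm <| Set.image_subset_iff.2 fun _ => orbitMap_mem_jetOrbit hn

end JetOrbitSubset

section OneForms

variable {V W F : Type*} [NormedAddCommGroup V] [NormedSpace ℝ V] [NormedAddCommGroup W]
  [NormedSpace ℝ W] [NormedAddCommGroup F] [NormedSpace ℝ F]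

/-- The exterior derivative of the vector valued one-form `η` vanishes at `x`. -/
def ClosedAt (η : V → V →L[ℝ] F) (x : V) : Prop :=
  ∀ u v, fderiv ℝ η x u v = fderiv ℝ η x v u

/-- Compare the second derivatives of both sides of `dψ = φ^* η`. -/
lemma closedAt_of_fderiv_eq_comp {η : V → V →L[ℝ] F} {φ : W → V} {ψ : W → F} {w : W}
    (hη : ContDiffAt ℝ ∞ η (φ w)) (hφ : ContDiffAt ℝ ∞ φ w) (hψ : ContDiffAt ℝ ∞ ψ w)
    (hsurj : Function.Surjective (fderiv ℝ φ w))
    (h : fderiv ℝ ψ =ᶠ[𝓝 w] fun y => (η (φ y)).comp (fderiv ℝ φ y)) : ClosedAt η (φ w) := by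
  have hasFDerivAt_pullback := ((hη.differentiableAt (by simp)).hasFDerivAt.comp w
    (hφ.differentiableAt (by simp)).hasFDerivAt).clm_comp
      ((contDiffAt_fderiv hφ).differentiableAt (by simp)).hasFDerivAt
  have second_fderiv : ∀ a b, fderiv ℝ (fderiv ℝ ψ) w a b
      = η (φ w) (fderiv ℝ (fderiv ℝ φ) w a b)
        + fderiv ℝ η (φ w) (fderiv ℝ φ w a) (fderiv ℝ φ w b) := fun a b =>
    congrArg (fun L => L a b) (h.fderiv_eq.trans hasFDerivAt_pullback.fderiv)
  have two_le : minSmoothness ℝ 2 ≤ (∞ : WithTop ℕ∞) := by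
    simpa using WithTop.coe_le_coe.2 (le_top : (2 : ℕ∞) ≤ ⊤)
  have symm_φ := hφ.isSymmSndFDerivAt two_le
  have symm_ψ := hψ.isSymmSndFDerivAt two_le
  intro u v
  obtain ⟨a, rfl⟩ := hsurj u
  obtain ⟨b, rfl⟩ := hsurj v
  have symm := symm_ψ.eq a b
  rw [second_fderiv, second_fderiv, symm_φ.eq a b] at symm
  exact add_left_cancel symm

lemma exists_potential [CompleteSpace F] {η : V → V →L[ℝ] F} {Ω : Set V} {x : V} (hΩ : IsOpen Ω)
    (hx : x ∈ Ω) (hη : ContDiffOn ℝ ∞ η Ω) (hclosed : ∀ y ∈ Ω, ClosedAt η y) :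
    ∃ χ : V → F, ContDiffAt ℝ ∞ χ x ∧ ∀ᶠ y in 𝓝 x, fderiv ℝ χ y = η y := by
  obtain ⟨r, hr, hball⟩ := Metric.isOpen_iff.1 hΩ x hx
  have smooth_η : ContDiffOn ℝ ∞ η (Metric.ball x r) := hη.mono hball
  obtain ⟨χ, hχ⟩ := (convex_ball x r).exists_forall_hasFDerivAt_of_fderiv_symmetric
    Metric.isOpen_ball (smooth_η.differentiableOn (by simp)) fun y hy => hclosed y (hball hy)
  have smooth_χ : ContDiffOn ℝ ∞ χ (Metric.ball x r) :=
    (contDiffOn_infty_iff_fderiv_of_isOpen Metric.isOpen_ball).2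
      ⟨fun y hy => (hχ y hy).differentiableAt.differentiableWithinAt,
        smooth_η.congr fun y hy => (hχ y hy).fderiv⟩
  have ball_mem : Metric.ball x r ∈ 𝓝 x := Metric.ball_mem_nhds x hr
  exact ⟨χ, smooth_χ.contDiffAt ball_mem, eventually_of_mem ball_mem fun y hy => (hχ y hy).fderiv⟩

end OneForms

section Integrability

variable {c : Coeff} {σ : Plane → Coeff} {Ω : Set Plane} {t : Plane}

/-- The connection form `dzᵏ ↦ (aMat c)ᵢₖ dtⁱ`, with values in the leaf directions; the graph of
its negative is the fibre of `Ξ^⊥`. -/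
def connForm (c : Coeff) : Plane →L[ℝ] Plane :=
  LinearMap.toContinuousLinearMap (Matrix.mulVecLin (aMat c)ᵀ)

lemma connForm_apply (c : Coeff) (v : Plane) : connForm c v = (aMat c)ᵀ *ᵥ v := rfl

lemma connForm_eq_fderiv_iff {χ : Plane → Plane} :
    connForm c = fderiv ℝ χ t ↔ aMat c = (jac χ t)ᵀ := by
  rw [← Matrix.transpose_inj, Matrix.transpose_transpose, ← Matrix.mulVec_injective.eq_iff,
    funext_iff, ContinuousLinearMap.ext_iff]
  simp only [connForm_apply, jac_mulVec]

lemma contDiffAt_connForm (h : (hMat c).det ≠ 0) : ContDiffAt ℝ ∞ connForm c :=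
  (LinearMap.toContinuousLinearMap ((LinearMap.toContinuousLinearMap (𝕜 := ℝ) (E := Plane)
    (F' := Plane)).toLinearMap ∘ₗ (Matrix.toLin' (R := ℝ)).toLinearMap)).contDiff.contDiffAt.comp c
    (contDiffAt_transpose (contDiffAt_aMat h))

lemma mem_orthLeaf_iff (h : (hMat c).det ≠ 0) (v : Space) :
    v ∈ orthLeaf c ↔ v.2 = -(connForm c v.1) := by
  have hu := isUnit_iff_ne_zero.2 h
  have gForm_leaf : ∀ w, gForm c v (0, w) = ((fMat c)ᵀ *ᵥ v.1 + hMat c *ᵥ v.2) ⬝ᵥ w := fun w => by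
    simp only [gForm_eq, Matrix.mulVec_zero, zero_add, add_dotProduct, Matrix.dotProduct_mulVec,
      ← Matrix.mulVec_transpose, hMat_transpose]
  have aMat_transpose : (aMat c)ᵀ = (hMat c)⁻¹ * (fMat c)ᵀ := by
    rw [aMat, Matrix.transpose_mul, Matrix.transpose_nonsing_inv, hMat_transpose]
  have mem_iff : v ∈ orthLeaf c ↔ (fMat c)ᵀ *ᵥ v.1 + hMat c *ᵥ v.2 = 0 := by
    simp only [orthLeaf, Set.mem_ofPred_eq, gForm_leaf]
    exact ⟨fun h0 => dotProduct_eq_zero _ h0, fun h0 w => by rw [h0, zero_dotProduct]⟩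
  rw [mem_iff, connForm_apply, aMat_transpose, ← Matrix.mulVec_mulVec]
  constructor
  · intro h0
    rw [eq_neg_of_add_eq_zero_left h0, Matrix.mulVec_neg, Matrix.mulVec_mulVec,
      Matrix.nonsing_inv_mul _ hu, Matrix.one_mulVec, neg_neg]
  · intro h0
    rw [h0, Matrix.mulVec_neg, Matrix.mulVec_mulVec, Matrix.mul_nonsing_inv _ hu,
      Matrix.one_mulVec, add_neg_cancel]

lemma closedAt_of_orthIntegrableOn (hΩ : IsOpen Ω) (hσ : IsMetricOn σ Ω)
    (hI : OrthIntegrableOn σ Ω) (ht : t ∈ Ω) : ClosedAt (fun s => connForm (σ s)) t := by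
  obtain ⟨W, e, hW, smooth_e, ⟨w, hw, hwt⟩, he⟩ := hI (t, 0) ht
  have smooth_at : ∀ y ∈ W, ContDiffAt ℝ ∞ e y := fun y hy => smooth_e.contDiffAt (hW.mem_nhds hy)
  have fderiv_e : ∀ y ∈ W, HasFDerivAt e (fderiv ℝ e y) y := fun y hy =>
    ((smooth_at y hy).differentiableAt (by simp)).hasFDerivAt
  have fderiv_fst : ∀ y ∈ W, fderiv ℝ (fun y => (e y).1) y = _ := fun y hy =>
    (hasFDerivAt_fst.comp y (fderiv_e y hy)).fderiv
  have fderiv_snd : ∀ y ∈ W, fderiv ℝ (fun y => -(e y).2) y = _ := fun y hy =>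
    (hasFDerivAt_snd.comp y (fderiv_e y hy)).neg.fderiv
  have fderiv_mem : ∀ y ∈ W, ∀ u,
      (fderiv ℝ e y u).2 = -(connForm (σ (e y).1) (fderiv ℝ e y u).1) := fun y hy u =>
    (mem_orthLeaf_iff (hσ.2 _ (he y hy).1).2 _).1 ((he y hy).2.2 ▸ Set.mem_range_self u)
  have base_eq : (e w).1 = t := congrArg Prod.fst hwt
  have fst_injective : Function.Injective (fderiv ℝ (fun y => (e y).1) w) := by
    rw [fderiv_fst w hw]
    intro u v huv
    have fst_eq : (fderiv ℝ e w u).1 = (fderiv ℝ e w v).1 := huv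
    exact (he w hw).2.1 (Prod.ext fst_eq (by rw [fderiv_mem w hw, fderiv_mem w hw, fst_eq]))
  have closed := closedAt_of_fderiv_eq_comp (η := fun s => connForm (σ s))
    (φ := fun y => (e y).1) (ψ := fun y => -(e y).2)
    ((contDiffAt_connForm (hσ.2 _ (he w hw).1).2).comp _
      (hσ.1.contDiffAt (hΩ.mem_nhds (he w hw).1)))
    (contDiffAt_fst.comp w (smooth_at w hw)) (contDiffAt_snd.comp w (smooth_at w hw)).neg
    (LinearMap.surjective_of_injective (f := (fderiv ℝ (fun y => (e y).1) w : Plane →ₗ[ℝ] Plane))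
      fst_injective)
    (eventually_of_mem (hW.mem_nhds hw) fun y hy => by
      change _ = (connForm _).comp _
      rw [fderiv_fst y hy, fderiv_snd y hy]
      ext1 u
      exact (congrArg Neg.neg (fderiv_mem y hy u)).trans (neg_neg _))
  rwa [base_eq] at closed

/-- The integral surfaces are the graphs of the functions that differ from `-χ` by a constant. -/
lemma orthIntegrableOn_of_exact (hΩ : IsOpen Ω) (hσ : IsMetricOn σ Ω) {χ : Plane → Plane}
    (hχ : ContDiffOn ℝ ∞ χ Ω) (h : ∀ t ∈ Ω, connForm (σ t) = fderiv ℝ χ t) :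
    OrthIntegrableOn σ Ω := by
  intro y hy
  have hasFDerivAt_graph : ∀ w ∈ Ω, HasFDerivAt (fun w => ((w, y.2 + χ y.1 - χ w) : Space))
      ((ContinuousLinearMap.id ℝ Plane).prod (-(fderiv ℝ χ w))) w := fun w hw =>
    (hasFDerivAt_id w).prodMk
      (((hχ.contDiffAt (hΩ.mem_nhds hw)).differentiableAt (by simp)).hasFDerivAt.const_sub _)
  refine ⟨Ω, fun w => (w, y.2 + χ y.1 - χ w), hΩ, contDiffOn_id.prodMk (contDiffOn_const.sub hχ),
    ⟨y.1, hy, by simp⟩, fun w hw => ⟨hw, ?_, ?_⟩⟩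
  · rw [(hasFDerivAt_graph w hw).fderiv]
    exact fun u v huv => congrArg Prod.fst huv
  · rw [(hasFDerivAt_graph w hw).fderiv]
    ext v
    rw [mem_orthLeaf_iff (hσ.2 w hw).2, h w hw]
    exact ⟨by rintro ⟨u, rfl⟩; rfl, fun hv => ⟨v.1, Prod.ext rfl hv.symm⟩⟩

end Integrability

section Closed

variable {V F : Type*} [NormedAddCommGroup V] [NormedSpace ℝ V] [NormedAddCommGroup F]
  [NormedSpace ℝ F] {η ζ : V → V →L[ℝ] F} {x : V}

lemma ClosedAt.congr (hη : ClosedAt η x) (h : η =ᶠ[𝓝 x] ζ) : ClosedAt ζ x := by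
  rwa [ClosedAt, ← h.fderiv_eq]

lemma ClosedAt.sub (hη : ClosedAt η x) (hζ : ClosedAt ζ x) (sη : DifferentiableAt ℝ η x)
    (sζ : DifferentiableAt ℝ ζ x) : ClosedAt (fun y => η y - ζ y) x := fun u v => by
  rw [fderiv_fun_sub sη sζ]
  exact congrArg₂ (· - ·) (hη u v) (hζ u v)

lemma flat_pow {f : V → ℝ} (hf : ContDiffAt ℝ ∞ f x) (hx : f x = 0) (m : ℕ) :
    Flat m (fun y => f y ^ (m + 1)) x := by
  induction m with
  | zero => exact flat_zero_iff.2 (by simp [hx])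
  | succ m ih =>
    have fderiv_pow : (fun y => ((m + 2 : ℕ) * f y ^ (m + 1)) • fderiv ℝ f y)
        =ᶠ[𝓝 x] fderiv ℝ fun y => f y ^ (m + 2) := by
      filter_upwards [eventually_differentiableAt hf] with y hy
      rw [fderiv_fun_pow _ hy, nsmul_eq_mul]
      rfl
    refine flat_succ_iff.2 ⟨by simp [hx], Flat.congr ?_ fderiv_pow⟩
    exact ih.map (Φ := fun p : (V →L[ℝ] ℝ) × ℝ => ((m + 2 : ℕ) * p.2) • p.1) (by fun_prop)
      (fun e => by simp) (contDiffAt_fderiv hf) (hf.pow _)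

lemma not_eventually_closedAt_pow_smul {ℓ : V →L[ℝ] ℝ} {L : V →L[ℝ] F} {u v : V}
    (hu : ℓ u ≠ 0) (hv : ℓ v = 0) (hL : L v ≠ 0) (m : ℕ) :
    ¬ ∀ᶠ y in 𝓝 x, ClosedAt (fun y => ℓ (y - x) ^ (m + 1) • L) y := by
  intro closed
  have tendsto_line : Tendsto (fun s : ℝ => x + s • u) (𝓝[≠] 0) (𝓝 x) :=
    ((by fun_prop : Continuous fun s : ℝ => x + s • u).tendsto' 0 x (by simp)).mono_left
      nhdsWithin_le_nhds
  obtain ⟨s, closed_s, hs⟩ :=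
    ((tendsto_line.eventually closed).and self_mem_nhdsWithin).exists
  have hs : s ≠ 0 := hs
  have hasFDerivAt_pow : HasFDerivAt (fun y => ℓ (y - x) ^ (m + 1) • L)
      ((((m + 1 : ℕ) * ℓ (x + s • u - x) ^ m) • ℓ).smulRight L) (x + s • u) := by
    have hasFDerivAt_ℓ : HasFDerivAt (fun y => ℓ (y - x)) ℓ (x + s • u) :=
      ℓ.hasFDerivAt.comp (x + s • u) ((hasFDerivAt_id _).sub_const x)
    simpa only [nsmul_eq_mul, Nat.add_sub_cancel] using (hasFDerivAt_ℓ.pow (m + 1)).smul_const L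
  have symm := closed_s u v
  rw [hasFDerivAt_pow.fderiv] at symm
  simp [hv, hL, hu, hs, Nat.cast_add_one_ne_zero] at symm

end Closed

lemma pull_one_zero_one (c : Coeff) : pull 1 0 1 c = c :=
  gForm_ext fun u v => by simp [gForm_pull, blockMap_apply]

lemma connForm_pull_shear {c : Coeff} (h : (hMat c).det ≠ 0) (K : M2) :
    connForm (pull 1 K 1 c) = connForm c + LinearMap.toContinuousLinearMap K.mulVecLin := by
  ext1 v
  simp [connForm_apply, aMat_pull h, Matrix.add_mulVec]

section Intransitive

variable {m : ℕ}

lemma eventually_closedAt_of_notMem {σ : Plane → Coeff} {x : Space} (hσ : ContDiff ℝ ∞ σ)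
    (hx : Nondeg (σ x.1)) (h : jet m σ x ∉ intransitiveJets m) :
    ∀ᶠ t in 𝓝 x.1, ClosedAt (fun s => connForm (σ s)) t := by
  by_contra not_closed
  refine h ⟨x, {t | Nondeg (σ t)}, σ, isOpen_nondeg.preimage hσ.continuous, hx,
    ⟨hσ.contDiffOn, fun t ht => ht⟩, fun Ω hsub hΩ hxΩ integrable => not_closed ?_, rfl⟩
  exact eventually_of_mem (hΩ.mem_nhds hxΩ) fun t ht =>
    closedAt_of_orthIntegrableOn hΩ ⟨hσ.contDiffOn, fun s hs => hsub hs⟩ integrable ht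

/-- A shear by a function that is flat at `x` changes the curvature of the connection near `x`,
but not the jet at `x`. -/
lemma exists_sameJet_not_closed {σ : Plane → Coeff} {x : Plane} (hσ : ContDiff ℝ ∞ σ)
    (hx : Nondeg (σ x)) (hclosed : ∀ᶠ t in 𝓝 x, ClosedAt (fun s => connForm (σ s)) t) (m : ℕ) :
    ∃ τ : Plane → Coeff, ContDiff ℝ ∞ τ ∧ SameJet m τ σ x ∧
      ¬ ∀ᶠ t in 𝓝 x, ClosedAt (fun s => connForm (τ s)) t := by
  let ℓ : Plane →L[ℝ] ℝ := ContinuousLinearMap.proj 0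
  let K₀ : M2 := !![0, 1; 0, 0]
  let K : Plane → M2 := fun t => ℓ (t - x) ^ (m + 1) • K₀
  have smooth_K : ContDiff ℝ ∞ K := by fun_prop
  have flat_K : Flat m K x := (flat_pow (f := fun t => ℓ (t - x)) (by fun_prop) (by simp) m).comp
    (f := fun r : ℝ => r • K₀) (by fun_prop) (zero_smul ℝ K₀) (by fun_prop)
  have smooth_τ : ∀ t, ContDiffAt ℝ ∞ (fun t => pull 1 (K t) 1 (σ t)) t := fun t =>
    contDiffAt_pull contDiffAt_const smooth_K.contDiffAt contDiffAt_const hσ.contDiffAt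
  refine ⟨fun t => pull 1 (K t) 1 (σ t), contDiff_iff_contDiffAt.2 smooth_τ, ?_, fun closed => ?_⟩
  · have sameJet := SameJet.pull (SameJet.refl m (fun _ => 1) x) flat_K (SameJet.refl m σ x) 1
      contDiffAt_const contDiffAt_const smooth_K.contDiffAt contDiffAt_const hσ.contDiffAt
      hσ.contDiffAt
    simpa only [pull_one_zero_one] using sameJet
  have eventually_nondeg : ∀ᶠ t in 𝓝 x, Nondeg (σ t) :=
    hσ.continuous.continuousAt.eventually (isOpen_nondeg.mem_nhds hx)
  refine not_eventually_closedAt_pow_smul (ℓ := ℓ) (x := x)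
    (L := LinearMap.toContinuousLinearMap K₀.mulVecLin) (u := ![1, 0]) (v := ![0, 1])
    (by simp [ℓ]) (by simp [ℓ]) (fun h => by simpa [K₀] using congrFun h 0) m ?_
  filter_upwards [closed, hclosed, eventually_nondeg.eventually_nhds] with t closed_τ closed_σ hn
  have nondeg_σ := hn.self_of_nhds
  refine (closed_τ.sub closed_σ ?_ ?_).congr (hn.mono fun s hs => ?_)
  · exact ((contDiffAt_connForm (nondeg_pull nondeg_σ (by simp) (by simp)).2).comp t
      (smooth_τ t)).differentiableAt (by simp)
  · exact ((contDiffAt_connForm nondeg_σ.2).comp t hσ.contDiffAt).differentiableAt (by simp)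
  · ext1 v
    simp [connForm_pull_shear hs.2, K]

lemma intransitiveJets_eq : intransitiveJets m = {θ | Nondeg (jetValue θ)} := by
  ext θ
  refine ⟨?_, fun hθ => ?_⟩
  · rintro ⟨x, Ω, σ, -, hx, hσ, -, rfl⟩
    exact hσ.2 _ hx
  by_contra hθ'
  have nondeg_taylor : Nondeg (taylorMetric θ θ.1.1) := by rwa [taylorMetric_base]
  have smooth_taylor := contDiff_taylorMetric θ
  rw [← jet_taylorMetric θ] at hθ'
  obtain ⟨τ, smooth_τ, sameJet, not_closed⟩ := exists_sameJet_not_closed smooth_taylor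
    nondeg_taylor (eventually_closedAt_of_notMem smooth_taylor nondeg_taylor hθ') m
  rw [← (jet_eq_jet_iff smooth_τ.contDiffAt smooth_taylor.contDiffAt).2 sameJet] at hθ'
  exact not_closed (eventually_closedAt_of_notMem smooth_τ (sameJet.eq ▸ nondeg_taylor) hθ')

end Intransitive

/-- The symmetric matrix with given entries. -/
def symMat (s : Sym2 (Fin 2) → ℝ) : M2 := Matrix.of fun i j => s s(i, j)

/-- The entries of the symmetrization of a matrix; a left inverse of `symMat`. -/
def symPart (B : M2) : Sym2 (Fin 2) → ℝ := (coeffOf B 0 0).1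

lemma symMat_transpose (s : Sym2 (Fin 2) → ℝ) : (symMat s)ᵀ = symMat s := by
  ext i j
  simp [symMat, Sym2.eq_swap]

lemma symMat_symPart {B : M2} (hB : Bᵀ = B) : symMat (symPart B) = B := bMat_coeffOf hB

lemma symPart_symMat (s : Sym2 (Fin 2) → ℝ) : symPart (symMat s) = s := by
  ext x
  induction x using Sym2.ind with
  | _ i j => simp [symPart, coeffOf, symMat, Sym2.eq_swap (a := j)]

lemma isLinearMap_symMat : IsLinearMap ℝ symMat := ⟨fun _ _ => rfl, fun _ _ => rfl⟩

@[fun_prop]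
lemma contDiff_symMat : ContDiff ℝ ∞ symMat :=
  (LinearMap.toContinuousLinearMap isLinearMap_symMat.mk').contDiff

lemma isLinearMap_symPart : IsLinearMap ℝ symPart where
  map_add B C := by
    simpa [symPart] using congrArg Prod.fst (isLinearMap_coeffOf.map_add (B, 0, 0) (C, 0, 0))
  map_smul r B := by
    simpa [symPart] using congrArg Prod.fst (isLinearMap_coeffOf.map_smul r (B, 0, 0))

@[fun_prop]
lemma contDiff_symPart : ContDiff ℝ ∞ symPart :=
  (LinearMap.toContinuousLinearMap isLinearMap_symPart.mk').contDiff

/-- Parameters for the jets of orthogonally transitive metrics: a point, and the jets at that point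
of the quotient metric, of the leaf metric, and of a potential of the connection. -/
abbrev TransParam (m : ℕ) : Type :=
  Space × (MultiIndex m → Sym2 (Fin 2) → ℝ) × (MultiIndex m → Sym2 (Fin 2) → ℝ) ×
    (PosIndex m → Plane)

namespace TransParam

variable {m : ℕ}

/-- The entries of the quotient metric. -/
def quot (p : TransParam m) : Plane → Sym2 (Fin 2) → ℝ := taylor ord p.1.1 p.2.1

/-- The entries of the leaf metric. -/
def leaf (p : TransParam m) : Plane → Sym2 (Fin 2) → ℝ := taylor ord p.1.1 p.2.2.1

/-- The potential of the connection that vanishes at the base point. -/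
def pot (p : TransParam m) : Plane → Plane := taylor ord p.1.1 p.2.2.2

@[fun_prop]
lemma contDiff_quot : ContDiff ℝ ∞ fun q : TransParam m × Plane => q.1.quot q.2 :=
  contDiff_taylor _ (by fun_prop) (by fun_prop) (by fun_prop)

@[fun_prop]
lemma contDiff_leaf : ContDiff ℝ ∞ fun q : TransParam m × Plane => q.1.leaf q.2 :=
  contDiff_taylor _ (by fun_prop) (by fun_prop) (by fun_prop)

@[fun_prop]
lemma contDiff_pot : ContDiff ℝ ∞ fun q : TransParam m × Plane => q.1.pot q.2 :=
  contDiff_taylor _ (by fun_prop) (by fun_prop) (by fun_prop)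

end TransParam

section Transitive

variable {m : ℕ}

/-- The orthogonally transitive metrics with polynomial quotient metric, leaf metric and
potential. -/
def transFamily (q : TransParam m × Plane) : Coeff :=
  ofReduced (symMat (q.1.quot q.2)) (jac q.1.pot q.2)ᵀ (symMat (q.1.leaf q.2))

lemma contDiff_transFamily : ContDiff ℝ ∞ (transFamily (m := m)) :=
  contDiff_iff_contDiffAt.2 fun _ => contDiffAt_ofReduced (by fun_prop)
    (contDiffAt_transpose (contDiff_jac_slice TransParam.contDiff_pot).contDiffAt) (by fun_prop)

/-- The jets of the metrics of `transFamily`. -/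
def transMap : TransParam m → JetSpace m :=
  jetMap m transFamily (ContinuousLinearMap.fst ℝ Space _)

/-- The parameters of the nondegenerate metrics. -/
def transDomain (m : ℕ) : Set (TransParam m) :=
  {p | (symMat (p.quot p.1.1)).det ≠ 0 ∧ (symMat (p.leaf p.1.1)).det ≠ 0}

lemma isOpen_transDomain : IsOpen (transDomain m) := by
  have continuous_quot : Continuous fun p : TransParam m => symMat (p.quot p.1.1) :=
    ContDiff.continuous (n := ∞) (by fun_prop)
  have continuous_leaf : Continuous fun p : TransParam m => symMat (p.leaf p.1.1) :=
    ContDiff.continuous (n := ∞) (by fun_prop)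
  exact (isOpen_ne.preimage continuous_quot.matrix_det).inter
    (isOpen_ne.preimage continuous_leaf.matrix_det)

section Immersion

variable {p v : TransParam m}

lemma transFamily_line (hv : v.1 = 0) (s : ℝ) (t : Plane) :
    transFamily (p + s • v, t) = ofReduced (symMat (p.quot t + s • taylor ord p.1.1 v.2.1 t))
      (jac p.pot t + s • jac (taylor ord p.1.1 v.2.2.2) t)ᵀ
      (symMat (p.leaf t + s • taylor ord p.1.1 v.2.2.1 t)) := by
  have pot_line : (p + s • v).pot = fun t => p.pot t + s • taylor ord p.1.1 v.2.2.2 t :=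
    funext fun t => by
      simp only [TransParam.pot, Prod.fst_add, Prod.snd_add, Prod.smul_fst, Prod.smul_snd, hv,
        smul_zero, add_zero, taylor_add_smul]
  have differentiable_taylor : ∀ w : PosIndex m → Plane, Differentiable ℝ (taylor ord p.1.1 w) :=
    fun w => (contDiff_taylor_right _ _ _).differentiable (by simp)
  have jac_pot : jac (p + s • v).pot t = jac p.pot t + s • jac (taylor ord p.1.1 v.2.2.2) t := by
    rw [pot_line]
    exact jac_add_smul (differentiable_taylor _ t) (differentiable_taylor _ t) s
  simp only [transFamily]
  rw [jac_pot]
  simp only [TransParam.quot, TransParam.leaf, Prod.fst_add, Prod.snd_add, Prod.smul_fst,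
    Prod.smul_snd, hv, smul_zero, add_zero, taylor_add_smul]

lemma eventually_det_leaf_line (hp : p ∈ transDomain m) : ∀ᶠ t in 𝓝 p.1.1, ∀ᶠ s : ℝ in 𝓝 0,
    (symMat (p.leaf t + s • taylor ord p.1.1 v.2.2.1 t)).det ≠ 0 := by
  have continuous_leaf : Continuous fun t => symMat (p.leaf t) :=
    ContDiff.continuous (n := ∞) (by fun_prop)
  filter_upwards [continuous_leaf.matrix_det.continuousAt.eventually_ne hp.2] with t ht
  have continuous_line : Continuous fun s : ℝ =>
      symMat (p.leaf t + s • taylor ord p.1.1 v.2.2.1 t) :=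
    ContDiff.continuous (n := ∞) (by fun_prop)
  exact continuous_line.matrix_det.continuousAt.eventually_ne (by simpa using ht)

variable (hv : v.1 = 0) (flat : Flat m (fun t => dirDeriv (v, 0) transFamily (p, t)) p.1.1)

include hv flat

lemma flat_leaf_variation : Flat m (taylor ord p.1.1 v.2.2.1) p.1.1 := by
  refine flat_variation contDiff_transFamily flat (R := fun c => symPart (hMat c)) (by fun_prop)
    (Eventually.of_forall fun t => ?_)
  simp only [transFamily_line hv, hMat_ofReduced (symMat_transpose _), symPart_symMat]
  exact hasDerivAt_add_smul _ _

variable (hp : p ∈ transDomain m)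

include hp

lemma flat_quot_variation : Flat m (taylor ord p.1.1 v.2.1) p.1.1 := by
  refine flat_variation contDiff_transFamily flat (R := fun c => symPart (qMat c)) ?_ ?_
  · have smooth_qMat : ContDiffAt ℝ ∞ qMat (transFamily (p, p.1.1)) :=
      contDiffAt_qMat (by rw [transFamily, hMat_ofReduced (symMat_transpose _)]; exact hp.2)
    fun_prop
  filter_upwards [eventually_det_leaf_line (v := v) hp] with t ht
  refine (hasDerivAt_add_smul (p.quot t) _).congr_of_eventuallyEq ?_
  filter_upwards [ht] with s hs
  rw [transFamily_line hv, qMat_ofReduced (symMat_transpose _) (symMat_transpose _) hs,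
    symPart_symMat]

lemma flat_pot_variation : Flat (m + 1) (taylor ord p.1.1 v.2.2.2) p.1.1 := by
  refine (flat_succ_iff_jac (contDiff_taylor_right _ _ _).contDiffAt).2
    ⟨taylor_posIndex_self _, ?_⟩
  refine flat_variation contDiff_transFamily flat (R := fun c => (aMat c)ᵀ) ?_ ?_
  · exact contDiffAt_transpose
      (contDiffAt_aMat (by rw [transFamily, hMat_ofReduced (symMat_transpose _)]; exact hp.2))
  filter_upwards [eventually_det_leaf_line (v := v) hp] with t ht
  refine (hasDerivAt_add_smul (jac p.pot t) _).congr_of_eventuallyEq ?_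
  filter_upwards [ht] with s hs
  rw [transFamily_line hv, aMat_ofReduced (symMat_transpose _) hs, Matrix.transpose_transpose]

end Immersion

lemma transMap_immersion {p v : TransParam m} (hp : p ∈ transDomain m)
    (h : fderiv ℝ transMap p v = 0) : v = 0 := by
  obtain ⟨hv, flat⟩ := flat_of_fderiv_jetMap_eq_zero contDiff_transFamily _ h
  exact Prod.ext hv (Prod.ext
    (eq_zero_of_flat_taylor (fun _ h => h) (flat_quot_variation hv flat hp)) (Prod.ext
    (eq_zero_of_flat_taylor (fun _ h => h) (flat_leaf_variation hv flat))
    (eq_zero_of_flat_taylor (fun _ h => h.2) (flat_pot_variation hv flat hp))))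

lemma mem_transitiveJets {B H : Plane → M2} {χ : Plane → Plane} {x : Space}
    (sB : ContDiff ℝ ∞ B) (sH : ContDiff ℝ ∞ H) (sχ : ContDiff ℝ ∞ χ) (hB : ∀ t, (B t)ᵀ = B t)
    (hH : ∀ t, (H t)ᵀ = H t) (hBx : (B x.1).det ≠ 0) (hHx : (H x.1).det ≠ 0) :
    jet m (fun t => ofReduced (B t) (jac χ t)ᵀ (H t)) x ∈ transitiveJets m := by
  have smooth_σ : ContDiff ℝ ∞ fun t => ofReduced (B t) (jac χ t)ᵀ (H t) :=
    contDiff_iff_contDiffAt.2 fun t => contDiffAt_ofReduced sB.contDiffAt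
      (contDiffAt_transpose (contDiffAt_jac sχ.contDiffAt)) sH.contDiffAt
  have isOpen_domain : IsOpen {t | (B t).det ≠ 0 ∧ (H t).det ≠ 0} :=
    (isOpen_ne.preimage sB.continuous.matrix_det).inter
      (isOpen_ne.preimage sH.continuous.matrix_det)
  have isMetricOn : IsMetricOn (fun t => ofReduced (B t) (jac χ t)ᵀ (H t))
      {t | (B t).det ≠ 0 ∧ (H t).det ≠ 0} :=
    ⟨smooth_σ.contDiffOn, fun t ht => nondeg_ofReduced (hB t) (hH t) ht.1 ht.2⟩
  exact ⟨x, _, _, isOpen_domain, ⟨hBx, hHx⟩, isMetricOn,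
    orthIntegrableOn_of_exact isOpen_domain isMetricOn sχ.contDiffOn fun t ht =>
      connForm_eq_fderiv_iff.2 (aMat_ofReduced (hH t) ht.2), rfl⟩

lemma jet_mem_transMap {σ : Plane → Coeff} {χ : Plane → Plane} {x : Space}
    (sσ : ContDiffAt ℝ ∞ σ x.1) (sχ : ContDiffAt ℝ ∞ χ x.1) (hn : Nondeg (σ x.1))
    (h : ∀ᶠ t in 𝓝 x.1, connForm (σ t) = fderiv ℝ χ t) :
    jet m σ x ∈ transMap '' transDomain m := by
  have smooth_q : ContDiffAt ℝ ∞ (fun t => symPart (qMat (σ t))) x.1 :=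
    contDiff_symPart.contDiffAt.comp _ ((contDiffAt_qMat hn.2).comp _ sσ)
  have smooth_h : ContDiffAt ℝ ∞ (fun t => symPart (hMat (σ t))) x.1 := by fun_prop
  let p : TransParam m := (x, derivsAt (fun t => symPart (qMat (σ t))) x.1,
    derivsAt (fun t => symPart (hMat (σ t))) x.1, derivsAt χ x.1)
  have smooth_pot : ContDiff ℝ ∞ p.pot := by fun_prop
  have sameJet_quot : SameJet m _ p.quot x.1 := sameJet_taylor smooth_q
  have sameJet_leaf : SameJet m _ p.leaf x.1 := sameJet_taylor smooth_h
  have sameJet_jac : SameJet m (jac χ) (jac p.pot) x.1 := by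
    have sameJet_pot : SameJet (m + 1) χ (fun t => χ x.1 + p.pot t) x.1 :=
      sameJet_taylor_posIndex sχ
    have sameJet := sameJet_pot.jac sχ (contDiffAt_const.add smooth_pot.contDiffAt)
    rwa [show jac (fun t => χ x.1 + p.pot t) = jac p.pot from funext (jac_const_add _ _)]
      at sameJet
  have sameJet_family : SameJet m (fun t => ofReduced (symMat (symPart (qMat (σ t)))) (jac χ t)ᵀ
      (symMat (symPart (hMat (σ t))))) (fun t => transFamily (p, t)) x.1 := by
    refine (sameJet_quot.prodMk (sameJet_jac.prodMk sameJet_leaf ?_ ?_ ?_ ?_) ?_ ?_ ?_ ?_).comp_left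
      (f := fun e : _ × M2 × _ => ofReduced (symMat e.1) e.2.1ᵀ (symMat e.2.2)) ?_ ?_ ?_
    all_goals fun_prop
  have sameJet : SameJet m (fun t => transFamily (p, t)) σ x.1 := by
    refine sameJet_family.symm.trans (sameJet_of_eventuallyEq ?_)
    filter_upwards [h, sσ.continuousAt.eventually (isOpen_nondeg.mem_nhds hn)] with t ht hnt
    rw [symMat_symPart (qMat_transpose _), symMat_symPart (hMat_transpose _),
      ← connForm_eq_fderiv_iff.1 ht, ofReduced_eq hnt.2]
  refine ⟨p, ?_, (jet_eq_jet_iff ?_ sσ).2 sameJet⟩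
  · have quot_base : qMat (σ x.1) = symMat (p.quot x.1) := by
      rw [← sameJet_quot.eq, symMat_symPart (qMat_transpose _)]
    have leaf_base : hMat (σ x.1) = symMat (p.leaf x.1) := by
      rw [← sameJet_leaf.eq, symMat_symPart (hMat_transpose _)]
    exact ⟨quot_base ▸ ((nondeg_iff _).1 hn).1, leaf_base ▸ hn.2⟩
  · exact (contDiff_transFamily.comp (contDiff_prodMk_right p)).contDiffAt

lemma transitiveJets_eq : transitiveJets m = transMap '' transDomain m := by
  ext θ
  constructor
  · rintro ⟨x, Ω, σ, hΩ, hx, hσ, hI, rfl⟩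
    have smooth_σ : ContDiffAt ℝ ∞ σ x.1 := hσ.1.contDiffAt (hΩ.mem_nhds hx)
    obtain ⟨χ, sχ, hχ⟩ := exists_potential hΩ hx
      (η := fun t => connForm (σ t)) (fun t ht => ((contDiffAt_connForm (hσ.2 t ht).2).comp t
        (hσ.1.contDiffAt (hΩ.mem_nhds ht))).contDiffWithinAt)
      fun t ht => closedAt_of_orthIntegrableOn hΩ hσ hI ht
    exact jet_mem_transMap smooth_σ sχ (hσ.2 _ hx) (hχ.mono fun t ht => ht.symm)
  · rintro ⟨p, hp, rfl⟩
    exact mem_transitiveJets (B := fun t => symMat (p.quot t)) (H := fun t => symMat (p.leaf t))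
      (χ := p.pot) (x := p.1) (by fun_prop) (by fun_prop) (by fun_prop)
      (fun _ => symMat_transpose _) (fun _ => symMat_transpose _) hp.1 hp.2

end Transitive

section Congruence

/-- The matrices of a bilinear form in all bases. -/
def congruenceClass (b : M2) : Set M2 := {c | ∃ J : M2, J.det ≠ 0 ∧ c = Jᵀ * b * J}

lemma fderiv_symPart_congruence (b J X : M2) :
    fderiv ℝ (fun J : M2 => symPart (Jᵀ * b * J)) J X = symPart (Xᵀ * b * J + Jᵀ * b * X) := by
  have smooth : ContDiff ℝ ∞ fun J : M2 => symPart (Jᵀ * b * J) :=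
    contDiff_iff_contDiffAt.2 fun _ => by fun_prop
  have line := hasDerivAt_congruence_line (q := fun _ : M2 => b) (x := 0)
    (differentiableAt_const b) J X 0
  simp only [fderiv_const_apply, _root_.zero_apply, Matrix.mul_zero, Matrix.zero_mul,
    add_zero] at line
  exact (hasDerivAt_line (smooth.differentiable (by simp) J) X).unique
    ((LinearMap.toContinuousLinearMap isLinearMap_symPart.mk').hasFDerivAt.comp_hasDerivAt _ line)

/-- Sylvester's law of inertia. -/
lemma isOpen_symMat_preimage_congruenceClass {b : M2} (hb : bᵀ = b) (hd : b.det ≠ 0) :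
    IsOpen (symMat ⁻¹' congruenceClass b) := by
  have smooth : ContDiff ℝ ∞ fun J : M2 => symPart (Jᵀ * b * J) :=
    contDiff_iff_contDiffAt.2 fun _ => by fun_prop
  have isSymm : ∀ J : M2, (Jᵀ * b * J)ᵀ = Jᵀ * b * J := fun J => by
    rw [Matrix.transpose_mul, Matrix.transpose_mul, Matrix.transpose_transpose, hb,
      Matrix.mul_assoc]
  refine isOpen_iff_mem_nhds.2 fun s ⟨J, hJ, hs⟩ => ?_
  obtain rfl : symPart (Jᵀ * b * J) = s := hs ▸ symPart_symMat s
  have surjective : Function.Surjective (fderiv ℝ (fun J : M2 => symPart (Jᵀ * b * J)) J) := by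
    intro s
    have unit : IsUnit (Jᵀ * b).det := isUnit_iff_ne_zero.2 (by simp [hJ, hd])
    refine ⟨(Jᵀ * b)⁻¹ * ((1 / 2 : ℝ) • symMat s), ?_⟩
    have right := Matrix.mul_nonsing_inv_cancel_left _ ((1 / 2 : ℝ) • symMat s) unit
    have left := congrArg Matrix.transpose right
    rw [Matrix.transpose_mul, Matrix.transpose_mul Jᵀ, Matrix.transpose_transpose, hb,
      Matrix.transpose_smul, symMat_transpose, ← Matrix.mul_assoc] at left
    rw [fderiv_symPart_congruence, left, right, ← add_smul, add_halves, one_smul, symPart_symMat]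
  rw [← (smooth.contDiffAt.hasStrictFDerivAt (by simp)).map_nhds_eq_of_surj
    (LinearMap.range_eq_top.2 surjective)]
  have invertible : ∀ᶠ J' in 𝓝 J, J'.det ≠ 0 :=
    continuous_id.matrix_det.continuousAt.eventually_ne hJ
  filter_upwards [Filter.image_mem_map invertible]
  rintro _ ⟨J', hJ', rfl⟩
  exact ⟨J', hJ', symMat_symPart (isSymm J')⟩

end Congruence

section OrderZero

lemma jac_mulVec_left (J : M2) (t : Plane) : jac (fun s => J *ᵥ s) t = J := by
  have linear : HasFDerivAt (fun s => J *ᵥ s) _ t :=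
    (LinearMap.toContinuousLinearMap (Matrix.mulVecLin J)).hasFDerivAt
  rw [jac, linear.fderiv]
  exact LinearMap.toMatrix'_toLin' J

lemma exists_jac_taylor_eq {m : ℕ} (c : Plane) (J : M2) :
    ∃ w : PosIndex m → Plane, jac (taylor ord c w) c = J := by
  have smooth : ContDiff ℝ ∞ fun s : Plane => J *ᵥ s :=
    (LinearMap.toContinuousLinearMap (Matrix.mulVecLin J)).contDiff
  refine ⟨derivsAt (fun s => J *ᵥ s) c, ?_⟩
  have same := (sameJet_taylor_posIndex (m := m) (c := c) smooth.contDiffAt).jac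
    smooth.contDiffAt (contDiff_const.add (contDiff_taylor_right _ _ _)).contDiffAt
  rw [← jac_const_add _ (J *ᵥ c), ← same.eq, jac_mulVec_left]

instance : Unique (MultiIndex 0) where
  default := ⟨(0, 0), Nat.zero_le 0⟩
  uniq _ := Subtype.ext (Prod.ext (Fin.eq_zero _) (Fin.eq_zero _))

lemma jet_zero_eq_iff {σ : Plane → Coeff} {x : Space} {θ : JetSpace 0} :
    jet 0 σ x = θ ↔ x = θ.1 ∧ σ x.1 = jetValue θ := by
  refine ⟨fun h => h ▸ ⟨rfl, rfl⟩, fun ⟨hx, hσ⟩ => Prod.ext hx (funext <| Unique.forall_iff.2 ?_)⟩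
  exact hσ

lemma mem_jetOrbit_zero_iff {θ θ' : JetSpace 0} (hn : Nondeg (jetValue θ)) :
    θ' ∈ jetOrbit 0 θ ↔ Nondeg (jetValue θ') ∧
      qMat (jetValue θ') ∈ congruenceClass (qMat (jetValue θ)) ∧
      hMat (jetValue θ') ∈ congruenceClass (hMat (jetValue θ)) := by
  rw [jetOrbit_eq hn]
  constructor
  · rintro ⟨p, hp, rfl⟩
    refine ⟨nondeg_orbitMap hn hp, ?_⟩
    rw [orbitMap_apply, jetValue_jet]
    refine ⟨⟨_, hp.2, ?_⟩, _, hp.1, ?_⟩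
    · exact (congrArg qMat orbitFamily_base).trans (qMat_pull hn.2 hp.1)
    · exact (congrArg hMat orbitFamily_base).trans (hMat_pull _ _ _ _)
  · rintro ⟨hn', ⟨J, hJ, hq⟩, α, hα, hh⟩
    obtain ⟨w, hw⟩ := exists_jac_taylor_eq (m := 0) θ'.1.1 J
    obtain ⟨w', hw'⟩ := exists_jac_taylor_eq (m := 0) θ'.1.1
      (aMat (jetValue θ') * αᵀ - Jᵀ * aMat (jetValue θ))ᵀ
    refine ⟨(θ'.1, α, w, w'), ⟨hα, hw.symm ▸ hJ⟩, jet_zero_eq_iff.2 ⟨rfl, ?_⟩⟩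
    refine orbitFamily_base.trans ?_
    simp only [OrbitParam.phi, OrbitParam.psi, hw, hw']
    have inv_cancel : αᵀ * (α⁻¹)ᵀ = 1 := by
      rw [← Matrix.transpose_mul, Matrix.nonsing_inv_mul _ (isUnit_iff_ne_zero.2 hα),
        Matrix.transpose_one]
    have key := pull_ofReduced (A := aMat (jetValue θ)) (qMat_transpose (jetValue θ))
      (hMat_transpose (jetValue θ)) hα (J := J)
      (K := (aMat (jetValue θ') * αᵀ - Jᵀ * aMat (jetValue θ))ᵀ)
    rwa [ofReduced_eq hn.2, ← hq, ← hh, Matrix.transpose_transpose, add_sub_cancel,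
      Matrix.mul_assoc, inv_cancel, Matrix.mul_one, ofReduced_eq hn'.2] at key

lemma continuous_jetValue {m : ℕ} : Continuous (jetValue (m := m)) :=
  (continuous_apply _).comp continuous_snd

lemma isOpen_nondeg_jetValue {m : ℕ} : IsOpen {θ : JetSpace m | Nondeg (jetValue θ)} :=
  isOpen_nondeg.preimage continuous_jetValue

theorem isOpen_jetOrbit_zero {θ : JetSpace 0} (hn : Nondeg (jetValue θ)) :
    IsOpen (jetOrbit 0 θ) := by
  obtain ⟨hq, hh⟩ := (nondeg_iff _).1 hn
  have continuousOn : ContinuousOn (fun θ' : JetSpace 0 =>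
      (symPart (qMat (jetValue θ')), symPart (hMat (jetValue θ'))))
      {θ' | Nondeg (jetValue θ')} := fun θ' hn' =>
    (ContinuousAt.prodMk
      (contDiff_symPart.continuous.continuousAt.comp
        ((contDiffAt_qMat hn'.2).continuousAt.comp continuous_jetValue.continuousAt))
      ((contDiff_symPart.continuous.comp
        (contDiff_hMat.continuous.comp continuous_jetValue)).continuousAt)).continuousWithinAt
  convert continuousOn.isOpen_inter_preimage isOpen_nondeg_jetValue
    ((isOpen_symMat_preimage_congruenceClass (qMat_transpose _) hq).prod
      (isOpen_symMat_preimage_congruenceClass (hMat_transpose _) hh)) using 1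
  ext θ'
  rw [mem_jetOrbit_zero_iff hn]
  simp only [Set.mem_inter_iff, Set.mem_ofPred_eq, Set.mem_preimage, Set.mem_prod,
    symMat_symPart (qMat_transpose _), symMat_symPart (hMat_transpose _)]

lemma nondeg_of_mem_transitiveJets {m : ℕ} {θ : JetSpace m} (h : θ ∈ transitiveJets m) :
    Nondeg (jetValue θ) := by
  obtain ⟨x, Ω, σ, -, hx, hσ, -, rfl⟩ := h
  exact hσ.2 _ hx

theorem transitiveJets_zero : transitiveJets 0 = {θ | Nondeg (jetValue θ)} := by
  refine Set.Subset.antisymm (fun _ => nondeg_of_mem_transitiveJets) fun θ hn => ?_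
  obtain ⟨hq, hh⟩ := (nondeg_iff _).1 hn
  set c := jetValue θ
  have mem := mem_transitiveJets (m := 0) (x := θ.1) (χ := fun t => (aMat c)ᵀ *ᵥ t)
    contDiff_const contDiff_const
    (LinearMap.toContinuousLinearMap (Matrix.mulVecLin (aMat c)ᵀ)).contDiff
    (fun _ => qMat_transpose c) (fun _ => hMat_transpose c) hq hh
  simp only [jac_mulVec_left, Matrix.transpose_transpose, ofReduced_eq hh] at mem
  exact (jet_zero_eq_iff.2 ⟨rfl, rfl⟩ : jet 0 (fun _ => c) θ.1 = θ) ▸ mem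

end OrderZero

section RegularCongruence

variable {n : Type*} [Fintype n] [DecidableEq n]

lemma exists_sum_mul_ne_zero {J : Matrix n n ℝ} (hJ : J.det ≠ 0) {v : n → ℝ} {i : n}
    (hi : v i ≠ 0) : ∃ l, ∑ j, J j l * v j ≠ 0 := by
  by_contra! vanish
  exact hi (congrFun (Matrix.eq_zero_of_mulVec_eq_zero (M := Jᵀ)
    (by rwa [Matrix.det_transpose]) (funext vanish)) i)

lemma proportional_iff {h k : M2} (hh : h ≠ 0) :
    (∀ a b c d, h a b * k c d = h c d * k a b) ↔ ∃ r : ℝ, k = r • h := by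
  constructor
  · intro hk
    obtain ⟨a, b, hab⟩ : ∃ a b, h a b ≠ 0 := by
      by_contra! vanish
      exact hh (Matrix.ext vanish)
    refine ⟨k a b / h a b, Matrix.ext fun c d => ?_⟩
    rw [Matrix.smul_apply, smul_eq_mul, div_mul_eq_mul_div, eq_div_iff hab, mul_comm, hk, mul_comm]
  · rintro ⟨r, rfl⟩ a b c d
    simp only [Matrix.smul_apply, smul_eq_mul, mul_left_comm, mul_comm]

lemma trace_adjugate_congruence (h k α : Matrix n n ℝ) :
    ((αᵀ * h * α).adjugate * (αᵀ * k * α)).trace = α.det ^ 2 * (h.adjugate * k).trace := by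
  have cancel : α * ((αᵀ * h * α).adjugate * (αᵀ * k)) = α.det ^ 2 • (h.adjugate * k) := calc
    _ = (α * α.adjugate) * h.adjugate * (αᵀ.adjugate * αᵀ) * k := by
      simp only [Matrix.adjugate_mul_distrib, Matrix.mul_assoc]
    _ = α.det ^ 2 • (h.adjugate * k) := by
      simp only [Matrix.mul_adjugate, Matrix.adjugate_mul, Matrix.det_transpose, Matrix.smul_mul,
        Matrix.mul_smul, one_mul, mul_one, smul_smul, sq]
  rw [← Matrix.mul_assoc, Matrix.trace_mul_comm, cancel, Matrix.trace_smul, smul_eq_mul]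

lemma Regular.sum_smul {h J : M2} {k : Fin 2 → M2} (hr : Regular h k) (hJ : J.det ≠ 0) :
    Regular h fun i => ∑ j, J j i • k j := by
  obtain ⟨⟨i₀, trace_ne_zero⟩, i, a, b, c, d, not_proportional⟩ := hr
  constructor
  · obtain ⟨l, hl⟩ := exists_sum_mul_ne_zero hJ (v := fun j => (h.adjugate * k j).trace)
      trace_ne_zero
    exact ⟨l, by simpa only [Matrix.mul_sum, Matrix.mul_smul, Matrix.trace_sum, Matrix.trace_smul,
      smul_eq_mul] using hl⟩
  · obtain ⟨l, hl⟩ := exists_sum_mul_ne_zero hJ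
      (v := fun j => h a b * k j c d - h c d * k j a b) (sub_ne_zero.2 not_proportional)
    refine ⟨l, a, b, c, d, sub_ne_zero.1 ?_⟩
    simpa only [Matrix.sum_apply, Matrix.smul_apply, smul_eq_mul, Finset.mul_sum,
      ← Finset.sum_sub_distrib, mul_sub, mul_left_comm] using hl

lemma Regular.congruence {h α : M2} {k : Fin 2 → M2} (hr : Regular h k) (hd : h.det ≠ 0)
    (hα : α.det ≠ 0) : Regular (αᵀ * h * α) fun i => αᵀ * k i * α := by
  have ne_zero : ∀ {M : M2}, M.det ≠ 0 → M ≠ 0 := fun hM h0 => hM (h0 ▸ Matrix.det_zero)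
  obtain ⟨⟨i₀, trace_ne_zero⟩, i, a, b, c, d, not_proportional⟩ := hr
  refine ⟨⟨i₀, ?_⟩, i, ?_⟩
  · rw [trace_adjugate_congruence]
    exact mul_ne_zero (pow_ne_zero _ hα) trace_ne_zero
  · by_contra! vanish
    obtain ⟨r, hr⟩ := (proportional_iff (ne_zero (by simp [hd, hα]))).1 vanish
    refine not_proportional ((proportional_iff (ne_zero hd)).2 ⟨r, ?_⟩ a b c d)
    have unit : IsUnit α := (Matrix.isUnit_iff_isUnit_det α).2 (isUnit_iff_ne_zero.2 hα)
    rw [← Matrix.smul_mul, ← Matrix.mul_smul] at hr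
    exact ((Matrix.isUnit_transpose α).2 unit).mul_left_cancel (unit.mul_right_cancel hr)

end RegularCongruence

section Invariance

variable {m : ℕ}

lemma pderiv_comp {M : Plane → M2} {φ : Plane → Plane} {t : Plane}
    (hM : DifferentiableAt ℝ M (φ t)) (hφ : DifferentiableAt ℝ φ t) (i : Fin 2) :
    pderiv i (fun s => M (φ s)) t = ∑ j, jac φ t j i • pderiv j M (φ t) := by
  have chain := congrArg (fun L => L (Pi.single i 1))
    (hM.hasFDerivAt.comp t hφ.hasFDerivAt).fderiv
  exact chain.trans (fderiv_eq_sum_pderiv _ _ _)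

lemma pderiv_congruence {M : Plane → M2} {t : Plane} (hM : DifferentiableAt ℝ M t) (α : M2)
    (i : Fin 2) : pderiv i (fun s => αᵀ * M s * α) t = αᵀ * pderiv i M t * α :=
  congrArg (fun L => L (Pi.single i 1)) ((hM.hasFDerivAt.const_mul αᵀ).mul_const' α).fderiv

lemma regularJet_orbitMap {θ : JetSpace (m + 1)} (hn : Nondeg (jetValue θ)) (hr : RegularJet θ)
    {p : OrbitParam (m + 1)} (hp : p ∈ orbitDomain (m + 1)) : RegularJet (orbitMap θ p) := by
  have smooth : ContDiff ℝ ∞ fun t => orbitFamily θ (p, t) :=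
    (contDiff_orbitFamily θ).comp (contDiff_prodMk_right p)
  have differentiable : Differentiable ℝ fun t => hMat (taylorMetric θ t) :=
    ContDiff.differentiable (n := ∞) (by fun_prop) (by simp)
  have differentiable_phi : Differentiable ℝ fun t => θ.1.1 + p.phi t :=
    (contDiff_const.add p.contDiff_phi_apply).differentiable (by simp)
  have base : θ.1.1 + p.phi p.1.1 = θ.1.1 := by rw [p.phi_base, add_zero]
  rw [orbitMap_apply, regularJet_jet_iff (smooth.differentiable (by simp) _)]
  convert ((regularJet_iff.1 hr).sum_smul hp.2).congruence hn.2 hp.1 using 2 with i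
  · exact (congrArg hMat orbitFamily_base).trans (hMat_pull _ _ _ _)
  · simp only [orbitFamily, hMat_pull]
    refine (pderiv_congruence ((differentiable _).comp _ (differentiable_phi _)) _ i).trans ?_
    refine congrArg (fun M => p.2.1ᵀ * M * p.2.1)
      ((pderiv_comp (differentiable _) (differentiable_phi _) i).trans ?_)
    simp only [jac_const_add, base]

lemma orbitMap_jet {σ : Plane → Coeff} (hσ : ContDiff ℝ ∞ σ) (x : Space) (p : OrbitParam m) :
    orbitMap (jet m σ x) p
      = jet m (fun t => pull (jac p.phi t) (jac p.psi t) p.2.1 (σ (x.1 + p.phi t))) p.1 := by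
  have smooth_phi : ContDiff ℝ ∞ fun t => x.1 + p.phi t :=
    contDiff_const.add p.contDiff_phi_apply
  have smooth_jac_phi := contDiffAt_jac (p.contDiff_phi_apply.contDiffAt (x := p.1.1))
  have smooth_jac_psi := contDiffAt_jac (p.contDiff_psi_apply.contDiffAt (x := p.1.1))
  have smooth_taylor := contDiff_taylorMetric (jet m σ x)
  have base : x.1 + p.phi p.1.1 = x.1 := by rw [p.phi_base, add_zero]
  have sameJet : SameJet m (fun t => taylorMetric (jet m σ x) (x.1 + p.phi t))
      (fun t => σ (x.1 + p.phi t)) p.1.1 :=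
    (base.symm ▸ (sameJet_taylorMetric hσ.contDiffAt).symm :
      SameJet m (taylorMetric (jet m σ x)) σ (x.1 + p.phi p.1.1)).comp
      (φ := fun t => x.1 + p.phi t) (SameJet.refl _ _ _) smooth_taylor.contDiffAt hσ.contDiffAt
      smooth_phi.contDiffAt smooth_phi.contDiffAt
  rw [orbitMap_apply]
  exact (jet_eq_jet_iff
    (contDiffAt_pull smooth_jac_phi smooth_jac_psi contDiffAt_const
      (smooth_taylor.comp smooth_phi).contDiffAt)
    (contDiffAt_pull smooth_jac_phi smooth_jac_psi contDiffAt_const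
      (hσ.comp smooth_phi).contDiffAt)).2
    ((SameJet.refl _ _ _).pull (SameJet.refl _ _ _) sameJet p.2.1 smooth_jac_phi smooth_jac_phi
      smooth_jac_psi smooth_jac_psi (smooth_taylor.comp smooth_phi).contDiffAt
      (hσ.comp smooth_phi).contDiffAt)

lemma jac_mulVec_comp_add {χ φ ψ : Plane → Plane} (sχ : Differentiable ℝ χ)
    (sφ : Differentiable ℝ φ) (sψ : Differentiable ℝ ψ) (β : M2) (t : Plane) :
    jac (fun s => β *ᵥ (χ (φ s) + ψ s)) t = β * (jac χ (φ t) * jac φ t + jac ψ t) := by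
  have chain : HasFDerivAt (fun s => β *ᵥ (χ (φ s) + ψ s)) _ t :=
    (LinearMap.toContinuousLinearMap (Matrix.mulVecLin β)).hasFDerivAt.comp t
      (((sχ (φ t)).hasFDerivAt.comp t (sφ t).hasFDerivAt).add (sψ t).hasFDerivAt)
  refine Matrix.ext_of_mulVec_single fun i => ?_
  rw [jac_mulVec, chain.fderiv, ← Matrix.mulVec_mulVec, Matrix.add_mulVec, ← Matrix.mulVec_mulVec,
    jac_mulVec, jac_mulVec, jac_mulVec]
  rfl

lemma pull_ofReduced_exact {χ φ ψ : Plane → Plane} (sχ : Differentiable ℝ χ)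
    (sφ : Differentiable ℝ φ) (sψ : Differentiable ℝ ψ) {B H α : M2} (hB : Bᵀ = B) (hH : Hᵀ = H)
    (hα : α.det ≠ 0) (t : Plane) :
    pull (jac φ t) (jac ψ t) α (ofReduced B (jac χ (φ t))ᵀ H) =
      ofReduced ((jac φ t)ᵀ * B * jac φ t) (jac (fun s => α⁻¹ *ᵥ (χ (φ s) + ψ s)) t)ᵀ
        (αᵀ * H * α) := by
  rw [pull_ofReduced hB hH hα, jac_mulVec_comp_add sχ sφ sψ]
  simp only [Matrix.transpose_mul, Matrix.transpose_add]

theorem orbitMap_mem_transitiveJets {θ : JetSpace m} (hθ : θ ∈ transitiveJets m)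
    {p : OrbitParam m} (hp : p ∈ orbitDomain m) : orbitMap θ p ∈ transitiveJets m := by
  rw [transitiveJets_eq] at hθ
  obtain ⟨q, hq, rfl⟩ := hθ
  have ⟨det_quot, det_leaf⟩ : (symMat (q.quot q.1.1)).det ≠ 0 ∧ (symMat (q.leaf q.1.1)).det ≠ 0 :=
    hq
  have smooth_phi : ContDiff ℝ ∞ fun t => q.1.1 + p.phi t :=
    contDiff_const.add p.contDiff_phi_apply
  have smooth_psi := p.contDiff_psi_apply
  have smooth_pot : ContDiff ℝ ∞ q.pot := by fun_prop
  have : ContDiff ℝ ∞ (jac p.phi) :=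
    contDiff_iff_contDiffAt.2 fun t => contDiffAt_jac p.contDiff_phi_apply.contDiffAt
  have base : q.1.1 + p.phi p.1.1 = q.1.1 := by rw [p.phi_base, add_zero]
  have mem := mem_transitiveJets (m := m) (x := p.1)
    (B := fun t => (jac p.phi t)ᵀ * symMat (q.quot (q.1.1 + p.phi t)) * jac p.phi t)
    (H := fun t => p.2.1ᵀ * symMat (q.leaf (q.1.1 + p.phi t)) * p.2.1)
    (χ := fun t => p.2.1⁻¹ *ᵥ (q.pot (q.1.1 + p.phi t) + p.psi t))
    (contDiff_iff_contDiffAt.2 fun t => by fun_prop)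
    (contDiff_iff_contDiffAt.2 fun t => by fun_prop)
    ((LinearMap.toContinuousLinearMap (Matrix.mulVecLin p.2.1⁻¹)).contDiff.comp
      ((smooth_pot.comp smooth_phi).add smooth_psi))
    (fun t => by simp [Matrix.mul_assoc, symMat_transpose])
    (fun t => by simp [Matrix.mul_assoc, symMat_transpose])
    (by simp [base, hp.2, det_quot]) (by simp [base, hp.1, det_leaf])
  convert mem using 1
  refine (orbitMap_jet (contDiff_transFamily.comp (contDiff_prodMk_right q)) _ p).trans ?_
  congr 1
  funext t
  have exact := pull_ofReduced_exact (smooth_pot.differentiable (by simp))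
    (smooth_phi.differentiable (by simp)) (smooth_psi.differentiable (by simp))
    (symMat_transpose (q.quot (q.1.1 + p.phi t))) (symMat_transpose (q.leaf (q.1.1 + p.phi t)))
    hp.1 t
  rwa [jac_const_add] at exact

end Invariance

section RegularPerturbation

lemma exists_symm_regular {h : M2} (hs : hᵀ = h) (hd : h.det ≠ 0) :
    ∃ K : M2, Kᵀ = K ∧ Regular h fun _ => K := by
  have symm : h 1 0 = h 0 1 := congrFun (congrFun hs 0) 1
  have transpose_of : ∀ a b c : ℝ, (!![a, b; b, c] : M2)ᵀ = !![a, b; b, c] := fun a b c => by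
    ext i j
    fin_cases i <;> fin_cases j <;> rfl
  have trace_eq : ∀ a b c : ℝ, (h.adjugate * !![a, b; b, c]).trace
      = h 1 1 * a - 2 * h 0 1 * b + h 0 0 * c := fun a b c => by
    simp only [Matrix.adjugate_fin_two, Matrix.trace_fin_two, Matrix.mul_apply, Fin.sum_univ_two,
      Matrix.of_apply, Matrix.cons_val', Matrix.cons_val_zero, Matrix.cons_val_one,
      Matrix.cons_val_fin_one, symm]
    ring
  by_cases h00 : h 0 0 = 0
  · by_cases h11 : h 1 1 = 0
    · have h01 : h 0 1 ≠ 0 := fun h01 => hd (by rw [Matrix.det_fin_two, h00, h01]; ring)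
      refine ⟨!![1, 1; 1, 0], transpose_of _ _ _, ⟨0, ?_⟩, 0, 0, 1, 0, 0, ?_⟩
      · simpa [trace_eq, h00, h11] using h01
      · simpa [h00] using h01
    · refine ⟨!![1, 0; 0, 0], transpose_of _ _ _, ⟨0, ?_⟩, 0, 0, 0, 1, 1, ?_⟩
      · simpa [trace_eq] using h11
      · simpa [h00] using Ne.symm h11
  · refine ⟨!![0, 0; 0, 1], transpose_of _ _ _, ⟨0, ?_⟩, 0, 0, 0, 1, 1, ?_⟩
    · simpa [trace_eq] using h00
    · simpa using h00

lemma eventually_add_mul_ne_zero (u : ℝ) {v : ℝ} (hv : v ≠ 0) :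
    ∀ᶠ s in 𝓝[≠] (0 : ℝ), u + s * v ≠ 0 := by
  have eventually_ne : ∀ᶠ s in 𝓝[≠] (0 : ℝ), s ≠ -u / v := by
    rcases eq_or_ne (-u / v) 0 with h | h
    · rw [h]
      exact eventually_mem_nhdsWithin
    · exact (eventually_ne_nhds h.symm).filter_mono nhdsWithin_le_nhds
  filter_upwards [eventually_ne] with s hs zero
  exact hs (by rw [eq_div_iff hv]; linear_combination zero)

lemma Regular.eventually_add_smul {h : M2} {k : Fin 2 → M2} (hr : Regular h k) (l : Fin 2 → M2) :
    ∀ᶠ s in 𝓝[≠] (0 : ℝ), Regular h fun i => l i + s • k i := by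
  obtain ⟨⟨i₀, trace_ne_zero⟩, i, a, b, c, d, not_proportional⟩ := hr
  filter_upwards [eventually_add_mul_ne_zero (h.adjugate * l i₀).trace trace_ne_zero,
    eventually_add_mul_ne_zero (h a b * l i c d - h c d * l i a b)
      (sub_ne_zero.2 not_proportional)] with s trace_ne_zero' not_proportional'
  refine ⟨⟨i₀, ?_⟩, i, a, b, c, d, fun proportional => not_proportional' ?_⟩
  · simpa only [Matrix.mul_add, Matrix.mul_smul, Matrix.trace_add, Matrix.trace_smul,
      smul_eq_mul] using trace_ne_zero'
  · simp only [Matrix.add_apply, Matrix.smul_apply, smul_eq_mul] at proportional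
    linear_combination proportional

end RegularPerturbation

section Density

variable {m : ℕ}

lemma tendsto_add_smul {E : Type*} [NormedAddCommGroup E] [NormedSpace ℝ E] (x v : E) :
    Tendsto (fun s : ℝ => x + s • v) (𝓝[≠] 0) (𝓝 x) := by
  have continuous : Continuous fun s : ℝ => x + s • v := by fun_prop
  simpa using (continuous.tendsto 0).mono_left (nhdsWithin_le_nhds (s := {0}ᶜ))

lemma isOpen_regularJet : IsOpen {θ : JetSpace (m + 1) | RegularJet θ} := by
  have continuous_hMat : ∀ I : MultiIndex (m + 1),
      Continuous fun θ : JetSpace (m + 1) => hMat (θ.2 I) := fun I =>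
    contDiff_hMat.continuous.comp (by fun_prop)
  have hh := continuous_hMat zeroIndex
  have hk := fun i => continuous_hMat (unitIndex i)
  simp only [RegularJet, Regular, Set.ofPred_and, Set.ofPred_exists]
  refine IsOpen.inter (isOpen_iUnion fun i => ?_) (isOpen_iUnion fun i => isOpen_iUnion fun a =>
    isOpen_iUnion fun b => isOpen_iUnion fun c => isOpen_iUnion fun d => ?_)
  · exact isOpen_ne_fun (hh.matrix_adjugate.matrix_mul (hk i)).matrix_trace continuous_const
  · exact isOpen_ne_fun ((hh.matrix_elem a b).mul ((hk i).matrix_elem c d))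
      ((hh.matrix_elem c d).mul ((hk i).matrix_elem a b))

lemma nondeg_subset_closure_regularJet : {θ : JetSpace (m + 1) | Nondeg (jetValue θ)} ⊆
    closure ({θ | Nondeg (jetValue θ)} ∩ {θ | RegularJet θ}) := fun θ hn => by
  obtain ⟨K, hK, regular⟩ := exists_symm_regular (hMat_transpose (jetValue θ)) hn.2
  let v : JetSpace (m + 1) := (0, Function.update (fun _ => (0, 0, symPart K)) zeroIndex 0)
  refine mem_closure_of_tendsto (tendsto_add_smul θ v) ?_
  filter_upwards [regular.eventually_add_smul fun i => hMat (jetPartial i θ)] with s hs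
  have value_eq : jetValue (θ + s • v) = jetValue θ := by simp [jetValue, v]
  have partial_eq : ∀ i, hMat (jetPartial i (θ + s • v)) = hMat (jetPartial i θ) + s • K :=
    fun i => by
      have partial_v : jetPartial i v = (0, 0, symPart K) :=
        Function.update_of_ne (unitIndex_ne_zeroIndex i) 0 fun _ => (0, 0, symPart K)
      calc hMat (jetPartial i (θ + s • v))
          = hMat (jetPartial i θ) + s • hMat (jetPartial i v) := rfl
        _ = hMat (jetPartial i θ) + s • K := by
          rw [partial_v]
          exact congrArg _ (congrArg _ (symMat_symPart hK))
  refine ⟨?_, ?_⟩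
  · rwa [Set.mem_ofPred_eq, value_eq]
  · simpa only [Set.mem_ofPred_eq, RegularJet, value_eq, partial_eq] using hs

namespace TransParam

lemma leaf_base (q : TransParam m) : q.leaf q.1.1 = q.2.2.1 zeroIndex :=
  pderiv_iterate_taylor_apply ord_injective (zeroIndex : MultiIndex m)

lemma pderiv_leaf_base (q : TransParam (m + 1)) (i : Fin 2) :
    pderiv i q.leaf q.1.1 = q.2.2.1 (unitIndex i) := by
  have coefficient := pderiv_iterate_taylor_apply (c := q.1.1) (w := q.2.2.1) ord_injective
    (unitIndex i)
  fin_cases i <;> exact coefficient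

end TransParam

lemma pderiv_symMat {s : Plane → Sym2 (Fin 2) → ℝ} {t : Plane} (hs : DifferentiableAt ℝ s t)
    (i : Fin 2) : pderiv i (fun t => symMat (s t)) t = symMat (pderiv i s t) := by
  have chain := (LinearMap.toContinuousLinearMap isLinearMap_symMat.mk').hasFDerivAt.comp t
    hs.hasFDerivAt
  exact congrArg (fun L => L (Pi.single i 1)) chain.fderiv

lemma regularJet_transMap_iff (q : TransParam (m + 1)) : RegularJet (transMap q) ↔
    Regular (symMat (q.2.2.1 zeroIndex)) fun i => symMat (q.2.2.1 (unitIndex i)) := by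
  have smooth : ContDiff ℝ ∞ fun t => transFamily (q, t) :=
    contDiff_transFamily.comp (contDiff_prodMk_right q)
  have differentiable_leaf : DifferentiableAt ℝ q.leaf q.1.1 :=
    (contDiff_taylor_right _ _ _).differentiable (by simp) _
  have regular_iff : RegularJet (jet (m + 1) (fun t => transFamily (q, t)) q.1) ↔ _ :=
    regularJet_jet_iff (smooth.differentiable (by simp) _)
  simp only [transFamily, hMat_ofReduced (symMat_transpose _), pderiv_symMat differentiable_leaf,
    q.leaf_base, q.pderiv_leaf_base] at regular_iff
  exact regular_iff

lemma transitiveJets_subset_closure_regularJet :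
    transitiveJets (m + 1) ⊆ closure (transitiveJets (m + 1) ∩ {θ | RegularJet θ}) := by
  rw [transitiveJets_eq]
  rintro _ ⟨q, hq, rfl⟩
  obtain ⟨K, hK, regular⟩ := exists_symm_regular (symMat_transpose _) (q.leaf_base ▸ hq.2)
  let v : TransParam (m + 1) := (0, 0, Function.update (fun _ => symPart K) zeroIndex 0, 0)
  have continuous_transMap : Continuous (transMap (m := m + 1)) :=
    (contDiff_jetMap contDiff_transFamily _).continuous
  refine mem_closure_of_tendsto ((continuous_transMap.tendsto q).comp (tendsto_add_smul q v)) ?_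
  filter_upwards [regular.eventually_add_smul fun i => symMat (q.2.2.1 (unitIndex i)),
    (tendsto_add_smul q v).eventually (isOpen_transDomain.mem_nhds hq)] with s hs mem
  refine ⟨⟨_, mem, rfl⟩, (regularJet_transMap_iff _).2 ?_⟩
  have value_eq : (q + s • v).2.2.1 zeroIndex = q.2.2.1 zeroIndex := by simp [v]
  have partial_eq : ∀ i, symMat ((q + s • v).2.2.1 (unitIndex i))
      = symMat (q.2.2.1 (unitIndex i)) + s • K := fun i => by
    have partial_v : v.2.2.1 (unitIndex i) = symPart K :=
      Function.update_of_ne (unitIndex_ne_zeroIndex i) 0 fun _ => symPart K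
    calc symMat ((q + s • v).2.2.1 (unitIndex i))
        = symMat (q.2.2.1 (unitIndex i)) + s • symMat (v.2.2.1 (unitIndex i)) := rfl
      _ = symMat (q.2.2.1 (unitIndex i)) + s • K := by rw [partial_v, symMat_symPart hK]
  simpa only [value_eq, partial_eq] using hs

end Density

section GenericDimension

variable {m : ℕ}

lemma hasDimension_jetOrbit {θ : JetSpace (m + 1)} (hn : Nondeg (jetValue θ))
    (hr : RegularJet θ) :
    HasDimension (jetOrbit (m + 1) θ) (Module.finrank ℝ (OrbitParam (m + 1))) := by
  rw [jetOrbit_eq hn]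
  exact hasDimension_image isOpen_orbitDomain (contDiff_jetMap (contDiff_orbitFamily θ) _)
    fun _ hp _ => orbitMap_immersion hn hr hp

lemma hasDimension_transitiveJets :
    HasDimension (transitiveJets m) (Module.finrank ℝ (TransParam m)) := by
  rw [transitiveJets_eq]
  exact hasDimension_image isOpen_transDomain (contDiff_jetMap contDiff_transFamily _)
    fun _ hp _ => transMap_immersion hp

lemma transitiveJets_nonempty : (transitiveJets m).Nonempty :=
  ⟨_, mem_transitiveJets (B := fun _ => 1) (H := fun _ => 1) (χ := fun _ => 0) (x := 0)
    contDiff_const contDiff_const contDiff_const (fun _ => Matrix.transpose_one)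
    (fun _ => Matrix.transpose_one) (by simp) (by simp)⟩

lemma card_sym2_fin_two : Fintype.card (Sym2 (Fin 2)) = 3 := by decide

lemma two_mul_card_multiIndex (m : ℕ) :
    2 * Fintype.card (MultiIndex m) = (m + 1) * (m + 2) := by
  let byFirst : MultiIndex m ≃ (p : Fin (m + 1)) × Fin (m + 1 - p) :=
    { toFun := fun I => ⟨I.1.1, I.1.2, by have := I.2; omega⟩
      invFun := fun J => ⟨(J.1, ⟨J.2, by omega⟩), by simp only; omega⟩
      left_inv := fun _ => rfl
      right_inv := fun _ => rfl }
  rw [Fintype.card_congr byFirst, Fintype.card_sigma]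
  simp only [Fintype.card_fin]
  rw [Fin.sum_univ_eq_sum_range fun p => m + 1 - p]
  induction m with
  | zero => rfl
  | succ m ih =>
    simp only [Finset.sum_range_succ' _ (m + 1), Nat.add_sub_add_right, Nat.sub_zero, mul_add, ih]
    ring

lemma card_posIndex_add_one (m : ℕ) :
    Fintype.card (PosIndex m) + 1 = Fintype.card (MultiIndex (m + 1)) := by
  let punctured : PosIndex m ≃ {I : MultiIndex (m + 1) // I ≠ zeroIndex} :=
    { toFun := fun I => ⟨⟨I.1, I.2.2⟩, fun h => by
        have positive : 1 ≤ (ord I).1 + (ord I).2 := I.2.1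
        rw [show ord I = (0, 0) from congrArg ord h] at positive
        omega⟩
      invFun := fun I => ⟨I.1.1, Nat.one_le_iff_ne_zero.2 fun h => I.2 <| ord_injective <|
        Prod.ext (Nat.add_eq_zero_iff.1 h).1 (Nat.add_eq_zero_iff.1 h).2, I.1.2⟩
      left_inv := fun _ => rfl
      right_inv := fun _ => rfl }
  have positive : 0 < Fintype.card (MultiIndex (m + 1)) := Fintype.card_pos_iff.2 ⟨zeroIndex⟩
  rw [Fintype.card_congr punctured]
  exact (congrArg (· + 1) (Set.card_ne_eq zeroIndex)).trans (Nat.sub_add_cancel positive)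

lemma finrank_jetSpace :
    Module.finrank ℝ (JetSpace m) = 4 + 10 * Fintype.card (MultiIndex m) := by
  simp only [Module.finrank_prod, Module.finrank_fintype_fun_eq_card, Module.finrank_pi_fintype,
    Finset.sum_const, Finset.card_univ, Fintype.card_fin, card_sym2_fin_two, smul_eq_mul]
  ring

lemma finrank_orbitParam :
    Module.finrank ℝ (OrbitParam m) = 8 + 4 * Fintype.card (PosIndex m) := by
  simp only [Module.finrank_prod, Module.finrank_matrix, Module.finrank_self,
    Module.finrank_fintype_fun_eq_card, Module.finrank_pi_fintype, Finset.sum_const,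
    Finset.card_univ, Fintype.card_fin, smul_eq_mul]
  ring

lemma finrank_transParam : Module.finrank ℝ (TransParam m)
    = 4 + 6 * Fintype.card (MultiIndex m) + 2 * Fintype.card (PosIndex m) := by
  simp only [Module.finrank_prod, Module.finrank_fintype_fun_eq_card, Module.finrank_pi_fintype,
    Finset.sum_const, Finset.card_univ, Fintype.card_fin, card_sym2_fin_two, smul_eq_mul]
  ring

theorem generic_zero : HasGenericOrbitSpaceDim 0 {θ | Nondeg (jetValue θ)} 0 := by
  refine ⟨transitiveJets_nonempty.mono fun _ => nondeg_of_mem_transitiveJets, _, _, _,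
    hasDimension_of_isOpen isOpen_nondeg_jetValue, ⟨_, isOpen_nondeg_jetValue,
    (Set.inter_self _).symm⟩, subset_closure, fun θ hn θ' hθ' => ?_,
    fun θ hn => hasDimension_of_isOpen (isOpen_jetOrbit_zero hn), rfl⟩
  obtain ⟨p, hp, rfl⟩ := jetOrbit_subset θ hθ'
  exact nondeg_orbitMap hn hp

theorem generic_intransitive (m : ℕ) :
    HasGenericOrbitSpaceDim (m + 1) (intransitiveJets (m + 1)) ((3 * m + 2) * (m + 3)) := by
  rw [intransitiveJets_eq]
  refine ⟨transitiveJets_nonempty.mono fun _ => nondeg_of_mem_transitiveJets, _, _, _,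
    hasDimension_of_isOpen isOpen_nondeg_jetValue, ⟨_, isOpen_regularJet, rfl⟩,
    nondeg_subset_closure_regularJet, fun θ hθ θ' hθ' => ?_,
    fun θ hθ => hasDimension_jetOrbit hθ.1 hθ.2, ?_⟩
  · obtain ⟨p, hp, rfl⟩ := jetOrbit_subset θ hθ'
    exact ⟨nondeg_orbitMap hθ.1 hp, regularJet_orbitMap hθ.1 hθ.2 hp⟩
  · rw [finrank_jetSpace, finrank_orbitParam]
    linarith [two_mul_card_multiIndex (m + 1), two_mul_card_multiIndex (m + 2),
      card_posIndex_add_one (m + 1)]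

theorem generic_transitive (m : ℕ) :
    HasGenericOrbitSpaceDim (m + 1) (transitiveJets (m + 1)) (2 * m ^ 2 + 8 * m + 4) := by
  refine ⟨transitiveJets_nonempty, _, _, _, hasDimension_transitiveJets,
    ⟨_, isOpen_regularJet, rfl⟩, transitiveJets_subset_closure_regularJet,
    fun θ hθ θ' hθ' => ?_,
    fun θ hθ => hasDimension_jetOrbit (nondeg_of_mem_transitiveJets hθ.1) hθ.2, ?_⟩
  · obtain ⟨p, hp, rfl⟩ := jetOrbit_subset θ hθ'
    exact ⟨orbitMap_mem_transitiveJets hθ.1 hp,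
      regularJet_orbitMap (nondeg_of_mem_transitiveJets hθ.1) hθ.2 hp⟩
  · rw [finrank_transParam, finrank_orbitParam]
    linarith [two_mul_card_multiIndex (m + 1), two_mul_card_multiIndex (m + 2),
      card_posIndex_add_one (m + 1)]

end GenericDimension

end GTwo

end

open GTwo in
theorem mainTheorem5_general :
    (HasGenericOrbitSpaceDim 0 (intransitiveJets 0) 0 ∧
      HasGenericOrbitSpaceDim 0 (transitiveJets 0) 0) ∧
    ∀ m : ℕ,
      HasGenericOrbitSpaceDim (m + 1) (intransitiveJets (m + 1)) ((3 * m + 2) * (m + 3)) ∧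
      HasGenericOrbitSpaceDim (m + 1) (transitiveJets (m + 1)) (2 * m ^ 2 + 8 * m + 4) :=
  ⟨⟨intransitiveJets_eq (m := 0) ▸ generic_zero, transitiveJets_zero ▸ generic_zero⟩,
    fun m => ⟨generic_intransitive m, generic_transitive m⟩⟩

theorem mainTheorem5 :
    (GTwo.HasGenericOrbitSpaceDim 0 (GTwo.intransitiveJets 0) 0 ∧
      GTwo.HasGenericOrbitSpaceDim 1 (GTwo.intransitiveJets 1) 6 ∧
      GTwo.HasGenericOrbitSpaceDim 2 (GTwo.intransitiveJets 2) 20) ∧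
    (GTwo.HasGenericOrbitSpaceDim 0 (GTwo.transitiveJets 0) 0 ∧
      GTwo.HasGenericOrbitSpaceDim 1 (GTwo.transitiveJets 1) 4 ∧
      GTwo.HasGenericOrbitSpaceDim 2 (GTwo.transitiveJets 2) 14) :=
  have ⟨⟨intransitive_zero, transitive_zero⟩, higher⟩ := mainTheorem5_general
  ⟨⟨intransitive_zero, (higher 0).1, (higher 1).1⟩, transitive_zero, (higher 0).2, (higher 1).2⟩
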